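/- **Conventions.** All manifolds, maps and actions are smooth. $Spin(n)\subset C_n$ is the spin group in the real Clifford algebra with $v^2=-\|v\|^2$ for $v\in\mathbb R^n$, $Spin^c(n)=(Spin(n)\times U(1))/\{(1,1),(-1,-1)\}$, $\lambda(x)v=xvx^t$ and $\lambda^c[x,z]=\lambda(x)\in SO(n)$ (where $(v_1\cdots v_l)^t=v_l\cdots v_1$). For an oriented Riemannian vector bundle $W\to M$ of rank $r$ with oriented orthonormal frame bundle $SOF(W)$, a *spin$^c$ structure* on $W$ is a principal $Spin^c(r)$-bundle $P\to M$ with a map $\Lambda:P\to SOF(W)$ over $M$ such that $\Lambda(p\cdot s)=\Lambda(p)\circ\lambda^c(s)$. It is *$G$-equivariant* if a Lie group $G$ acts on $P$ and on $W\to M$, $\Lambda$ is equivariant, and the action on $P$ commutes with that of $Spin^c(r)$. A connection 1-form on the principal $U(1)$-bundle $P\to SOF(W)$ has values in $\mathfrak u(1)=i\mathbb R$. For a manifold $M$ of dimension $m$ with a $G$-invariant Riemannian metric, orientation and closed real 2-form $\omega$, a *$G$-equivariant spin$^c$ prequantization* of $(M,\omega)$ is a $G$-equivariant spin$^c$ structure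 $P\to SOF(M)=SOF(TM)\to M$ together with a $G$- and $Spin^c(m)$-invariant connection 1-form $\theta$ on $P\to SOF(M)$ such that $\theta(\zeta_P)=0$ for all $\zeta\in\mathfrak{spin}(m)$ and $d\theta=\pi^*(-i\,\omega)$, where $\zeta_P$ is the vector field generated by $\zeta$ and $\pi:P\to M$ is the projection. **Proposition.** Let $Z$ be an oriented Riemannian manifold of dimension $n\ge 2$ with a closed real 2-form $\omega$. Let a Lie group $G$ and the circle $S^1$ act on $Z$ by orientation preserving, $\omega$-preserving isometries, and let $(P,\theta)$ be a $G$- and $S^1$-equivariant spin$^c$ prequantization of $(Z,\omega)$ (one pair $(P,\theta)$, equivariant for both actions). Assume that the actions of $G$ and $S^1$ commute on $Z$ and on $P$, and that $S^1$ acts freely on $Z$. Let $(\partial/\partial\varphi)_Z$ be the vector field generated by $S^1$, let $V\subset TZ$ be its orthogonal complement, and let $\eta:SOF(V)\to SOF(Z)$ be the map that completes a frame of $V_x$ by the unit vector in the direction of $(\partial/\partial\varphi)_Z$, as last vector; here $V$ is oriented so that $\eta$ takes values in $SOF(Z)$. Let $\eta':\eta^*(P)\to P$ be the pullback of $P\to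 SOF(Z)$ along $\eta$, with the structure group $Spin^c(n-1)\subset Spin^c(n)$, and let $q:\eta^*(P)\to\bar P=\eta^*(P)/S^1$ be the quotient map. Give $Z/S^1$ the quotient manifold structure, the metric for which $V\to T(Z/S^1)$ is fibrewise isometric, and the orientation for which it is orientation preserving, so that $SOF(V)/S^1\cong SOF(Z/S^1)$. Then $\eta^*(P)$ is an embedded submanifold of $P$, $Z/S^1$ and $\bar P$ are quotient manifolds, $\eta^*(P)\to SOF(V)\to Z$ is a $G$- and $S^1$-equivariant spin$^c$ structure on $V$, $\bar P\to SOF(Z/S^1)\to Z/S^1$ is a $G$-equivariant spin$^c$ structure on $Z/S^1$, and: 1. $\theta'=(\eta')^*\theta$ is a connection 1-form on the principal circle bundle $\eta^*(P)\to SOF(V)$; with $\pi:\eta^*(P)\to Z$ the projection, $d\theta'=\pi^*(-i\,\omega)$, and $\theta'(\zeta_{\eta^*(P)})=0$ for all $\zeta\in\mathfrak{spin}(n-1)$. 2. There is a connection 1-form $\bar\theta$ on $\bar P\to SOF(Z/S^1)$ with $\theta'=q^*\bar\theta$ if and only if $\theta'\big((\partial/\partial\varphi)_{\eta^*(P)}\big)=0$.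 In this case there is a 2-form $\bar\omega$ on $Z/S^1$ whose pullback to $Z$ is $\omega$, and, for every such $\bar\theta$, $(\bar P,\bar\theta)$ is a $G$-equivariant spin$^c$ prequantization of $(Z/S^1,\bar\omega)$. -/

import Mathlib

open scoped Manifold ContDiff RealInnerProductSpace

noncomputable section

namespace SpinCPreq

/-- Euclidean space `ℝⁿ`. -/
abbrev Euc (n : ℕ) := EuclideanSpace ℝ (Fin n)

/-! ### The groups `Spin(n)` and `Spinᶜ(n)` -/

/-- Minus the standard inner product on `ℝⁿ`, as the quadratic form `v ↦ -‖v‖²`. -/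
def negForm (n : ℕ) : QuadraticForm ℝ (Euc n) :=
  LinearMap.BilinMap.toQuadraticMap (-(innerₗ (Euc n)))

theorem negForm_apply (n : ℕ) (v : Euc n) : negForm n v = -(⟪v, v⟫) := by
  simp [negForm, LinearMap.BilinMap.toQuadraticMap_apply]

/-- The real Clifford algebra `C_n`, in which `v² = -‖v‖²` for `v ∈ ℝⁿ`. -/
abbrev Cl (n : ℕ) := CliffordAlgebra (negForm n)

/-- `Spin(n) ⊂ C_n`. -/
abbrev Spin (n : ℕ) := spinGroup (negForm n)

/-- The canonical inclusion of `ℝⁿ` in `C_n`. -/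
abbrev vec {n : ℕ} (v : Euc n) : Cl n := CliffordAlgebra.ι (negForm n) v

theorem exists_rot {n : ℕ} (x : Spin n) (v : Euc n) :
    ∃ w : Euc n, vec w = (x : Cl n) * vec v * CliffordAlgebra.reverse (x : Cl n) := by
  have h := spinGroup.conjAct_smul_ι_mem_range_ι (x := spinGroup.toUnits x) x.2 v
  rw [ConjAct.units_smul_def] at h
  obtain ⟨w, hw⟩ := h
  refine ⟨w, hw.trans ?_⟩
  have h2 : star (x : Cl n) = CliffordAlgebra.reverse (x : Cl n) := by
    rw [CliffordAlgebra.star_def, spinGroup.involute_eq x.2]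
  rw [← h2]
  rfl

/-- The action `λ(x) : ℝⁿ → ℝⁿ`, `v ↦ x v xᵗ`, of `x ∈ Spin(n)`; it is the vector `w` with
`w = x v xᵗ` in `C_n`, which exists by `exists_rot` and is unique since `ℝⁿ → C_n` is injective. -/
def rot {n : ℕ} (x : Spin n) (v : Euc n) : Euc n := (exists_rot x v).choose

theorem vec_rot {n : ℕ} (x : Spin n) (v : Euc n) :
    vec (rot x v) = (x : Cl n) * vec v * CliffordAlgebra.reverse (x : Cl n) :=
  (exists_rot x v).choose_spec

/-- The subgroup `K = {(1, 1), (-1, -1)}` of `Spin(n) × U(1)`. -/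
def spinK (n : ℕ) : Subgroup (Spin n × Circle) where
  carrier := {y | ((y.1 : Cl n) = 1 ∧ (y.2 : ℂ) = 1) ∨ ((y.1 : Cl n) = -1 ∧ (y.2 : ℂ) = -1)}
  one_mem' := by left; simp
  mul_mem' := by
    rintro a b (⟨h1, h2⟩ | ⟨h1, h2⟩) (⟨h3, h4⟩ | ⟨h3, h4⟩)
    · left; refine ⟨?_, ?_⟩ <;> simp only [Prod.fst_mul, Prod.snd_mul, Submonoid.coe_mul,
        Circle.coe_mul, h1, h2, h3, h4, mul_one]
    · right; refine ⟨?_, ?_⟩ <;> simp only [Prod.fst_mul, Prod.snd_mul, Submonoid.coe_mul,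
        Circle.coe_mul, h1, h2, h3, h4, one_mul]
    · right; refine ⟨?_, ?_⟩ <;> simp only [Prod.fst_mul, Prod.snd_mul, Submonoid.coe_mul,
        Circle.coe_mul, h1, h2, h3, h4, mul_one]
    · left; refine ⟨?_, ?_⟩ <;> simp only [Prod.fst_mul, Prod.snd_mul, Submonoid.coe_mul,
        Circle.coe_mul, h1, h2, h3, h4, mul_neg, mul_one, neg_neg]
  inv_mem' := by
    rintro a (⟨h1, h2⟩ | ⟨h1, h2⟩)
    · left
      refine ⟨?_, by simp [h2]⟩
      change star (a.1 : Cl n) = 1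
      rw [h1, star_one]
    · right
      refine ⟨?_, by simp [h2]⟩
      change star (a.1 : Cl n) = -1
      rw [h1, star_neg, star_one]

instance spinK_normal (n : ℕ) : (spinK n).Normal where
  conj_mem := by
    intro a ha b
    have h : b * a * b⁻¹ = a := by
      rw [mul_inv_eq_iff_eq_mul]
      apply Prod.ext
      · apply Subtype.ext
        rcases ha with ⟨h1, -⟩ | ⟨h1, -⟩ <;> simp [h1]
      · exact mul_comm _ _
    rwa [h]

/-- `Spinᶜ(n) = (Spin(n) × U(1)) / K`. -/
abbrev SpinC (n : ℕ) := (Spin n × Circle) ⧸ spinK n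

/-- The element `[x, z]` of `Spinᶜ(n)`. -/
def SpinC.mk {n : ℕ} (x : Spin n) (z : Circle) : SpinC n := QuotientGroup.mk (x, z)

/-- For a linear functional `ℓ` on `C_n`, the value `z ℓ(x)` at `[x, z]`. These functions are the
(complex) coordinates of the embedding `[x, z] ↦ z x` of `Spinᶜ(n)` in `C_n ⊗ ℂ`. -/
def SpinC.coeff {n : ℕ} (l : Module.Dual ℝ (Cl n)) (s : SpinC n) : ℂ :=
  Quotient.liftOn' s (fun y : Spin n × Circle => (y.2 : ℂ) * (l (y.1 : Cl n) : ℂ)) (by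
    intro a b hab
    rw [QuotientGroup.leftRel_apply] at hab
    obtain ⟨c, rfl⟩ : ∃ c, b = a * c := ⟨a⁻¹ * b, by group⟩
    rw [inv_mul_cancel_left] at hab
    rcases hab with ⟨h1, h2⟩ | ⟨h1, h2⟩ <;> simp [h1, h2])

/-- `ℝᵏ → ℝᵏ⁺¹`, `v ↦ (v, 0)`. -/
def incl (k : ℕ) : Euc k →ₗ[ℝ] Euc (k + 1) where
  toFun v := WithLp.toLp 2 (Fin.snoc (α := fun _ => ℝ) v 0)
  map_add' u v := by
    ext i
    refine Fin.lastCases ?_ (fun j => ?_) i <;> simp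
  map_smul' c v := by
    ext i
    refine Fin.lastCases ?_ (fun j => ?_) i <;> simp

/-- `ℝᵏ⁺¹ → ℝᵏ`, forgetting the last coordinate. -/
def init (k : ℕ) : Euc (k + 1) →ₗ[ℝ] Euc k where
  toFun v := WithLp.toLp 2 (fun i => v i.castSucc)
  map_add' u v := by ext i; simp
  map_smul' c v := by ext i; simp

theorem inner_incl (k : ℕ) (u v : Euc k) : ⟪incl k u, incl k v⟫ = ⟪u, v⟫ := by
  simp [incl, PiLp.inner_apply, Fin.sum_univ_castSucc]

/-- `incl` as an isometry of quadratic forms. -/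
def inclIsometry (k : ℕ) : negForm k →qᵢ negForm (k + 1) where
  toLinearMap := incl k
  map_app' v := by
    change negForm (k + 1) (incl k v) = negForm k v
    rw [negForm_apply, negForm_apply, inner_incl]

/-- The inclusion of Clifford algebras `C_k → C_{k+1}` extending `ℝᵏ → ℝᵏ⁺¹`. -/
def clIncl (k : ℕ) : Cl k →ₐ[ℝ] Cl (k + 1) := CliffordAlgebra.map (inclIsometry k)

theorem star_clIncl (k : ℕ) (x : Cl k) : star (clIncl k x) = clIncl k (star x) := by
  induction x using CliffordAlgebra.induction with
  | algebraMap r => simp [clIncl, CliffordAlgebra.star_def]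
  | ι v => simp [clIncl]
  | mul a b ha hb => simp [ha, hb]
  | add a b ha hb => simp [ha, hb]

theorem clIncl_mem (k : ℕ) {x : Cl k} (hx : x ∈ spinGroup (negForm k)) :
    clIncl k x ∈ spinGroup (negForm (k + 1)) := by
  obtain ⟨⟨⟨u, hu, rfl⟩, h1, h2⟩, h3⟩ := hx
  refine ⟨⟨⟨Units.map (clIncl k : Cl k →* Cl (k + 1)) u, ?_, rfl⟩, ?_, ?_⟩, ?_⟩
  · have hle : lipschitzGroup (negForm k) ≤
        (lipschitzGroup (negForm (k + 1))).comap (Units.map (clIncl k : Cl k →* Cl (k + 1))) := by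
      unfold lipschitzGroup
      rw [Subgroup.closure_le]
      rintro w ⟨v, hv⟩
      refine Subgroup.subset_closure ⟨incl k v, ?_⟩
      change _ = clIncl k (w : Cl k)
      rw [← hv]
      exact (CliffordAlgebra.map_apply_ι (inclIsometry k) v).symm
    exact hle hu
  · rw [star_clIncl, ← map_mul]
    exact (congrArg (clIncl k) h1).trans (map_one _)
  · rw [star_clIncl, ← map_mul]
    exact (congrArg (clIncl k) h2).trans (map_one _)
  · have h4 : (Units.coeHom (Cl k)) u ∈ CliffordAlgebra.evenOdd (negForm k) 0 := h3
    change clIncl k _ ∈ CliffordAlgebra.evenOdd (negForm (k + 1)) 0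
    clear h3
    generalize (Units.coeHom (Cl k)) u = y at h4
    induction y, h4 using CliffordAlgebra.even_induction with
    | algebraMap r => simpa using SetLike.algebraMap_mem_graded _ _
    | add _ _ _ _ ihx ihy => rw [map_add]; exact add_mem ihx ihy
    | ι_mul_ι_mul m₁ m₂ x hx ih =>
      rw [map_mul, map_mul]
      have e : ∀ m, clIncl k (CliffordAlgebra.ι (negForm k) m) =
        CliffordAlgebra.ι (negForm (k + 1)) (incl k m) :=
        fun m => CliffordAlgebra.map_apply_ι (inclIsometry k) m
      rw [e, e]
      have := SetLike.mul_mem_graded (CliffordAlgebra.ι_mul_ι_mem_evenOdd_zero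
        (negForm (k + 1)) (incl k m₁) (incl k m₂)) ih
      simpa using this

/-- The natural inclusion `Spin(k) → Spin(k+1)`. -/
def spinIncl (k : ℕ) : Spin k →* Spin (k + 1) where
  toFun x := ⟨clIncl k x, clIncl_mem k x.2⟩
  map_one' := Subtype.ext (map_one (clIncl k))
  map_mul' _ _ := Subtype.ext (map_mul (clIncl k) _ _)

/-- The natural inclusion `Spinᶜ(k) → Spinᶜ(k+1)`, `[x, z] ↦ [x, z]`. -/
def spinCIncl (k : ℕ) : SpinC k →* SpinC (k + 1) :=
  QuotientGroup.map (spinK k) (spinK (k + 1))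
    ((spinIncl k).prodMap (MonoidHom.id Circle)) (by
      rintro a (⟨h1, h2⟩ | ⟨h1, h2⟩)
      · left
        exact ⟨(congrArg (clIncl k) h1).trans (map_one _), h2⟩
      · right
        exact ⟨(congrArg (clIncl k) h1).trans (by rw [map_neg, map_one]), h2⟩)

/-! ### Differential forms on a manifold -/

section Forms

/-- `F`-valued differential `r`-forms (not necessarily smooth) on a manifold `M` modelled
on `ℝᵈ`. -/
abbrev DForm (d : ℕ) (M : Type*) [TopologicalSpace M] [ChartedSpace (Euc d) M] (r : ℕ)
    (F : Type*) [NormedAddCommGroup F] [NormedSpace ℝ F] :=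
  ∀ x : M, (TangentSpace (𝓡 d) x) [⋀^Fin r]→L[ℝ] F

variable {d e r : ℕ} {M N : Type*} [TopologicalSpace M] [ChartedSpace (Euc d) M]
  [TopologicalSpace N] [ChartedSpace (Euc e) N]
  {F : Type*} [NormedAddCommGroup F] [NormedSpace ℝ F]

/-- The pullback `f^*α`. -/
def DForm.pullback (f : M → N) (α : DForm e N r F) : DForm d M r F := fun x =>
  (α (f x)).compContinuousLinearMap (mfderiv (𝓡 d) (𝓡 e) f x)

/-- The expression of a form in the preferred chart at `x₀`. -/
def DForm.inChart (α : DForm d M r F) (x₀ : M) (y : Euc d) : (Euc d) [⋀^Fin r]→L[ℝ] F :=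
  (α ((extChartAt (𝓡 d) x₀).symm y)).compContinuousLinearMap
    (mfderiv 𝓘(ℝ, Euc d) (𝓡 d) (extChartAt (𝓡 d) x₀).symm y)

/-- A form is smooth if its expressions in charts are smooth. -/
def DForm.IsSmooth (α : DForm d M r F) : Prop :=
  ∀ x₀ : M, ContDiffOn ℝ ∞ (α.inChart x₀) (extChartAt (𝓡 d) x₀).target

/-- The exterior derivative `dα`, computed at each point in the preferred chart. -/
def DForm.extD (α : DForm d M r F) : DForm d M (r + 1) F := fun x =>
  (extDeriv (α.inChart x) (extChartAt (𝓡 d) x x)).compContinuousLinearMap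
    (mfderiv (𝓡 d) 𝓘(ℝ, Euc d) (extChartAt (𝓡 d) x) x)

/-- The value of a 1-form on the velocity at time `0` of a smooth curve `c`. -/
def DForm.onVelocity (α : DForm d M 1 F) (c : ℝ → M) : F :=
  α (c 0) (fun _ => mfderiv 𝓘(ℝ, ℝ) (𝓡 d) c 0 (1 : ℝ))

end Forms

/-! ### Oriented Riemannian manifolds and their frames -/

section Frames

/-- A (smooth) Riemannian metric on `M`. -/
abbrev RiemMetric (d : ℕ) (M : Type*) [TopologicalSpace M] [ChartedSpace (Euc d) M]
    [IsManifold (𝓡 d) ∞ M] :=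
  Bundle.ContMDiffRiemannianMetric (𝓡 d) ∞ (Euc d) (fun x : M => TangentSpace (𝓡 d) x)

/-- An orientation of a manifold: an orientation of every tangent space, such that around every
point there is a smooth positively oriented local frame. -/
structure ManifoldOrientation (d : ℕ) (M : Type*) [TopologicalSpace M] [ChartedSpace (Euc d) M]
    [IsManifold (𝓡 d) ∞ M] where
  orientation : ∀ x : M, Orientation ℝ (TangentSpace (𝓡 d) x) (Fin d)
  exists_frame : ∀ x₀ : M, ∃ X : Fin d → ∀ x : M, TangentSpace (𝓡 d) x,
    (∀ i, ContMDiffAt (𝓡 d) (𝓡 d).tangent ∞ (fun x => (⟨x, X i x⟩ : TangentBundle (𝓡 d) M)) x₀) ∧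
    ∀ᶠ x in nhds x₀, ∃ b : Module.Basis (Fin d) ℝ (TangentSpace (𝓡 d) x),
      (∀ i, b i = X i x) ∧ b.orientation = orientation x

variable {d : ℕ} {M : Type*} [TopologicalSpace M] [ChartedSpace (Euc d) M]
  [IsManifold (𝓡 d) ∞ M]

/-- `b` is a positively oriented basis of `T_x M`. -/
def ManifoldOrientation.IsPositive (o : ManifoldOrientation d M) (x : M)
    (b : Fin d → TangentSpace (𝓡 d) x) : Prop :=
  ∃ B : Module.Basis (Fin d) ℝ (TangentSpace (𝓡 d) x),
    (∀ i, B i = b i) ∧ B.orientation = o.orientation x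

/-- The fibre `SOF(M)_x`: the oriented orthonormal frames `ℝᵈ → T_x M`. -/
def SOF (g : RiemMetric d M) (o : ManifoldOrientation d M) (x : M) :
    Set (Euc d →ₗ[ℝ] TangentSpace (𝓡 d) x) :=
  {f | (∀ u v, g.inner x (f u) (f v) = ⟪u, v⟫) ∧
    o.IsPositive x (fun i => f (EuclideanSpace.single i 1))}

/-- A group acts by orientation preserving isometries (the differential of each element carries
positively oriented bases to positively oriented bases). -/
structure ActsByOrientedIsometries (G : Type*) [Group G] [MulAction G M]
    (g : RiemMetric d M) (o : ManifoldOrientation d M) : Prop where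
  isometry : ∀ (a : G) (x : M) (u v : TangentSpace (𝓡 d) x),
    g.inner (a • x) (mfderiv (𝓡 d) (𝓡 d) (fun y : M => a • y) x u)
      (mfderiv (𝓡 d) (𝓡 d) (fun y : M => a • y) x v) = g.inner x u v
  positive : ∀ (a : G) (x : M) (b : Fin d → TangentSpace (𝓡 d) x), o.IsPositive x b →
    o.IsPositive (a • x) (fun i => mfderiv (𝓡 d) (𝓡 d) (fun y : M => a • y) x (b i))

end Frames

/-! ### Spinᶜ structures -/

/-- The dimension of a principal `Spinᶜ(r)`-bundle over a `d`-dimensional manifold. -/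
abbrev spinCDim (d r : ℕ) : ℕ := d + r.choose 2 + 1

/-- A spinᶜ structure `P → Q → M` on a principal `SO(r)`-bundle `Q → M` whose fibre over `x` is a
set `Q x` of linear maps `ℝʳ → T_x M` (such as the oriented orthonormal frame bundle of `M` or of an
oriented subbundle of `TM`), `SO(r)` acting by precomposition. The Lie group `Spinᶜ(r)` is an
embedded submanifold of `C_r ⊗ ℂ`, so a map into it is smooth when its coordinates
`SpinC.coeff l` are; and a map out of `P × Spinᶜ(r)` is smooth when it is smooth along all smooth
families of elements of `Spinᶜ(r)`. -/
structure SpinCStructure {d : ℕ} (r : ℕ) {M : Type*} [TopologicalSpace M] [ChartedSpace (Euc d) M]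
    [IsManifold (𝓡 d) ∞ M] (Q : ∀ x : M, Set (Euc r →ₗ[ℝ] TangentSpace (𝓡 d) x))
    (P : Type*) [TopologicalSpace P] [ChartedSpace (Euc (spinCDim d r)) P]
    [IsManifold (𝓡 (spinCDim d r)) ∞ P] where
  /-- the projection `P → M` -/
  proj : P → M
  /-- the principal (right) action of `Spinᶜ(r)` on `P` -/
  act : P → SpinC r → P
  /-- the map `Λ : P → Q` -/
  frame : ∀ p : P, Euc r →ₗ[ℝ] TangentSpace (𝓡 d) (proj p)
  proj_smooth : ContMDiff (𝓡 (spinCDim d r)) (𝓡 d) ∞ proj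
  act_one : ∀ p, act p 1 = p
  act_mul : ∀ p s t, act p (s * t) = act (act p s) t
  act_smooth : ∀ (m : ℕ) (γ : Euc m → SpinC r), (∀ l, ContDiff ℝ ∞ fun t => SpinC.coeff l (γ t)) →
    ContMDiff ((𝓡 (spinCDim d r)).prod (𝓡 m)) (𝓡 (spinCDim d r)) ∞
      (fun y : P × Euc m => act y.1 (γ y.2))
  act_free : ∀ p s t, act p s = act p t → s = t
  fibre : ∀ p p', proj p = proj p' ↔ ∃ s, act p s = p'
  /-- local triviality: near each point there is a smooth local section `σ`, for which the map
  `(x, s) ↦ σ(x) s` has a smooth inverse `p ↦ (proj p, τ p)` -/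
  locally_trivial : ∀ x₀ : M, ∃ U : Set M, IsOpen U ∧ x₀ ∈ U ∧ ∃ (σ : M → P) (τ : P → SpinC r),
    (∀ x ∈ U, proj (σ x) = x) ∧ ContMDiffOn (𝓡 d) (𝓡 (spinCDim d r)) ∞ σ U ∧
    (∀ p, proj p ∈ U → act (σ (proj p)) (τ p) = p) ∧
    ∀ l, ContMDiffOn (𝓡 (spinCDim d r)) 𝓘(ℝ, ℂ) ∞ (fun p => SpinC.coeff l (τ p)) (proj ⁻¹' U)
  frame_mem : ∀ p, frame p ∈ Q (proj p)
  frame_smooth : ∀ v : Euc r, ContMDiff (𝓡 (spinCDim d r)) (𝓡 d).tangent ∞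
    (fun p => (⟨proj p, frame p v⟩ : TangentBundle (𝓡 d) M))
  /-- `Λ (p · [x, z]) = Λ p ∘ λ(x)` -/
  frame_act : ∀ p x z v, (⟨proj (act p (SpinC.mk x z)), frame (act p (SpinC.mk x z)) v⟩ :
    TangentBundle (𝓡 d) M) = ⟨proj p, frame p (rot x v)⟩

section Prequantization

variable {d r : ℕ} {M : Type*} [TopologicalSpace M] [ChartedSpace (Euc d) M]
  [IsManifold (𝓡 d) ∞ M] {Q : ∀ x : M, Set (Euc r →ₗ[ℝ] TangentSpace (𝓡 d) x)}
  {P : Type*} [TopologicalSpace P] [ChartedSpace (Euc (spinCDim d r)) P]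
  [IsManifold (𝓡 (spinCDim d r)) ∞ P]

/-- A left action of a Lie group `G` on `M` and `P` makes `P → Q → M` a `G`-equivariant
spinᶜ structure: the actions are smooth, `P → Q → M` is equivariant (`G` acting on frames through
differentials), and the actions of `G` and `Spinᶜ(r)` on `P` commute. -/
structure SpinCStructure.IsEquivariant (S : SpinCStructure r Q P)
    {E H : Type*} [NormedAddCommGroup E] [NormedSpace ℝ E] [TopologicalSpace H]
    (I : ModelWithCorners ℝ E H) (G : Type*) [TopologicalSpace G] [ChartedSpace H G] [Group G]
    [MulAction G M] [MulAction G P] : Prop where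
  smooth_base : ContMDiffSMul I (𝓡 d) ∞ G M
  smooth_total : ContMDiffSMul I (𝓡 (spinCDim d r)) ∞ G P
  smul_act : ∀ (a : G) (p : P) (s : SpinC r), S.act (a • p) s = a • S.act p s
  proj_smul : ∀ (a : G) (p : P), S.proj (a • p) = a • S.proj p
  frame_smul : ∀ (a : G) (p : P) (v : Euc r),
    (⟨S.proj (a • p), S.frame (a • p) v⟩ : TangentBundle (𝓡 d) M) =
      tangentMap (𝓡 d) (𝓡 d) (fun y : M => a • y) ⟨S.proj p, S.frame p v⟩

/-- `θ` is a connection 1-form on the principal circle bundle `P → Q`, with values in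
`𝔲(1) = iℝ ⊂ ℂ`; the circle acts on `P` through `z ↦ [1, z] ∈ Spinᶜ(r)`. -/
structure SpinCStructure.IsConnection (S : SpinCStructure r Q P)
    (θ : DForm (spinCDim d r) P 1 ℂ) : Prop where
  smooth : θ.IsSmooth
  imaginary : ∀ p v, (θ p v).re = 0
  vertical : ∀ (p : P) (a : ℝ),
    θ.onVelocity (fun t => S.act p (SpinC.mk 1 (Circle.exp (t * a)))) = a * Complex.I
  invariant : ∀ z : Circle, θ.pullback (fun p : P => S.act p (SpinC.mk 1 z)) = θ

/-- `θ(ζ_P) = 0` for all `ζ ∈ 𝔰𝔭𝔦𝔫(r)`; the elements `ζ` are given by the smooth one-parameter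
subgroups of `Spin(r)` that they generate. -/
def SpinCStructure.VanishesOnSpin (S : SpinCStructure r Q P)
    (θ : DForm (spinCDim d r) P 1 ℂ) : Prop :=
  ∀ γ : Multiplicative ℝ →* Spin r,
    (∀ l : Module.Dual ℝ (Cl r), ContDiff ℝ ∞ fun t : ℝ => l (γ (Multiplicative.ofAdd t) : Cl r)) →
    ∀ p : P, θ.onVelocity (fun t => S.act p (SpinC.mk (γ (Multiplicative.ofAdd t)) 1)) = 0

/-- `dθ = π^*(-i ω)`, where `ω` is `form`. -/
def SpinCStructure.HasCurvature (S : SpinCStructure r Q P)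
    (θ : DForm (spinCDim d r) P 1 ℂ) (form : DForm d M 2 ℝ) : Prop :=
  ∀ (p : P) (v : Fin 2 → TangentSpace (𝓡 (spinCDim d r)) p),
    θ.extD p v = -Complex.I * ((DForm.pullback S.proj form p v : ℝ) : ℂ)

/-- `(P, θ)` is a `G`-equivariant spinᶜ prequantization of `(M, ω)`, where `ω`
(called `form`) is a `G`-invariant closed 2-form, with respect to a `G`-invariant Riemannian metric and orientation. -/
structure IsEquivariantPrequantization
    {E H : Type*} [NormedAddCommGroup E] [NormedSpace ℝ E] [TopologicalSpace H]
    (I : ModelWithCorners ℝ E H) (G : Type*) [TopologicalSpace G] [ChartedSpace H G] [Group G]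
    [MulAction G M] (g : RiemMetric d M) (o : ManifoldOrientation d M)
    (form : DForm d M 2 ℝ)
    {P : Type*} [TopologicalSpace P] [ChartedSpace (Euc (spinCDim d d)) P]
    [IsManifold (𝓡 (spinCDim d d)) ∞ P] [MulAction G P]
    (S : SpinCStructure d (SOF g o) P) (θ : DForm (spinCDim d d) P 1 ℂ) : Prop where
  isometries : ActsByOrientedIsometries G g o
  form_smooth : form.IsSmooth
  form_closed : ∀ x, form.extD x = 0
  form_invariant : ∀ a : G, form.pullback (fun x : M => a • x) = form
  equivariant : S.IsEquivariant I G
  connection : S.IsConnection θ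
  invariant : ∀ a : G, θ.pullback (fun p : P => a • p) = θ
  spinC_invariant : ∀ s : SpinC d, θ.pullback (fun p : P => S.act p s) = θ
  vanishesOnSpin : S.VanishesOnSpin θ
  curvature : S.HasCurvature θ form

end Prequantization

/-! ### The normal bundle of a circle action and the quotients by the circle -/

section Normal

/-- The vector field on `M` generated by `∂/∂φ ∈ Lie(S¹)`: the velocity of `t ↦ e^{it} · x`. -/
def generator (d : ℕ) {M : Type*} [TopologicalSpace M] [ChartedSpace (Euc d) M]
    [MulAction Circle M] (x : M) : TangentSpace (𝓡 d) x :=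
  mfderiv 𝓘(ℝ, ℝ) (𝓡 d) (fun t : ℝ => Circle.exp t • x) 0 (1 : ℝ)

variable {k : ℕ} {Z : Type*} [TopologicalSpace Z] [ChartedSpace (Euc (k + 1)) Z]
  [IsManifold (𝓡 (k + 1)) ∞ Z] [MulAction Circle Z]

/-- The unit vector in the direction of the generator. -/
def unitGenerator (g : RiemMetric (k + 1) Z) (x : Z) : TangentSpace (𝓡 (k + 1)) x :=
  (Real.sqrt (g.inner x (generator (k + 1) x) (generator (k + 1) x)))⁻¹ • generator (k + 1) x

/-- The fibre `V_x` of the normal bundle: the orthogonal complement of the generator. -/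
def normalSpace (g : RiemMetric (k + 1) Z) (x : Z) : Submodule ℝ (TangentSpace (𝓡 (k + 1)) x) :=
  LinearMap.ker (g.inner x (generator (k + 1) x) : TangentSpace (𝓡 (k + 1)) x →ₗ[ℝ] ℝ)

/-- The frame `η(f)` of `T_x Z`, for `f : ℝᵏ → T_x Z`: it agrees with `f` on `e_1, …, e_k`, and
sends the last basis vector to the unit vector in the direction of the generator. -/
def eta (g : RiemMetric (k + 1) Z) (x : Z) (f : Euc k →ₗ[ℝ] TangentSpace (𝓡 (k + 1)) x) :
    Euc (k + 1) →ₗ[ℝ] TangentSpace (𝓡 (k + 1)) x :=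
  f ∘ₗ init k +
    (EuclideanSpace.proj (𝕜 := ℝ) (Fin.last k) : Euc (k + 1) →L[ℝ] ℝ).toLinearMap.smulRight
      (unitGenerator g x)

/-- The fibre `SOF(V)_x`, `V` being oriented so that `η` carries its oriented frames to oriented
frames of `Z`. -/
def SOFV (g : RiemMetric (k + 1) Z) (o : ManifoldOrientation (k + 1) Z) (x : Z) :
    Set (Euc k →ₗ[ℝ] TangentSpace (𝓡 (k + 1)) x) :=
  {f | (∀ u, f u ∈ normalSpace g x) ∧ (∀ u v, g.inner x (f u) (f v) = ⟪u, v⟫) ∧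
    eta g x f ∈ SOF g o x}

variable {P : Type*} [TopologicalSpace P] [ChartedSpace (Euc (spinCDim (k + 1) (k + 1))) P]
  [IsManifold (𝓡 (spinCDim (k + 1) (k + 1))) ∞ P]
  {g : RiemMetric (k + 1) Z} {o : ManifoldOrientation (k + 1) Z}

/-- The pullback `η^*(P)` of `P → SOF(Z)` along the injective map `η : SOF(V) → SOF(Z)`, as a
subspace of `P`: the points of `P` lying over `η(SOF(V))`. -/
abbrev EtaPullback (S : SpinCStructure (k + 1) (SOF g o) P) :=
  {p : P // ∃ f ∈ SOFV g o (S.proj p), S.frame p = eta g (S.proj p) f}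

/-- The orbit relation of the circle action on `η^*(P)`. -/
def etaSetoid (S : SpinCStructure (k + 1) (SOF g o) P) [MulAction Circle P] :
    Setoid (EtaPullback S) :=
  (MulAction.orbitRel Circle P).comap Subtype.val

/-- `P̄ = η^*(P) / S¹`. -/
abbrev EtaQuotient (S : SpinCStructure (k + 1) (SOF g o) P) [MulAction Circle P] :=
  Quotient (etaSetoid S)

/-- The quotient map `η^*(P) → P̄`. -/
def etaQuot (S : SpinCStructure (k + 1) (SOF g o) P) [MulAction Circle P] :
    EtaPullback S → EtaQuotient S := Quotient.mk (etaSetoid S)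

/-- `Z / S¹`. -/
abbrev OrbitSpace (Z : Type*) [MulAction Circle Z] := MulAction.orbitRel.Quotient Circle Z

/-- The quotient map `Z → Z / S¹`. -/
def orbitMk (Z : Type*) [MulAction Circle Z] : Z → OrbitSpace Z :=
  Quotient.mk (MulAction.orbitRel Circle Z)

end Normal

end SpinCPreq

end

open SpinCPreq

/-!
# Reduction of equivariant spinᶜ prequantizations by a free circle action

Write `n = k + 1`, and `e` for the last basis vector of `ℝⁿ` (`lastVec`).

**The bundle over the normal frames.** Reading the unit vector along the generator in the frame of a
point of `P` gives a smooth map `frameCoord` from `P` to the unit sphere of `ℝⁿ`, equivariant under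
`Spinᶜ(n)` and invariant under `G` and `S¹`, and `η^*(P)` is its fibre over `e`. In stereographic
coordinates the sphere without `-e` is swept out by a smooth family of elements of `Spin(n)`
(`stereoSpin`) that rotate `e`; rotating a point of `P` back by this family retracts a neighbourhood
of `η^*(P)` onto `η^*(P)` (`etaRetract`). The stabilizer of `e` in `Spin(n)` is `Spin(n - 1)`
(`exists_spinIncl_eq`): an even element of `C_n` that commutes with `e` lies in `C_k`; it induces an
isometry of `ℝᵏ`, which comes from `Pin(k)` by the theorem of Cartan–Dieudonné, and two elements
that induce the same isometry differ by a scalar (`exists_eq_algebraMap`). Hence `η^*(P)` is a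
principal `Spinᶜ(n - 1)`-bundle (`etaSpinC`).

**Manifold structures.** There is one construction for `η^*(P)`, `Z / S¹` and `η^*(P) / S¹`. By
Cartan's argument a smooth idempotent map is a linear projection in suitable charts around a fixed
point (`exists_adapted_chart`), so that a space which is locally a smooth retract of a manifold is a
manifold (`LocalRetract.exists_isManifold`). For a quotient by a free circle action the retractions
come from slices: the first Fourier coefficient of a bump function along the orbits is equivariant
and does not vanish near a given orbit, and its phase is an equivariant map to the circle
(`nonempty_circleSlice`, `exists_isManifold_quotient`).

**Descent to the quotient.** The metric is defined through horizontal lifts (`exists_riemMetric`),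
and the orientation by comparing determinants of normal frames (`exists_orientation`). The frames of
the points of an orbit in `η^*(P)` have the same projection to `Z / S¹`, and local trivializations
of `η^*(P)` and local sections of `Z → Z / S¹` combine to trivializations of the quotient bundle
(`quotSpinC`).

**Forms.** The exterior derivative commutes with pullbacks (`DForm.extD_pullback`), which gives the
statements about the restriction of the connection to `η^*(P)`. A form on the total space of a
circle quotient that is invariant and vanishes on the generator is the pullback of a form on the
base (`IsCircleQuotient.exists_pullback_eq`); the converse holds because the generator is vertical.
If the restricted connection descends, then so does its exterior derivative, which therefore
vanishes on the generator; so does the 2-form on `Z`, which thus descends as well. Pullbacks along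
surjective submersions are injective (`DForm.pullback_injective`), and so the remaining identities
on the quotients can be checked before dividing by the circle.
-/

/-! ### Linearization of smooth idempotents -/

noncomputable section

namespace SpinCPreq

open Set Filter Topology Manifold

section Linearization

variable {V : Type*} [NormedAddCommGroup V] [NormedSpace ℝ V]

theorem fderiv_idempotent {e : V → V} {O : Set V} (hO : IsOpen O) {y₀ : V} (hy₀ : y₀ ∈ O)
    (he : ContDiffOn ℝ ∞ e O) (hfix : e y₀ = y₀)
    (hidem : ∀ y ∈ O, e y ∈ O → e (e y) = e y) (v : V) :
    fderiv ℝ e y₀ (fderiv ℝ e y₀ v) = fderiv ℝ e y₀ v := by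
  have hd : DifferentiableAt ℝ e y₀ :=
    (he.contDiffAt (hO.mem_nhds hy₀)).differentiableAt (by simp)
  have h1 : e ∘ e =ᶠ[𝓝 y₀] e := by
    have : ∀ᶠ y in 𝓝 y₀, e y ∈ O :=
      hd.continuousAt.eventually_mem (by rw [hfix]; exact hO.mem_nhds hy₀)
    filter_upwards [this, hO.mem_nhds hy₀] with y h2 h3 using hidem y h3 h2
  have h2 := h1.fderiv_eq (𝕜 := ℝ)
  rw [fderiv_comp y₀ (by rwa [hfix]) hd, hfix] at h2
  exact congrArg (fun f : V →L[ℝ] V => f v) h2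

/-- Near a fixed point `y₀`, a smooth idempotent `e` is conjugate to its linearization `A` at `y₀`:
the map `h = A ∘ e + (1 - A) ∘ (1 - e)` has derivative `A² + (1 - A)² = 1` at `y₀`, and
`h ∘ e = A ∘ e = A ∘ h`. -/
theorem exists_linearization_of_idempotent [CompleteSpace V] {e : V → V} {O : Set V}
    (hO : IsOpen O) {y₀ : V}
    (hy₀ : y₀ ∈ O) (he : ContDiffOn ℝ ∞ e O) (hfix : e y₀ = y₀)
    (hidem : ∀ y ∈ O, e y ∈ O → e (e y) = e y) :
    ∃ ψ : OpenPartialHomeomorph V V, y₀ ∈ ψ.source ∧ ψ.source ⊆ O ∧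
      ContDiffOn ℝ ∞ ψ ψ.source ∧ ContDiffOn ℝ ∞ ψ.symm ψ.target ∧
      ∀ y ∈ ψ.source, e y ∈ ψ.source → ψ (e y) = fderiv ℝ e y₀ (ψ y) := by
  set A := fderiv ℝ e y₀ with hA
  have hAA : ∀ v, A (A v) = A v := fderiv_idempotent hO hy₀ he hfix hidem
  set h : V → V := fun y => A (e y) + ((y - e y) - A (y - e y)) with hh
  have hsm : ContDiffOn ℝ ∞ h O := by
    have h1 : ContDiffOn ℝ ∞ (fun y => y - e y) O := contDiffOn_id.sub he
    exact (A.contDiff.comp_contDiffOn he).add (h1.sub (A.contDiff.comp_contDiffOn h1))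
  have hd : HasFDerivAt e A y₀ :=
    ((he.contDiffAt (hO.mem_nhds hy₀)).differentiableAt (by simp)).hasFDerivAt
  have hder : HasFDerivAt h ((ContinuousLinearEquiv.refl ℝ V : V ≃L[ℝ] V) : V →L[ℝ] V) y₀ := by
    have h1 : HasFDerivAt (fun y => y - e y) (ContinuousLinearMap.id ℝ V - A) y₀ :=
      (hasFDerivAt_id y₀).sub hd
    have h2 := (A.hasFDerivAt.comp y₀ hd).add (h1.sub (A.hasFDerivAt.comp y₀ h1))
    refine h2.congr_fderiv ?_
    ext v
    simp [hAA]
  have hat := hsm.contDiffAt (hO.mem_nhds hy₀)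
  set ψ₀ := hat.toOpenPartialHomeomorph h hder (by simp) with hψ₀
  -- the locus where `h` stays a local diffeomorphism
  set T : Set V := {y ∈ O | fderiv ℝ h y ∈ range ((↑) : (V ≃L[ℝ] V) → V →L[ℝ] V)} with hT
  have hTo : IsOpen T := by
    have hc : ContinuousOn (fderiv ℝ h) O :=
      (hsm.continuousOn_fderiv_of_isOpen hO (by simp))
    exact hc.isOpen_inter_preimage hO ContinuousLinearEquiv.isOpen
  refine ⟨ψ₀.restr T, ?_, ?_, ?_, ?_, ?_⟩
  · rw [ψ₀.restr_source' _ hTo]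
    exact ⟨hat.mem_toOpenPartialHomeomorph_source hder (by simp), hy₀,
      ⟨_, hder.fderiv.symm⟩⟩
  · rw [ψ₀.restr_source' _ hTo]
    exact fun y hy => hy.2.1
  · rw [ψ₀.restr_source' _ hTo]
    exact hsm.mono fun y hy => hy.2.1
  · intro z hz
    have hz' : z ∈ ψ₀.target ∧ ψ₀.symm z ∈ T := by
      have := (ψ₀.restr T).map_target hz
      rw [ψ₀.restr_source' _ hTo] at this
      refine ⟨?_, this.2⟩
      have h3 := (ψ₀.restr T).right_inv hz
      rw [← h3]
      exact ψ₀.map_source this.1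
    obtain ⟨h1, h2, L, hL⟩ := hz'
    have h4 : ContDiffAt ℝ ∞ h (ψ₀.symm z) := hsm.contDiffAt (hO.mem_nhds h2)
    refine (ψ₀.contDiffAt_symm h1 (f₀' := L) ?_ h4).contDiffWithinAt
    rw [hL]
    exact (h4.differentiableAt (by simp)).hasFDerivAt
  · rw [ψ₀.restr_source' _ hTo]
    intro y hy hey
    have h1 := hidem y hy.2.1 hey.2.1
    change h (e y) = A (h y)
    simp only [hh, h1, sub_self, map_add, map_sub, hAA, add_zero]

/-- A linear projection on a finite-dimensional space is, in suitable linear coordinates, the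
projection of a product onto its first factor. -/
theorem exists_coordinates_of_projection {V W W' : Type*} [NormedAddCommGroup V] [NormedSpace ℝ V]
    [FiniteDimensional ℝ V] [NormedAddCommGroup W] [NormedSpace ℝ W] [FiniteDimensional ℝ W]
    [NormedAddCommGroup W'] [NormedSpace ℝ W'] [FiniteDimensional ℝ W']
    (A : V →L[ℝ] V) (hA : ∀ v, A (A v) = A v)
    (hk : Module.finrank ℝ (LinearMap.ker A.toLinearMap) = Module.finrank ℝ W')
    (hdim : Module.finrank ℝ V = Module.finrank ℝ W + Module.finrank ℝ W') :
    ∃ L : V ≃L[ℝ] W × W', ∀ v, L (A v) = ((L v).1, 0) := by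
  have hcompl : IsCompl (LinearMap.range A.toLinearMap) (LinearMap.ker A.toLinearMap) := by
    constructor
    · rw [Submodule.disjoint_def]
      rintro _ ⟨v, rfl⟩ hv
      have : A (A v) = 0 := hv
      rwa [hA] at this
    · rw [codisjoint_iff, eq_top_iff]
      intro v _
      rw [Submodule.mem_sup]
      refine ⟨A v, ⟨v, rfl⟩, v - A v, ?_, by abel⟩
      change A (v - A v) = 0
      rw [map_sub, hA, sub_self]
  have hr : Module.finrank ℝ (LinearMap.range A.toLinearMap) = Module.finrank ℝ W := by
    have := A.toLinearMap.finrank_range_add_finrank_ker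
    omega
  let α := LinearEquiv.ofFinrankEq _ _ hr
  let β := LinearEquiv.ofFinrankEq _ _ hk
  let E := (Submodule.prodEquivOfIsCompl _ _ hcompl).symm ≪≫ₗ (α.prodCongr β)
  refine ⟨E.toContinuousLinearEquiv, fun v => ?_⟩
  have h1 : (Submodule.prodEquivOfIsCompl _ _ hcompl).symm (A v) =
      ((⟨A v, ⟨v, rfl⟩⟩ : LinearMap.range A.toLinearMap), 0) :=
    Submodule.prodEquivOfIsCompl_symm_apply_left _ _ hcompl ⟨A v, ⟨v, rfl⟩⟩
  have h2 : (Submodule.prodEquivOfIsCompl _ _ hcompl).symm v =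
      ((⟨A v, ⟨v, rfl⟩⟩ : LinearMap.range A.toLinearMap),
        (⟨v - A v, by change A (v - A v) = 0; rw [map_sub, hA, sub_self]⟩ :
          LinearMap.ker A.toLinearMap)) := by
    rw [LinearEquiv.symm_apply_eq, Submodule.coe_prodEquivOfIsCompl']
    simp
  change E (A v) = ((E v).1, 0)
  simp only [E, LinearEquiv.trans_apply, h1, h2, LinearEquiv.prodCongr_apply, map_zero]

end Linearization

section AdaptedChart

variable {m : ℕ} {M : Type*} [TopologicalSpace M] [ChartedSpace (Euc m) M]
  [IsManifold (𝓡 m) ∞ M]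

/-- Cartan's theorem: near a fixed point, a smooth idempotent map of a manifold is a linear
projection in a suitable chart. -/
theorem exists_adapted_chart {d : ℕ} {W : Type*} [NormedAddCommGroup W] [NormedSpace ℝ W]
    [FiniteDimensional ℝ W] {e : M → M} {N : Set M} (hN : IsOpen N) (heN : MapsTo e N N)
    (he : ContMDiffOn (𝓡 m) (𝓡 m) ∞ e N) (hidem : ∀ y ∈ N, e (e y) = e y)
    {m₀ : M} (hm₀ : m₀ ∈ N) (hfix : e m₀ = m₀)
    (hk : Module.finrank ℝ (LinearMap.ker (mfderiv (𝓡 m) (𝓡 m) e m₀).toLinearMap) =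
      Module.finrank ℝ W)
    (hdim : m = d + Module.finrank ℝ W) :
    ∃ Φ ∈ IsManifold.maximalAtlas (𝓡 m) ∞ M, m₀ ∈ Φ.source ∧ Φ.source ⊆ N ∧
      MapsTo e Φ.source Φ.source ∧
      ∃ L : Euc m ≃L[ℝ] Euc d × W, ∀ y ∈ Φ.source, L (Φ (e y)) = ((L (Φ y)).1, 0) := by
  set φ := chartAt (Euc m) m₀ with hφ
  set e' : Euc m → Euc m := φ ∘ e ∘ φ.symm with he'
  have hNe : IsOpen (N ∩ e ⁻¹' φ.source) :=
    he.continuousOn.isOpen_inter_preimage hN φ.open_source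
  set O : Set (Euc m) := φ.target ∩ φ.symm ⁻¹' (N ∩ e ⁻¹' φ.source) with hOdef
  have hO : IsOpen O := φ.isOpen_inter_preimage_symm hNe
  have hm₀φ : m₀ ∈ φ.source := mem_chart_source _ _
  have hsymm : φ.symm (φ m₀) = m₀ := φ.left_inv hm₀φ
  have hy₀ : φ m₀ ∈ O := by
    refine ⟨φ.map_source hm₀φ, ?_⟩
    change φ.symm (φ m₀) ∈ N ∩ e ⁻¹' φ.source
    rw [hsymm]
    refine ⟨hm₀, ?_⟩
    change e m₀ ∈ φ.source
    rwa [hfix]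
  have hsm : ContDiffOn ℝ ∞ e' O := by
    rw [← contMDiffOn_iff_contDiffOn]
    refine (contMDiffOn_chart (I := 𝓡 m) (x := m₀)).comp
      (he.comp ((contMDiffOn_chart_symm (I := 𝓡 m) (x := m₀)).mono ?_) ?_) ?_
    · exact fun y hy => hy.1
    · exact fun y hy => hy.2.1
    · exact fun y hy => hy.2.2
  have hfix' : e' (φ m₀) = φ m₀ := by
    simp only [he', Function.comp_apply, hsymm, hfix]
  have hidem' : ∀ y ∈ O, e' y ∈ O → e' (e' y) = e' y := by
    intro y hy _
    simp only [he', Function.comp_apply]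
    rw [φ.left_inv hy.2.2, hidem _ hy.2.1]
  obtain ⟨ψ, h1, h2, h3, h4, h5⟩ :=
    exists_linearization_of_idempotent hO hy₀ hsm hfix' hidem'
  have hmd : mfderiv (𝓡 m) (𝓡 m) e m₀ = fderiv ℝ e' (φ m₀) := by
    have hd : MDifferentiableAt (𝓡 m) (𝓡 m) e m₀ :=
      (he.contMDiffAt (hN.mem_nhds hm₀)).mdifferentiableAt (by simp)
    rw [hd.mfderiv]
    simp only [writtenInExtChartAt, extChartAt, hfix, mfld_simps, fderivWithin_univ]
    rfl
  obtain ⟨L, hL⟩ := exists_coordinates_of_projection (W := Euc d) (W' := W)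
    (fderiv ℝ e' (φ m₀)) (fderiv_idempotent hO hy₀ hsm hfix' hidem')
    (by rw [← hk, hmd]; rfl) (by simpa using hdim)
  have hΦ : φ.trans ψ ∈ IsManifold.maximalAtlas (𝓡 m) ∞ M := by
    apply OpenPartialHomeomorph.mem_maximalAtlas_of_contMDiffOn
    · exact (contMDiffOn_iff_contDiffOn.2 h3).comp
        ((contMDiffOn_chart (I := 𝓡 m) (x := m₀)).mono (by simp [hφ]))
        (fun y hy => by simpa using hy.2)
    · refine (contMDiffOn_chart_symm (I := 𝓡 m) (x := m₀)).comp
        ((contMDiffOn_iff_contDiffOn.2 h4).mono ?_) ?_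
      · intro y hy
        rw [OpenPartialHomeomorph.trans_target] at hy
        exact hy.1
      · intro y hy
        rw [OpenPartialHomeomorph.trans_target] at hy
        exact hy.2
  set Φ₀ := φ.trans ψ with hΦ₀
  have hsub : ∀ y ∈ Φ₀.source, y ∈ N ∧ y ∈ φ.source ∧ φ y ∈ ψ.source := by
    intro y hy
    rw [hΦ₀, OpenPartialHomeomorph.trans_source] at hy
    have := (h2 hy.2).2.1
    rw [φ.left_inv hy.1] at this
    exact ⟨this, hy.1, hy.2⟩
  -- shrink the chart domain to a set stable under `e`
  set T : Set M := N ∩ e ⁻¹' Φ₀.source with hT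
  have hTo : IsOpen T := he.continuousOn.isOpen_inter_preimage hN Φ₀.open_source
  have hsrc : (Φ₀.restr T).source = Φ₀.source ∩ T := Φ₀.restr_source' _ hTo
  refine ⟨Φ₀.restr T, restr_mem_maximalAtlas _ hΦ hTo, ?_, ?_, ?_, L, ?_⟩
  · rw [hsrc]
    have h6 : m₀ ∈ Φ₀.source := by
      rw [hΦ₀, OpenPartialHomeomorph.trans_source]
      exact ⟨hm₀φ, h1⟩
    have h7 : e m₀ ∈ Φ₀.source := by rwa [hfix]
    exact ⟨h6, hm₀, h7⟩
  · rw [hsrc]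
    exact fun y hy => hy.2.1
  · rw [hsrc]
    intro y hy
    have h6 : e (e y) ∈ Φ₀.source := by
      rw [hidem y hy.2.1]
      exact hy.2.2
    exact ⟨hy.2.2, heN hy.2.1, h6⟩
  · rw [hsrc]
    intro y hy
    obtain ⟨-, h7, h8⟩ := hsub y hy.1
    obtain ⟨-, h9, h10⟩ := hsub (e y) hy.2.2
    have h11 : e' (φ y) = φ (e y) := by
      simp only [he', Function.comp_apply, φ.left_inv h7]
    have h12 := h5 (φ y) h8 (by rwa [h11])
    rw [h11] at h12
    change L (ψ (φ (e y))) = ((L (ψ (φ y))).1, 0)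
    rw [h12, hL]

end AdaptedChart

end SpinCPreq
end

/-! ### Smooth retracts of manifolds -/

noncomputable section

namespace SpinCPreq

open Set Filter Topology Manifold

/-- A presentation of the open subset `dom` of `X` as a retract of the open subset `nhd` of `M`. -/
structure LocalRetract (M X : Type*) [TopologicalSpace M] [TopologicalSpace X] where
  incl : X → M
  retr : M → X
  dom : Set X
  nhd : Set M
  isOpen_dom : IsOpen dom
  isOpen_nhd : IsOpen nhd
  continuousOn_incl : ContinuousOn incl dom
  continuousOn_retr : ContinuousOn retr nhd
  mapsTo_incl : MapsTo incl dom nhd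
  mapsTo_retr : MapsTo retr nhd dom
  retr_incl : ∀ x ∈ dom, retr (incl x) = x

namespace LocalRetract

variable {m d : ℕ} {M : Type*} [TopologicalSpace M] [ChartedSpace (Euc m) M]
  {X : Type*} [TopologicalSpace X]
  {W : Type*} [NormedAddCommGroup W] [NormedSpace ℝ W]

/-- A chart `Φ` of `M` in which the idempotent `incl ∘ retr` is a linear projection induces a chart
of `X`. -/
def chart (R : LocalRetract M X) (Φ : OpenPartialHomeomorph M (Euc m))
    (hN : Φ.source ⊆ R.nhd) (hmaps : MapsTo (R.incl ∘ R.retr) Φ.source Φ.source)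
    (L : Euc m ≃L[ℝ] Euc d × W)
    (hL : ∀ y ∈ Φ.source, L (Φ (R.incl (R.retr y))) = ((L (Φ y)).1, 0)) :
    OpenPartialHomeomorph X (Euc d) where
  toFun x := (L (Φ (R.incl x))).1
  invFun u := R.retr (Φ.symm (L.symm (u, 0)))
  source := R.dom ∩ R.incl ⁻¹' Φ.source
  target := (fun u => L.symm (u, 0)) ⁻¹' Φ.target
  map_source' := by
    intro x hx
    have h := hL (R.incl x) hx.2
    rw [R.retr_incl x hx.1] at h
    change L.symm ((L (Φ (R.incl x))).1, 0) ∈ Φ.target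
    rw [← h, L.symm_apply_apply]
    exact Φ.map_source hx.2
  map_target' := by
    intro u hu
    have hy := Φ.map_target hu
    exact ⟨R.mapsTo_retr (hN hy), hmaps hy⟩
  left_inv' := by
    intro x hx
    have h := hL (R.incl x) hx.2
    rw [R.retr_incl x hx.1] at h
    change R.retr (Φ.symm (L.symm ((L (Φ (R.incl x))).1, 0))) = x
    rw [← h, L.symm_apply_apply, Φ.left_inv hx.2, R.retr_incl x hx.1]
  right_inv' := by
    intro u hu
    have h := hL _ (Φ.map_target hu)
    change (L (Φ (R.incl (R.retr (Φ.symm (L.symm (u, 0))))))).1 = u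
    rw [h, Φ.right_inv hu, L.apply_symm_apply]
  open_source := R.continuousOn_incl.isOpen_inter_preimage R.isOpen_dom Φ.open_source
  open_target := Φ.open_target.preimage (by fun_prop)
  continuousOn_toFun := by
    have h : ContinuousOn (fun x => Φ (R.incl x)) (R.dom ∩ R.incl ⁻¹' Φ.source) :=
      Φ.continuousOn.comp (R.continuousOn_incl.mono inter_subset_left) (fun x hx => hx.2)
    exact (continuous_fst.comp L.continuous).comp_continuousOn h
  continuousOn_invFun := by
    refine R.continuousOn_retr.comp (Φ.symm.continuousOn.comp (Continuous.continuousOn ?_)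
      fun u hu => hu) fun u hu => hN (Φ.map_target hu)
    fun_prop

theorem contMDiffAt_incl_retr {ι : Type*} {R : ι → LocalRetract M X}
    (hsm : ∀ a b, ContMDiffOn (𝓡 m) (𝓡 m) ∞ ((R b).incl ∘ (R a).retr)
      ((R a).nhd ∩ (R a).retr ⁻¹' (R b).dom)) {a b : ι} {y : M} (hy : y ∈ (R a).nhd)
    (hb : (R a).retr y ∈ (R b).dom) :
    ContMDiffAt (𝓡 m) (𝓡 m) ∞ ((R b).incl ∘ (R a).retr) y :=
  (hsm a b).contMDiffAt (((R a).continuousOn_retr.isOpen_inter_preimage (R a).isOpen_nhd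
    (R b).isOpen_dom).mem_nhds ⟨hy, hb⟩)

variable [IsManifold (𝓡 m) ∞ M] [FiniteDimensional ℝ W]

/-- A space that is locally a smooth retract of a manifold, with smooth transitions between the
retracts, is a manifold, the inclusions are immersions and the retractions are submersions. -/
theorem exists_isManifold {ι : Type*} (R : ι → LocalRetract M X) (x : ι → X)
    (hx : ∀ a, x a ∈ (R a).dom) (hcov : Function.Surjective x)
    (hsm : ∀ a b, ContMDiffOn (𝓡 m) (𝓡 m) ∞ ((R b).incl ∘ (R a).retr)
      ((R a).nhd ∩ (R a).retr ⁻¹' (R b).dom))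
    (hk : ∀ a, Module.finrank ℝ (LinearMap.ker (mfderiv (𝓡 m) (𝓡 m)
      ((R a).incl ∘ (R a).retr) ((R a).incl (x a))).toLinearMap) = Module.finrank ℝ W)
    (hdim : m = d + Module.finrank ℝ W) :
    ∃ (_ : ChartedSpace (Euc d) X) (_ : IsManifold (𝓡 d) ∞ X), ∀ a,
      ContMDiffOn (𝓡 d) (𝓡 m) ∞ (R a).incl (R a).dom ∧
      ContMDiffOn (𝓡 m) (𝓡 d) ∞ (R a).retr (R a).nhd ∧
      IsImmersionAtOfComplement W (𝓡 d) (𝓡 m) ∞ (R a).incl (x a) ∧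
      IsSubmersionAtOfComplement W (𝓡 m) (𝓡 d) ∞ (R a).retr ((R a).incl (x a)) := by
  -- charts of `M` in which the idempotents `incl ∘ retr` are linear projections
  have key : ∀ a, ∃ Φ ∈ IsManifold.maximalAtlas (𝓡 m) ∞ M, (R a).incl (x a) ∈ Φ.source ∧
      Φ.source ⊆ (R a).nhd ∧ MapsTo ((R a).incl ∘ (R a).retr) Φ.source Φ.source ∧
      ∃ L : Euc m ≃L[ℝ] Euc d × W, ∀ y ∈ Φ.source,
        L (Φ (((R a).incl ∘ (R a).retr) y)) = ((L (Φ y)).1, 0) := by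
    intro a
    refine exists_adapted_chart (R a).isOpen_nhd
      (fun y hy => (R a).mapsTo_incl ((R a).mapsTo_retr hy)) ((hsm a a).mono
      fun y hy => ⟨hy, (R a).mapsTo_retr hy⟩) (fun y hy => ?_) ((R a).mapsTo_incl (hx a)) ?_
      (hk a) hdim
    · simp only [(R a).retr_incl _ ((R a).mapsTo_retr hy)]
    · simp only [(R a).retr_incl _ (hx a)]
  choose Φ hΦ hmem hN hmaps L hL using key
  let ch : ι → OpenPartialHomeomorph X (Euc d) := fun a =>
    (R a).chart (Φ a) (hN a) (hmaps a) (L a) (hL a)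
  have hch_source : ∀ a, (ch a).source = (R a).dom ∩ (R a).incl ⁻¹' (Φ a).source := fun a => rfl
  have hch_target : ∀ a, (ch a).target = (fun u => (L a).symm (u, 0)) ⁻¹' (Φ a).target :=
    fun a => rfl
  have hch_apply : ∀ a y, ch a y = ((L a) (Φ a ((R a).incl y))).1 := fun a y => rfl
  have hch_symm : ∀ a u, (ch a).symm u = (R a).retr ((Φ a).symm ((L a).symm (u, 0))) :=
    fun a u => rfl
  have hxch : ∀ a, x a ∈ (ch a).source := fun a => ⟨hx a, hmem a⟩
  choose idx hidx using hcov
  let cs : ChartedSpace (Euc d) X :=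
    { atlas := range ch
      chartAt := fun y => ch (idx y)
      mem_chart_source := fun y => by
        have := hxch (idx y)
        rwa [hidx] at this
      chart_mem_atlas := fun y => mem_range_self _ }
  -- smoothness, at a point of the chart domain, of `incl b ∘ (ch a).symm`
  have hincl : ∀ a b, ∀ u ∈ (ch a).target, (ch a).symm u ∈ (R b).dom →
      ContMDiffAt (𝓡 d) (𝓡 m) ∞ (fun u => (R b).incl ((ch a).symm u)) u := by
    intro a b u hu hb
    have h1 : ContMDiffAt (𝓡 d) (𝓡 m) ∞ (fun u => (L a).symm (u, (0 : W))) u :=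
      (ContDiff.contDiffAt (by fun_prop)).contMDiffAt
    have h2 : ContMDiffAt (𝓡 m) (𝓡 m) ∞ (Φ a).symm ((L a).symm (u, 0)) :=
      contMDiffAt_symm_of_mem_maximalAtlas (hΦ a) hu
    have h3 := contMDiffAt_incl_retr hsm (a := a) (b := b)
      (y := (Φ a).symm ((L a).symm (u, 0))) (hN a ((Φ a).map_target hu)) hb
    have h4 : ContMDiffAt (𝓡 d) (𝓡 m) ∞ (fun u => (Φ a).symm ((L a).symm (u, (0 : W)))) u :=
      ContMDiffAt.comp u (g := (Φ a).symm) h2 h1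
    exact ContMDiffAt.comp u (g := (R b).incl ∘ (R a).retr) h3 h4
  have hchart : ∀ a, ∀ y ∈ (Φ a).source,
      ContMDiffAt (𝓡 m) (𝓡 d) ∞ (fun y => ((L a) (Φ a y)).1) y := by
    intro a y hy
    have h1 : ContMDiffAt (𝓡 m) (𝓡 d) ∞ (fun v => ((L a) v).1) (Φ a y) :=
      (ContDiff.contDiffAt (by fun_prop)).contMDiffAt
    exact h1.comp y (contMDiffAt_of_mem_maximalAtlas (hΦ a) hy)
  have ism : IsManifold (𝓡 d) ∞ X := by
    apply isManifold_of_contDiffOn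
    rintro _ _ ⟨a, rfl⟩ ⟨b, rfl⟩ u hu
    have hu' : u ∈ (ch a).target ∧ (ch a).symm u ∈ (ch b).source := by
      simpa [OpenPartialHomeomorph.trans_source] using hu
    have h1 := hincl a b u hu'.1 hu'.2.1
    have h2 := (hchart b _ hu'.2.2).comp u h1
    exact (contMDiffAt_iff_contDiffAt.1 h2).contDiffWithinAt
  have hatlas : ∀ a, ch a ∈ IsManifold.maximalAtlas (𝓡 d) ∞ X := fun a =>
    IsManifold.subset_maximalAtlas (mem_range_self a)
  have hsmi : ∀ a, ContMDiffOn (𝓡 d) (𝓡 m) ∞ (R a).incl (R a).dom := by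
    intro a y hy
    have hyb : y ∈ (ch (idx y)).source := by
      have := hxch (idx y)
      rwa [hidx] at this
    have h1 := hincl (idx y) a (ch (idx y) y) ((ch (idx y)).map_source hyb)
      (by rwa [(ch (idx y)).left_inv hyb])
    have h2 := h1.comp y (contMDiffAt_of_mem_maximalAtlas (hatlas (idx y)) hyb)
    refine (h2.congr_of_eventuallyEq ?_).contMDiffWithinAt
    filter_upwards [(ch (idx y)).open_source.mem_nhds hyb] with z hz
    simp only [Function.comp_apply, (ch (idx y)).left_inv hz]
  have hsmr : ∀ a, ContMDiffOn (𝓡 m) (𝓡 d) ∞ (R a).retr (R a).nhd := by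
    intro a y hy
    obtain ⟨b, hb⟩ : ∃ b, (R a).retr y ∈ (ch b).source :=
      ⟨_, by have := hxch (idx ((R a).retr y)); rwa [hidx] at this⟩
    have h1 := contMDiffAt_incl_retr hsm (a := a) (b := b) hy hb.1
    have h2 := (hchart b _ hb.2).comp y h1
    have hu : ch b ((R a).retr y) ∈ (ch b).target := (ch b).map_source hb
    have h3 : ContMDiffAt (𝓡 d) (𝓡 d) ∞ (ch b).symm (ch b ((R a).retr y)) :=
      contMDiffAt_symm_of_mem_maximalAtlas (hatlas b) hu
    refine ((h3.comp y h2).congr_of_eventuallyEq ?_).contMDiffWithinAt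
    have hc : ContinuousAt (R a).retr y :=
      (R a).continuousOn_retr.continuousAt ((R a).isOpen_nhd.mem_nhds hy)
    filter_upwards [hc.eventually_mem ((ch b).open_source.mem_nhds hb)] with z hz
    exact ((ch b).left_inv hz).symm
  refine ⟨cs, ism, fun a => ⟨hsmi a, hsmr a, ?_, ?_⟩⟩
  · refine IsImmersionAtOfComplement.mk_of_charts (L a).symm (ch a) (Φ a) (hxch a) (hmem a)
      (hatlas a) (hΦ a) (fun y hy => hy.2) ?_
    intro u hu
    have hu' : u ∈ (ch a).target := by simpa using hu
    change Φ a ((R a).incl ((R a).retr ((Φ a).symm ((L a).symm (u, 0))))) = (L a).symm (u, 0)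
    have := hL a _ ((Φ a).map_target hu')
    rw [(Φ a).right_inv hu', (L a).apply_symm_apply] at this
    rw [ContinuousLinearEquiv.eq_symm_apply]
    exact this
  · refine IsSubmersionAtOfComplement.mk_of_charts (L a) (Φ a) (ch a) (hmem a) ?_
      (hΦ a) (hatlas a) (fun y hy => ⟨(R a).mapsTo_retr (hN a hy), hmaps a hy⟩) ?_
    · rw [(R a).retr_incl _ (hx a)]
      exact hxch a
    · intro v hv
      have hv' : v ∈ (Φ a).target := by simpa using hv
      change ((L a) (Φ a ((R a).incl ((R a).retr ((Φ a).symm v))))).1 = ((L a) v).1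
      have := hL a _ ((Φ a).map_target hv')
      rw [(Φ a).right_inv hv'] at this
      have h := congrArg Prod.fst this
      exact h

end LocalRetract

/-- If `p = Ψ (e p, F p)` near `m₀`, where `Ψ (m₀, ·)` is a local section of `F` contained in the
fibre of `e` through `m₀`, then the kernel of `de` at `m₀` is the tangent space of that fibre. -/
theorem finrank_ker_mfderiv {m : ℕ} {M : Type*} [TopologicalSpace M] [ChartedSpace (Euc m) M]
    {W : Type*} [NormedAddCommGroup W] [NormedSpace ℝ W]
    {e : M → M} {F : M → W} {Ψ : M × W → M} {m₀ : M} (hfix : e m₀ = m₀)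
    (he : MDifferentiableAt (𝓡 m) (𝓡 m) e m₀) (hF : MDifferentiableAt (𝓡 m) 𝓘(ℝ, W) F m₀)
    (hΨ : MDifferentiableAt ((𝓡 m).prod 𝓘(ℝ, W)) (𝓡 m) Ψ (m₀, F m₀))
    (hdec : ∀ᶠ p in 𝓝 m₀, Ψ (e p, F p) = p)
    (hsec : ∀ᶠ w in 𝓝 (F m₀), F (Ψ (m₀, w)) = w)
    (hfib : ∀ᶠ w in 𝓝 (F m₀), e (Ψ (m₀, w)) = m₀) :
    Module.finrank ℝ (LinearMap.ker (mfderiv (𝓡 m) (𝓡 m) e m₀).toLinearMap) =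
      Module.finrank ℝ W := by
  have hΨ0 : Ψ (m₀, F m₀) = m₀ := by
    have := hdec.self_of_nhds
    rwa [hfix] at this
  set j : W → M := fun w => Ψ (m₀, w) with hj
  have hjd : MDifferentiableAt 𝓘(ℝ, W) (𝓡 m) j (F m₀) :=
    hΨ.comp (F m₀) ((mdifferentiableAt_const (c := m₀)).prodMk mdifferentiableAt_id)
  have hj0 : j (F m₀) = m₀ := hΨ0
  set J : W →L[ℝ] Euc m := mfderiv 𝓘(ℝ, W) (𝓡 m) j (F m₀) with hJ
  set A : Euc m →L[ℝ] Euc m := mfderiv (𝓡 m) (𝓡 m) e m₀ with hA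
  set D : Euc m →L[ℝ] W := mfderiv (𝓡 m) 𝓘(ℝ, W) F m₀ with hD
  -- `D` and `J` are inverse isomorphisms between the kernel of `A` and `W`
  have hDJ : ∀ w, D (J w) = w := by
    intro w
    have h1 : F ∘ j =ᶠ[𝓝 (F m₀)] id := hsec
    have h2 := h1.mfderiv_eq (I := 𝓘(ℝ, W)) (I' := 𝓘(ℝ, W))
    rw [mfderiv_comp (F m₀) (by rwa [hj0]) hjd, mfderiv_id] at h2
    have h3 : ∀ m', m' = m₀ → mfderiv (𝓡 m) 𝓘(ℝ, W) F m' (J w) = D (J w) := by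
      rintro _ rfl
      rfl
    exact (h3 _ hj0).symm.trans (congrArg (fun f : W →L[ℝ] W => f w) h2)
  have hAJ : ∀ w, A (J w) = 0 := by
    intro w
    have h1 : e ∘ j =ᶠ[𝓝 (F m₀)] fun _ => m₀ := hfib
    have h2 := h1.mfderiv_eq (I := 𝓘(ℝ, W)) (I' := 𝓡 m)
    rw [mfderiv_comp (F m₀) (by rwa [hj0]) hjd, mfderiv_const] at h2
    have h3 : ∀ m', m' = m₀ → mfderiv (𝓡 m) (𝓡 m) e m' (J w) = A (J w) := by
      rintro _ rfl
      rfl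
    exact (h3 _ hj0).symm.trans (congrArg (fun f : W →L[ℝ] Euc m => f w) h2)
  have hker : ∀ v, A v = 0 → v = J (D v) := by
    intro v hv
    have h1 : Ψ ∘ (fun p => (e p, F p)) =ᶠ[𝓝 m₀] id := hdec
    have h2 := h1.mfderiv_eq (I := 𝓡 m) (I' := 𝓡 m)
    rw [mfderiv_comp m₀ (I' := (𝓡 m).prod 𝓘(ℝ, W)) (by rwa [hfix]) (he.prodMk hF), mfderiv_id,
      he.mfderiv_prod hF] at h2
    have h3 : ∀ m', m' = m₀ → mfderiv ((𝓡 m).prod 𝓘(ℝ, W)) (𝓡 m) Ψ (m', F m₀) (A v, D v) =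
        mfderiv ((𝓡 m).prod 𝓘(ℝ, W)) (𝓡 m) Ψ (m₀, F m₀) (A v, D v) := by
      rintro _ rfl
      rfl
    have h4 : mfderiv ((𝓡 m).prod 𝓘(ℝ, W)) (𝓡 m) Ψ (m₀, F m₀) (A v, D v) = v :=
      (h3 _ hfix).symm.trans (congrArg (fun f : Euc m →L[ℝ] Euc m => f v) h2)
    have h5 := mfderiv_prod_eq_add_apply hΨ (v := (A v, D v))
    rw [hv] at h4 h5
    refine h4.symm.trans (h5.trans ?_)
    erw [ContinuousLinearMap.map_zero, zero_add]
    rfl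
  have e' : LinearMap.ker A.toLinearMap ≃ₗ[ℝ] W := by
    refine LinearEquiv.ofBijective (D.toLinearMap ∘ₗ (LinearMap.ker A.toLinearMap).subtype)
      ⟨fun v w h => ?_, fun w => ⟨⟨J w, hAJ w⟩, hDJ w⟩⟩
    have h' : D v = D w := h
    apply Subtype.ext
    rw [hker v v.2, hker w w.2, h']
  exact e'.finrank_eq

end SpinCPreq
end

/-! ### Slices and quotients of free circle actions -/

noncomputable section

namespace SpinCPreq

open Set Filter Topology Manifold

section ParametricIntegral

open MeasureTheory Convolution

/-- The integral over an interval of a smooth family of functions is smooth in the parameter: it is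
the value at `0` of the convolution of an indicator function with a smoothly cut off family. -/
theorem contDiffOn_intervalIntegral {V F : Type*} [NormedAddCommGroup V] [NormedSpace ℝ V]
    [NormedAddCommGroup F] [NormedSpace ℝ F] [CompleteSpace F] {g : V → ℝ → F} {s : Set V}
    (hs : IsOpen s)
    (hg : ContDiffOn ℝ ∞ (fun y : V × ℝ => g y.1 y.2) (s ×ˢ univ)) {a b : ℝ} (hab : a ≤ b) :
    ContDiffOn ℝ ∞ (fun v => ∫ t in a..b, g v t) s := by
  let R : ℝ := |a| + |b| + 1
  have hR : 0 < R := by positivity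
  let ψ : ContDiffBump (0 : ℝ) := ⟨R, R + 1, hR, by linarith⟩
  let f : ℝ → ℝ := indicator (Ioc a b) (fun _ => 1)
  let g' : V → ℝ → F := fun v τ => ψ τ • g v (-τ)
  have hf : LocallyIntegrable f volume :=
    ((integrable_indicator_iff measurableSet_Ioc).2 (by simp)).locallyIntegrable
  have h := contDiffOn_convolution_right_with_param_comp (μ := (volume : Measure ℝ)) (n := ⊤)
    (ContinuousLinearMap.lsmul ℝ ℝ : ℝ →L[ℝ] F →L[ℝ] F)
    (v := fun _ : V => (0 : ℝ)) (s := s) contDiffOn_const (f := f) (g := g')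
    (k := Metric.closedBall 0 (R + 1)) hs (isCompact_closedBall _ _) ?_ hf ?_
  · refine h.congr fun v _ => ?_
    rw [convolution_def, intervalIntegral.integral_of_le hab,
      ← integral_indicator measurableSet_Ioc]
    congr 1
    ext t
    by_cases ht : t ∈ Ioc a b
    · have h1 : ψ (0 - t) = 1 := by
        apply ψ.one_of_mem_closedBall
        rw [mem_closedBall_zero_iff, zero_sub, norm_neg, Real.norm_eq_abs]
        change |t| ≤ |a| + |b| + 1
        rw [abs_le]
        constructor
        · have := neg_abs_le a; have := abs_nonneg b; linarith [ht.1]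
        · have := le_abs_self b; have := abs_nonneg a; linarith [ht.2]
      simp only [f, g', indicator_of_mem ht, one_smul, ContinuousLinearMap.lsmul_apply,
        zero_sub, neg_neg]
      rw [zero_sub] at h1
      rw [h1, one_smul]
    · simp only [f, indicator_of_notMem ht, ContinuousLinearMap.lsmul_apply, zero_smul]
  · intro v t _ ht
    have h1 : ψ t = 0 := by
      apply ψ.zero_of_le_dist
      change R + 1 ≤ _
      rw [Metric.mem_closedBall] at ht
      exact (not_le.1 ht).le
    simp only [g', h1, zero_smul]
  · have h1 : ContDiffOn ℝ ∞ (fun y : V × ℝ => g y.1 (-y.2)) (s ×ˢ univ) :=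
      hg.comp (f := fun y : V × ℝ => (y.1, -y.2)) (ContDiff.contDiffOn (by fun_prop))
        (fun y hy => ⟨hy.1, mem_univ _⟩)
    exact (ContDiff.contDiffOn (ψ.contDiff.comp contDiff_snd)).smul h1

end ParametricIntegral

section CircleValued

/-- The point `w / |w|` of the circle (and `1` if `w = 0`). -/
def toCircle (w : ℂ) : Circle := Circle.exp w.arg

theorem norm_mul_toCircle (w : ℂ) : (‖w‖ : ℂ) * (toCircle w : ℂ) = w := by
  rw [toCircle, Circle.coe_exp, Complex.norm_mul_exp_arg_mul_I]

theorem toCircle_mul (c : Circle) {w : ℂ} (hw : w ≠ 0) :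
    toCircle (c * w) = c * toCircle w := by
  have h1 := norm_mul_toCircle (c * w)
  have h2 : ‖(c : ℂ) * w‖ = ‖w‖ := by rw [norm_mul, Circle.norm_coe, one_mul]
  apply Circle.ext
  have h3 : (‖w‖ : ℂ) ≠ 0 := by simpa using hw
  apply mul_left_cancel₀ h3
  rw [h2] at h1
  rw [h1, Circle.coe_mul, mul_left_comm, norm_mul_toCircle]

theorem contMDiffAt_toCircle {w : ℂ} (hw : w ≠ 0) :
    ContMDiffAt 𝓘(ℝ, ℂ) (𝓡 1) ∞ toCircle w := by
  -- rotate `w` to the positive real axis, where the argument is smooth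
  set c : Circle := (toCircle w)⁻¹ with hc
  have hcw : (c : ℂ) * w = (‖w‖ : ℂ) := by
    conv_lhs => rw [← norm_mul_toCircle w, mul_left_comm, ← Circle.coe_mul, hc, inv_mul_cancel,
      Circle.coe_one, mul_one]
  have h1 : ContDiffAt ℝ ∞ (fun y : ℂ => (Complex.log (c * y)).im) w := by
    have h2 : ContDiffAt ℝ ∞ Complex.log ((c : ℂ) * w) := by
      refine (Complex.contDiffAt_log ?_).restrict_scalars ℝ
      rw [hcw, Complex.ofReal_mem_slitPlane]
      exact norm_pos_iff.2 hw
    exact Complex.imCLM.contDiff.contDiffAt.comp w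
      (h2.comp w (contDiffAt_const.mul contDiffAt_id))
  have h1' : ContMDiffAt 𝓘(ℝ, ℂ) 𝓘(ℝ, ℝ) ∞ (fun y : ℂ => Complex.arg (c * y)) w := by
    simpa only [Complex.log_im] using h1.contMDiffAt
  have h3 : ContMDiffAt 𝓘(ℝ, ℂ) (𝓡 1) ∞ (fun y : ℂ => c⁻¹ * toCircle (c * y)) w :=
    contMDiffAt_const.mul (contMDiff_circleExp.contMDiffAt.comp w h1')
  refine h3.congr_of_eventuallyEq ?_
  filter_upwards [isOpen_ne.mem_nhds hw] with y hy
  rw [toCircle_mul c hy, inv_mul_cancel_left]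

variable {E H M : Type*} [NormedAddCommGroup E] [NormedSpace ℝ E] [TopologicalSpace H]
  {I : ModelWithCorners ℝ E H} [TopologicalSpace M] [ChartedSpace H M]

attribute [local instance] finrank_real_complex_fact'

theorem contMDiff_circle_coe : ContMDiff (𝓡 1) 𝓘(ℝ, ℂ) ∞ (fun c : Circle => (c : ℂ)) :=
  contMDiff_coe_sphere (E := ℂ) (n := 1)

end CircleValued

section Fourier

variable {M : Type*} [MulAction Circle M]

/-- The Fourier coefficient of `f` along the orbits of the circle. -/
def orbitFourier (f : M → ℝ) (z : M) : ℂ :=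
  ∫ t in (-Real.pi)..Real.pi, (Circle.exp (-t) : ℂ) * (f (Circle.exp t • z) : ℂ)

theorem orbitFourier_smul (f : M → ℝ) (c : Circle) (z : M) :
    orbitFourier f (c • z) = c * orbitFourier f z := by
  obtain ⟨s, rfl⟩ : ∃ s : ℝ, Circle.exp s = c := ⟨_, Circle.exp_arg c⟩
  let h : ℝ → ℂ := fun t => (Circle.exp (-t) : ℂ) * (f (Circle.exp t • z) : ℂ)
  have hper : Function.Periodic h (2 * Real.pi) := by
    intro t
    simp only [h, Circle.exp_add, Circle.exp_neg, Circle.exp_two_pi, mul_one]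
  have h1 : ∀ t : ℝ, (Circle.exp (-t) : ℂ) * (f (Circle.exp t • Circle.exp s • z) : ℂ) =
      (Circle.exp s : ℂ) * h (t + s) := by
    intro t
    simp only [h]
    rw [← mul_assoc, ← Circle.coe_mul, ← Circle.exp_add, ← mul_smul, ← Circle.exp_add]
    congr 4
    ring
  simp only [orbitFourier, h1]
  rw [intervalIntegral.integral_const_mul, intervalIntegral.integral_comp_add_right]
  congr 1
  have h2 := hper.intervalIntegral_add_eq (-Real.pi + s) (-Real.pi)
  rw [show -Real.pi + s + 2 * Real.pi = Real.pi + s by ring,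
    show -Real.pi + 2 * Real.pi = Real.pi by ring] at h2
  exact h2

end Fourier

section Slice

variable {m : ℕ} {M : Type*} [TopologicalSpace M] [ChartedSpace (Euc m) M]

/-- A smooth `S¹`-equivariant map from an invariant open neighbourhood of `z₀` to the circle, taking
`z₀` to `1`; its fibre over `1` is a slice for the action. -/
structure CircleSlice [MulAction Circle M] (z₀ : M) where
  carrier : Set M
  toFun : M → Circle
  isOpen_carrier : IsOpen carrier
  mem_carrier : z₀ ∈ carrier
  smul_mem : ∀ (c : Circle), ∀ z ∈ carrier, c • z ∈ carrier
  contMDiffOn : ContMDiffOn (𝓡 m) (𝓡 1) ∞ toFun carrier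
  map_smul : ∀ (c : Circle), ∀ z ∈ carrier, toFun (c • z) = c * toFun z
  map_base : toFun z₀ = 1

variable [MulAction Circle M]

theorem contMDiff_exp_smul [ContMDiffSMul (𝓡 1) (𝓡 m) ∞ Circle M] :
    ContMDiff (𝓘(ℝ, ℝ).prod (𝓡 m)) (𝓡 m) ∞ (fun y : ℝ × M => Circle.exp y.1 • y.2) :=
  (contMDiff_smul (I := 𝓡 1) (I' := 𝓡 m) (n := ∞) (G := Circle) (M := M)).comp
    ((contMDiff_circleExp.comp contMDiff_fst).prodMk contMDiff_snd)

theorem contMDiff_orbitFourier [IsManifold (𝓡 m) ∞ M]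
    [ContMDiffSMul (𝓡 1) (𝓡 m) ∞ Circle M] {f : M → ℝ}
    (hf : ContMDiff (𝓡 m) 𝓘(ℝ, ℝ) ∞ f) : ContMDiff (𝓡 m) 𝓘(ℝ, ℂ) ∞ (orbitFourier f) := by
  intro z
  set φ := chartAt (Euc m) z
  have h1 : ContDiffOn ℝ ∞ (fun y : Euc m × ℝ => (Circle.exp (-y.2) : ℂ) *
      (f (Circle.exp y.2 • φ.symm y.1) : ℂ)) (φ.target ×ˢ univ) := by
    have h2 : ContMDiffOn (𝓘(ℝ, Euc m).prod 𝓘(ℝ, ℝ)) (𝓡 m) ∞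
        (fun y : Euc m × ℝ => Circle.exp y.2 • φ.symm y.1) (φ.target ×ˢ univ) :=
      contMDiff_exp_smul.comp_contMDiffOn (contMDiffOn_snd.prodMk
        ((contMDiffOn_chart_symm (I := 𝓡 m)).comp contMDiffOn_fst fun y hy => hy.1))
    have h3 : ContMDiff 𝓘(ℝ, ℝ) 𝓘(ℝ, ℂ) ∞ (fun x : ℝ => (x : ℂ)) :=
      Complex.ofRealCLM.contDiff.contMDiff
    have h4 : ContMDiff (𝓘(ℝ, Euc m).prod 𝓘(ℝ, ℝ)) 𝓘(ℝ, ℂ) ∞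
        (fun y : Euc m × ℝ => (Circle.exp (-y.2) : ℂ)) :=
      contMDiff_circle_coe.comp (contMDiff_circleExp.comp
        ((contDiff_neg (𝕜 := ℝ)).contMDiff.comp contMDiff_snd))
    have h5 := h3.comp_contMDiffOn (hf.comp_contMDiffOn h2)
    rw [← modelWithCornersSelf_prod, chartedSpaceSelf_prod] at h4 h5
    exact h4.contDiff.contDiffOn.mul h5.contDiffOn
  have h5 := contDiffOn_intervalIntegral (V := Euc m)
    (g := fun y t => (Circle.exp (-t) : ℂ) * (f (Circle.exp t • φ.symm y) : ℂ))
    φ.open_target h1 (neg_le_self Real.pi_pos.le)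
  have hz : z ∈ φ.source := mem_chart_source _ _
  have h6 := ((h5.contDiffAt (φ.open_target.mem_nhds (φ.map_source hz))).contMDiffAt).comp z
    (contMDiffAt_of_mem_maximalAtlas (IsManifold.chart_mem_maximalAtlas (I := 𝓡 m) (n := ∞) z) hz)
  refine h6.congr_of_eventuallyEq ?_
  filter_upwards [φ.open_source.mem_nhds hz] with y hy
  simp only [orbitFourier, Function.comp_apply]
  change _ = ∫ t in (-Real.pi)..Real.pi,
    (Circle.exp (-t) : ℂ) * (f (Circle.exp t • φ.symm (φ y)) : ℂ)
  rw [φ.left_inv hy]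

/-- A free smooth circle action has slices: the first Fourier coefficient along the orbits of a bump
function at `z₀` is equivariant, and it does not vanish at `z₀` if the bump function is concentrated
so much that the orbit of `z₀` meets its support only in points `c • z₀` with `Re c > 0`. -/
theorem nonempty_circleSlice [IsManifold (𝓡 m) ∞ M] [T2Space M]
    [ContMDiffSMul (𝓡 1) (𝓡 m) ∞ Circle M]
    (hfree : ∀ (c : Circle) (x : M), c • x = x → c = 1) (z₀ : M) :
    Nonempty (CircleSlice (m := m) z₀) := by
  have hcont : Continuous fun c : Circle => c • z₀ :=
    (contMDiff_smul (I := 𝓡 1) (I' := 𝓡 m) (n := ∞) (G := Circle) (M := M)).continuous.comp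
      (by fun_prop : Continuous fun c : Circle => (c, z₀))
  -- the part of the orbit to be avoided by the support of the bump function
  set K : Set M := (fun c : Circle => c • z₀) '' {c | (c : ℂ).re ≤ 0} with hK
  have hKc : IsClosed K := by
    refine (IsCompact.image ?_ hcont).isClosed
    exact (isClosed_le (by fun_prop) continuous_const).isCompact
  have hz₀ : z₀ ∉ K := by
    rintro ⟨c, hc, h⟩
    rw [hfree c z₀ h] at hc
    simp at hc
    linarith
  obtain ⟨f, -, hf⟩ := (SmoothBumpFunction.nhds_basis_tsupport (I := 𝓡 m) z₀).mem_iff.1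
    (hKc.isOpen_compl.mem_nhds hz₀)
  set u := orbitFourier (fun z => f z) with hu
  have hre : 0 < (u z₀).re := by
    have hc1 : Continuous fun t : ℝ => f (Circle.exp t • z₀) :=
      f.continuous.comp (hcont.comp Circle.exp.continuous)
    have h1 : (u z₀).re = ∫ t in (-Real.pi)..Real.pi,
        (Circle.exp t : ℂ).re * f (Circle.exp t • z₀) := by
      have hi : IntervalIntegrable
          (fun t => (Circle.exp (-t) : ℂ) * (f (Circle.exp t • z₀) : ℂ)) MeasureTheory.volume
          (-Real.pi) Real.pi := by
        apply Continuous.intervalIntegrable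
        exact (continuous_subtype_val.comp (Circle.exp.continuous.comp continuous_neg)).mul
          (Complex.continuous_ofReal.comp hc1)
      have h2 := Complex.reCLM.intervalIntegral_comp_comm hi
      rw [hu, orbitFourier, ← Complex.reCLM_apply, ← h2]
      congr 1
      ext t
      simp only [Circle.exp_neg, Circle.coe_inv_eq_conj, Complex.reCLM_apply, Complex.mul_re,
        Complex.conj_re, Complex.ofReal_re, Complex.ofReal_im, mul_zero, sub_zero]
    rw [h1]
    -- the integrand is nonnegative since `f` vanishes where `Re c ≤ 0`, and it is `1` at `t = 0`
    refine intervalIntegral.integral_pos (by linarith [Real.pi_pos])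
      (Continuous.continuousOn ((Complex.continuous_re.comp
        (continuous_subtype_val.comp Circle.exp.continuous)).mul hc1)) ?_
          ⟨0, ⟨by linarith [Real.pi_pos], Real.pi_pos.le⟩, ?_⟩
    · intro t _
      by_cases ht : (Circle.exp t : ℂ).re ≤ 0
      · have h3 : f (Circle.exp t • z₀) = 0 := by
          by_contra h4
          exact hf (subset_tsupport _ h4) ⟨_, ht, rfl⟩
        rw [h3, mul_zero]
      · exact mul_nonneg (not_le.1 ht).le f.nonneg
    · simp
  have hsm : ContMDiff (𝓡 m) 𝓘(ℝ, ℂ) ∞ u := contMDiff_orbitFourier f.contMDiff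
  have hne : u z₀ ≠ 0 := by
    intro h
    rw [h] at hre
    simp at hre
  refine ⟨⟨{z | u z ≠ 0}, fun z => toCircle (u z) * (toCircle (u z₀))⁻¹,
    isOpen_ne.preimage hsm.continuous, hne, ?_, ?_, ?_, ?_⟩⟩
  · intro c z hz
    have h1 := orbitFourier_smul f c z
    change u (c • z) ≠ 0
    rw [hu, h1]
    exact mul_ne_zero c.coe_ne_zero hz
  · intro z hz
    exact (((contMDiffAt_toCircle hz).comp z hsm.contMDiffAt).mul
      contMDiffAt_const).contMDiffWithinAt
  · intro c z hz
    have h1 : u (c • z) = c * u z := orbitFourier_smul f c z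
    simp only [h1]
    rw [toCircle_mul c hz, mul_assoc]
  · simp only [mul_inv_cancel]

end Slice

section SmoothQuotient

/-- A smooth map with a smooth local section through every point of its domain. -/
structure HasSmoothSections {m d : ℕ} {M X : Type*} [TopologicalSpace M] [ChartedSpace (Euc m) M]
    [TopologicalSpace X] [ChartedSpace (Euc d) X] (π : M → X) : Prop where
  contMDiff : ContMDiff (𝓡 m) (𝓡 d) ∞ π
  exists_section : ∀ z, ∃ U : Set X, IsOpen U ∧ π z ∈ U ∧ ∃ i : X → M,
    ContMDiffOn (𝓡 d) (𝓡 m) ∞ i U ∧ i (π z) = z ∧ ∀ x ∈ U, π (i x) = x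

variable {m d : ℕ} {M : Type*} [TopologicalSpace M] [ChartedSpace (Euc m) M]
  [MulAction Circle M] {X : Type*} [TopologicalSpace X]

/-- The slice of a circle action as a local section of the quotient map: the inclusion takes the
orbit of `z` to its point `(χ z)⁻¹ • z` in the slice. -/
def CircleSlice.localRetract {z₀ : M} (χ : CircleSlice (m := m) z₀)
    [ContMDiffSMul (𝓡 1) (𝓡 m) ∞ Circle M]
    {π : M → X} (hπ : IsOpenQuotientMap π)
    (horb : ∀ x y, π x = π y ↔ ∃ c : Circle, c • x = y) : LocalRetract M X where
  incl x := (χ.toFun (Function.surjInv hπ.surjective x))⁻¹ • Function.surjInv hπ.surjective x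
  retr := π
  dom := π '' χ.carrier
  nhd := χ.carrier
  isOpen_dom := hπ.isOpenMap _ χ.isOpen_carrier
  isOpen_nhd := χ.isOpen_carrier
  continuousOn_incl := by
    rw [hπ.isQuotientMap.continuousOn_isOpen_iff (hπ.isOpenMap _ χ.isOpen_carrier)]
    have hsub : ∀ z ∈ π ⁻¹' (π '' χ.carrier), z ∈ χ.carrier := by
      rintro z ⟨y, hy, h⟩
      obtain ⟨c, rfl⟩ := (horb _ _).1 h
      exact χ.smul_mem c y hy
    have h1 : ContinuousOn (fun z => (χ.toFun z)⁻¹ • z) χ.carrier :=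
      (contMDiff_smul (I := 𝓡 1) (I' := 𝓡 m) (n := ∞) (G := Circle)
        (M := M)).continuous.comp_continuousOn (χ.contMDiffOn.continuousOn.inv.prodMk
          continuousOn_id)
    -- the point `(χ z)⁻¹ • z` does not depend on the representative `z` of the orbit
    refine (h1.mono hsub).congr fun z hz => ?_
    obtain ⟨c, hc⟩ := (horb _ _).1 (Function.surjInv_eq hπ.surjective (π z))
    have h2 : Function.surjInv hπ.surjective (π z) ∈ χ.carrier := by
      have := χ.smul_mem c⁻¹ z (hsub z hz)
      rwa [← hc, inv_smul_smul] at this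
    change (χ.toFun (Function.surjInv hπ.surjective (π z)))⁻¹ •
      Function.surjInv hπ.surjective (π z) = (χ.toFun z)⁻¹ • z
    have h3 := χ.map_smul c _ h2
    rw [hc] at h3
    rw [h3, mul_inv, mul_comm, mul_smul]
    congr 1
    rw [eq_inv_smul_iff, hc]
  continuousOn_retr := hπ.continuous.continuousOn
  mapsTo_incl := by
    rintro _ ⟨z, hz, rfl⟩
    obtain ⟨c, hc⟩ := (horb _ _).1 (Function.surjInv_eq hπ.surjective (π z))
    refine χ.smul_mem _ _ ?_
    have := χ.smul_mem c⁻¹ z hz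
    rwa [← hc, inv_smul_smul] at this
  mapsTo_retr := fun z hz => mem_image_of_mem π hz
  retr_incl := by
    intro x hx
    have h1 : π (Function.surjInv hπ.surjective x) =
        π ((χ.toFun (Function.surjInv hπ.surjective x))⁻¹ • Function.surjInv hπ.surjective x) :=
      (horb _ _).2 ⟨_, rfl⟩
    rw [← h1, Function.surjInv_eq hπ.surjective]

theorem CircleSlice.localRetract_incl {z₀ : M} (χ : CircleSlice (m := m) z₀)
    [ContMDiffSMul (𝓡 1) (𝓡 m) ∞ Circle M]
    {π : M → X} (hπ : IsOpenQuotientMap π)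
    (horb : ∀ x y, π x = π y ↔ ∃ c : Circle, c • x = y) {z : M} (hz : z ∈ χ.carrier) :
    (χ.localRetract hπ horb).incl (π z) = (χ.toFun z)⁻¹ • z := by
  obtain ⟨c, hc⟩ := (horb _ _).1 (Function.surjInv_eq hπ.surjective (π z))
  have h2 : Function.surjInv hπ.surjective (π z) ∈ χ.carrier := by
    have := χ.smul_mem c⁻¹ z hz
    rwa [← hc, inv_smul_smul] at this
  change (χ.toFun (Function.surjInv hπ.surjective (π z)))⁻¹ •
    Function.surjInv hπ.surjective (π z) = (χ.toFun z)⁻¹ • z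
  have h3 := χ.map_smul c _ h2
  rw [hc] at h3
  rw [h3, mul_inv, mul_comm, mul_smul]
  congr 1
  rw [eq_inv_smul_iff, hc]

theorem CircleSlice.contMDiffOn_inv_smul {z₀ : M} (χ : CircleSlice (m := m) z₀)
    [ContMDiffSMul (𝓡 1) (𝓡 m) ∞ Circle M] :
    ContMDiffOn (𝓡 m) (𝓡 m) ∞ (fun z => (χ.toFun z)⁻¹ • z) χ.carrier :=
  (contMDiff_smul (I := 𝓡 1) (I' := 𝓡 m) (n := ∞) (G := Circle) (M := M)).comp_contMDiffOn
    (χ.contMDiffOn.inv.prodMk contMDiffOn_id)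

/-- The quotient of a manifold by a circle action that has slices is a manifold. -/
theorem exists_isManifold_quotient [IsManifold (𝓡 m) ∞ M]
    [ContMDiffSMul (𝓡 1) (𝓡 m) ∞ Circle M] (hdim : m = d + 1)
    {π : M → X} (hπ : IsOpenQuotientMap π)
    (horb : ∀ x y, π x = π y ↔ ∃ c : Circle, c • x = y)
    (hslice : ∀ z : M, Nonempty (CircleSlice (m := m) z)) :
    ∃ (_ : ChartedSpace (Euc d) X) (_ : IsManifold (𝓡 d) ∞ X),
      IsSubmersion (𝓡 m) (𝓡 d) ∞ π ∧ HasSmoothSections (m := m) (d := d) π := by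
  obtain ⟨χ⟩ : Nonempty (∀ z : M, CircleSlice (m := m) z) := ⟨fun z => (hslice z).some⟩
  set R : M → LocalRetract M X := fun z => (χ z).localRetract hπ horb with hR
  have hincl : ∀ z y, y ∈ (χ z).carrier → (R z).incl (π y) = ((χ z).toFun y)⁻¹ • y :=
    fun z y hy => (χ z).localRetract_incl hπ horb hy
  have hbase : ∀ z, (R z).incl (π z) = z := fun z => by
    rw [hincl z z (χ z).mem_carrier, (χ z).map_base, inv_one, one_smul]
  have hdomsub : ∀ z y, π y ∈ (R z).dom → y ∈ (χ z).carrier := by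
    rintro z y ⟨y', hy', h⟩
    obtain ⟨c, rfl⟩ := (horb _ _).1 h
    exact (χ z).smul_mem c y' hy'
  have hmem : ∀ z, π z ∈ (R z).dom := fun z => mem_image_of_mem π (χ z).mem_carrier
  have hsm : ∀ a b, ContMDiffOn (𝓡 m) (𝓡 m) ∞ ((R b).incl ∘ (R a).retr)
      ((R a).nhd ∩ (R a).retr ⁻¹' (R b).dom) := by
    intro a b
    refine ((χ b).contMDiffOn_inv_smul.mono fun y hy => hdomsub b y hy.2).congr fun y hy => ?_
    exact hincl b y (hdomsub b y hy.2)
  have hk : ∀ a, Module.finrank ℝ (LinearMap.ker (mfderiv (𝓡 m) (𝓡 m)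
      ((R a).incl ∘ (R a).retr) ((R a).incl (π a))).toLinearMap) = Module.finrank ℝ ℝ := by
    intro a
    rw [hbase]
    -- the fibre of the retraction through `a` is the orbit of `a`, parametrized by the angle
    have hsmul1 : ∀ᶠ t in 𝓝 (0 : ℝ), Complex.arg (Circle.exp t) = t := by
      filter_upwards [Ioo_mem_nhds (neg_lt_zero.2 Real.pi_pos) Real.pi_pos] with t ht
      exact Circle.arg_exp ht.1 ht.2.le
    have hF0 : Complex.arg ((χ a).toFun a) = 0 := by
      rw [(χ a).map_base, Circle.coe_one, Complex.arg_one]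
    have hχat : ContMDiffAt (𝓡 m) (𝓡 1) ∞ (χ a).toFun a :=
      (χ a).contMDiffOn.contMDiffAt ((χ a).isOpen_carrier.mem_nhds (χ a).mem_carrier)
    have hret : ∀ y ∈ (χ a).carrier, ((R a).incl ∘ (R a).retr) y = ((χ a).toFun y)⁻¹ • y :=
      fun y hy => hincl a y hy
    refine finrank_ker_mfderiv (F := fun z => Complex.arg ((χ a).toFun z))
      (Ψ := fun y : M × ℝ => Circle.exp y.2 • y.1) (hbase a) ?_ ?_ ?_ ?_ ?_ ?_
    · refine ((hsm a a).contMDiffAt ?_).mdifferentiableAt (by simp)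
      exact ((hπ.continuous.continuousOn.isOpen_inter_preimage (R a).isOpen_nhd
        (R a).isOpen_dom).mem_nhds ⟨(χ a).mem_carrier, hmem a⟩)
    · have h1 : ContMDiffAt 𝓘(ℝ, ℂ) 𝓘(ℝ, ℝ) ∞ Complex.arg (((χ a).toFun a : Circle) : ℂ) := by
        rw [(χ a).map_base, Circle.coe_one]
        have h2 : ContDiffAt ℝ ∞ Complex.log 1 :=
          (Complex.contDiffAt_log (by simp)).restrict_scalars ℝ
        have h3 := Complex.imCLM.contDiff.contDiffAt.comp 1 h2
        refine (h3.congr_of_eventuallyEq (Eventually.of_forall fun y => ?_)).contMDiffAt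
        exact (Complex.log_im y).symm
      have h4 := h1.comp a (contMDiff_circle_coe.contMDiffAt.comp a hχat)
      exact h4.mdifferentiableAt (by simp)
    · have h1 : ContMDiff ((𝓡 m).prod 𝓘(ℝ, ℝ)) (𝓡 m) ∞
          (fun y : M × ℝ => Circle.exp y.2 • y.1) :=
        contMDiff_exp_smul.comp (contMDiff_snd.prodMk contMDiff_fst)
      exact h1.mdifferentiableAt (by simp)
    · filter_upwards [(χ a).isOpen_carrier.mem_nhds (χ a).mem_carrier] with y hy
      rw [hret y hy, Circle.exp_arg, smul_inv_smul]
    · rw [hF0]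
      filter_upwards [hsmul1] with t ht
      rw [(χ a).map_smul _ _ (χ a).mem_carrier, (χ a).map_base, mul_one, ht]
    · refine Eventually.of_forall fun t => ?_
      rw [hret _ ((χ a).smul_mem _ _ (χ a).mem_carrier), (χ a).map_smul _ _ (χ a).mem_carrier,
        (χ a).map_base, mul_one, inv_smul_smul]
  obtain ⟨cs, ism, h⟩ := LocalRetract.exists_isManifold (W := ℝ) (d := d) R (fun a => π a) hmem
    hπ.surjective hsm hk (by simpa using hdim)
  refine ⟨cs, ism, ⟨ℝ, inferInstance, inferInstance, fun z => ?_⟩, ⟨fun z => ?_, fun z => ?_⟩⟩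
  · have := (h z).2.2.2
    rwa [hbase] at this
  · exact (h z).2.1.contMDiffAt ((χ z).isOpen_carrier.mem_nhds (χ z).mem_carrier)
  · exact ⟨(R z).dom, (R z).isOpen_dom, hmem z, (R z).incl, (h z).1, hbase z, (R z).retr_incl⟩

end SmoothQuotient

end SpinCPreq
end

/-! ### The Clifford algebra of a space with one more dimension -/

noncomputable section

namespace SpinCPreq

open CliffordAlgebra

section CliffordDecomposition

variable {k : ℕ}

/-- The last basis vector of `ℝᵏ⁺¹`. -/
def lastVec (k : ℕ) : Euc (k + 1) := EuclideanSpace.single (Fin.last k) 1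

theorem incl_apply_castSucc (v : Euc k) (i : Fin k) : incl k v i.castSucc = v i := by simp [incl]

theorem incl_apply_last (v : Euc k) : incl k v (Fin.last k) = 0 := by simp [incl]

theorem init_apply (v : Euc (k + 1)) (i : Fin k) : init k v i = v i.castSucc := rfl

theorem lastVec_castSucc (i : Fin k) : lastVec k i.castSucc = 0 := by
  simp [lastVec, i.castSucc_lt_last.ne]

theorem lastVec_last : lastVec k (Fin.last k) = 1 := by simp [lastVec]

theorem eq_incl_add_smul_lastVec (v : Euc (k + 1)) :
    v = incl k (init k v) + v (Fin.last k) • lastVec k := by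
  ext i
  refine Fin.lastCases ?_ (fun j => ?_) i
  · simp [incl_apply_last, lastVec_last]
  · simp [incl_apply_castSucc, lastVec_castSucc, init_apply]

theorem init_incl (v : Euc k) : init k (incl k v) = v := by
  ext i
  rw [init_apply, incl_apply_castSucc]

theorem init_lastVec : init k (lastVec k) = 0 := by
  ext i
  rw [init_apply, lastVec_castSucc]
  rfl

theorem inner_incl_lastVec (v : Euc k) : ⟪incl k v, lastVec k⟫ = 0 := by
  simp [lastVec, EuclideanSpace.inner_single_right, incl_apply_last]

theorem inner_lastVec (v : Euc (k + 1)) : ⟪v, lastVec k⟫ = v (Fin.last k) := by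
  simp [lastVec, EuclideanSpace.inner_single_right]

theorem vec_mul_self {n : ℕ} (v : Euc n) :
    vec v * vec v = algebraMap ℝ (Cl n) (-⟪v, v⟫) := by
  rw [← negForm_apply]
  exact ι_sq_scalar (negForm n) v

theorem vec_mul_add_swap {n : ℕ} (u v : Euc n) :
    vec u * vec v + vec v * vec u = algebraMap ℝ (Cl n) (-2 * ⟪u, v⟫) := by
  have h : vec (u + v) * vec (u + v) =
      vec u * vec u + (vec u * vec v + vec v * vec u) + vec v * vec v := by
    simp only [map_add]
    noncomm_ring
  rw [vec_mul_self, vec_mul_self, vec_mul_self, inner_add_add_self] at h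
  have h2 : vec u * vec v + vec v * vec u =
      algebraMap ℝ (Cl n) (-(⟪u, u⟫ + ⟪u, v⟫ + ⟪v, u⟫ + ⟪v, v⟫)) -
        algebraMap ℝ (Cl n) (-⟪u, u⟫) - algebraMap ℝ (Cl n) (-⟪v, v⟫) := by
    rw [h]
    abel
  rw [h2, ← map_sub, ← map_sub, real_inner_comm u v]
  congr 1
  ring

theorem clIncl_vec (v : Euc k) : clIncl k (vec v) = vec (incl k v) :=
  CliffordAlgebra.map_apply_ι (inclIsometry k) v

/-- The action of a vector of `ℝᵏ⁺¹` on `C_k × C_k`, in which `(a, b)` stands for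
`a + b e ∈ C_{k+1}` with `e` the last basis vector. -/
def pairAct (k : ℕ) : Euc (k + 1) →ₗ[ℝ] Module.End ℝ (Cl k × Cl k) where
  toFun v :=
    { toFun := fun y => (vec (init k v) * y.1 - v (Fin.last k) • involute y.2,
        vec (init k v) * y.2 + v (Fin.last k) • involute y.1)
      map_add' := by
        intro x y
        ext <;> simp only [Prod.fst_add, Prod.snd_add, mul_add, map_add, smul_add] <;> abel
      map_smul' := by
        intro c y
        ext <;> simp [smul_sub, smul_add, smul_comm c] }
  map_add' := by
    intro u v
    apply LinearMap.ext
    intro y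
    ext <;> simp [add_mul, add_smul] <;> abel
  map_smul' := by
    intro c v
    apply LinearMap.ext
    intro y
    ext <;> simp [smul_sub, smul_add, mul_smul]

theorem negForm_succ (v : Euc (k + 1)) :
    negForm (k + 1) v = -⟪init k v, init k v⟫ - v (Fin.last k) * v (Fin.last k) := by
  rw [negForm_apply, PiLp.inner_apply, PiLp.inner_apply, Fin.sum_univ_castSucc]
  simp [init_apply]
  ring

theorem pairAct_sq (v : Euc (k + 1)) :
    pairAct k v * pairAct k v = algebraMap ℝ _ (negForm (k + 1) v) := by
  apply LinearMap.ext
  rintro ⟨a, b⟩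
  have h : ∀ x : Cl k, vec (init k v) * (vec (init k v) * x) =
      (-⟪init k v, init k v⟫) • x := by
    intro x
    rw [← mul_assoc, vec_mul_self, Algebra.smul_def]
  change (vec (init k v) * (vec (init k v) * a - v (Fin.last k) • involute b) -
      v (Fin.last k) • involute (vec (init k v) * b + v (Fin.last k) • involute a),
    vec (init k v) * (vec (init k v) * b + v (Fin.last k) • involute a) +
      v (Fin.last k) • involute (vec (init k v) * a - v (Fin.last k) • involute b)) =
    (negForm (k + 1) v) • (a, b)
  rw [negForm_succ, Prod.smul_mk]
  ext
  · simp only [mul_sub, h, map_add, map_mul, involute_ι, map_smul, involute_involute, sub_smul,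
      mul_smul, mul_smul_comm, neg_mul, smul_add, smul_neg]
    abel
  · simp only [mul_add, h, map_sub, map_mul, involute_ι, map_smul, involute_involute, sub_smul,
      mul_smul, mul_smul_comm, neg_mul, smul_sub, smul_neg]
    abel

/-- The representation of `C_{k+1}` on `C_k × C_k`. -/
def pairRep (k : ℕ) : Cl (k + 1) →ₐ[ℝ] Module.End ℝ (Cl k × Cl k) :=
  CliffordAlgebra.lift (negForm (k + 1)) ⟨pairAct k, pairAct_sq⟩

theorem pairRep_vec (v : Euc (k + 1)) : pairRep k (vec v) = pairAct k v :=
  CliffordAlgebra.lift_ι_apply _ _ _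

theorem pairRep_clIncl (x : Cl k) (y : Cl k × Cl k) :
    pairRep k (clIncl k x) y = (x * y.1, x * y.2) := by
  induction x using CliffordAlgebra.induction generalizing y with
  | algebraMap r =>
    rw [AlgHom.commutes, AlgHom.commutes]
    simp [Algebra.algebraMap_eq_smul_one]
    rfl
  | ι v =>
    have h : clIncl k (ι (negForm k) v) = vec (incl k v) := clIncl_vec v
    rw [h, pairRep_vec]
    simp [pairAct, init_incl, incl_apply_last]
  | mul a b ha hb => rw [map_mul, map_mul, Module.End.mul_apply, hb, ha, mul_assoc, mul_assoc]
  | add a b ha hb => rw [map_add, map_add, LinearMap.add_apply, ha, hb, add_mul, add_mul]; rfl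

/-- The coordinates `x ↦ (a, b)` in the decomposition `x = a + b e` of `C_{k+1}`. -/
def clPair (k : ℕ) : Cl (k + 1) →ₗ[ℝ] Cl k × Cl k :=
  (LinearMap.applyₗ ((1 : Cl k), (0 : Cl k))) ∘ₗ (pairRep k).toLinearMap

theorem clPair_add_mul (a b : Cl k) :
    clPair k (clIncl k a + clIncl k b * vec (lastVec k)) = (a, b) := by
  change pairRep k _ (1, 0) = _
  rw [map_add, map_mul, LinearMap.add_apply, Module.End.mul_apply, pairRep_vec, pairRep_clIncl,
    pairRep_clIncl]
  simp [pairAct, init_lastVec, lastVec_last]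

theorem clPair_clIncl (a : Cl k) : clPair k (clIncl k a) = (a, 0) := by
  have := clPair_add_mul a 0
  rwa [map_zero, zero_mul, add_zero] at this

theorem clIncl_injective : Function.Injective (clIncl k) := by
  intro a b h
  have h1 := clPair_clIncl a
  rw [h, clPair_clIncl] at h1
  exact (congrArg Prod.fst h1).symm

theorem lastVec_mul_self : vec (lastVec k) * vec (lastVec k) = -1 := by
  rw [vec_mul_self, inner_lastVec, lastVec_last, map_neg, map_one]

theorem lastVec_mul_incl (v : Euc k) :
    vec (lastVec k) * vec (incl k v) = -(vec (incl k v) * vec (lastVec k)) := by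
  have h := vec_mul_add_swap (incl k v) (lastVec k)
  rw [inner_incl_lastVec, mul_zero, map_zero] at h
  exact eq_neg_of_add_eq_zero_right h

theorem lastVec_mul_clIncl (a : Cl k) :
    vec (lastVec k) * clIncl k a = clIncl k (involute a) * vec (lastVec k) := by
  induction a using CliffordAlgebra.induction with
  | algebraMap r =>
    rw [AlgHom.commutes, AlgHom.commutes, AlgHom.commutes]
    exact (Algebra.commutes r _).symm
  | ι v =>
    have h : clIncl k (ι (negForm k) v) = vec (incl k v) := clIncl_vec v
    rw [involute_ι, map_neg, h, lastVec_mul_incl, neg_mul]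
  | mul a b ha hb => rw [map_mul, ← mul_assoc, ha, mul_assoc, hb, map_mul, map_mul, mul_assoc]
  | add a b ha hb => rw [map_add, mul_add, ha, hb, map_add, map_add, add_mul]

theorem exists_eq_add_mul (x : Cl (k + 1)) :
    ∃ a b : Cl k, x = clIncl k a + clIncl k b * vec (lastVec k) := by
  induction x using CliffordAlgebra.left_induction with
  | algebraMap r => exact ⟨algebraMap ℝ _ r, 0, by simp⟩
  | add x y hx hy =>
    obtain ⟨a, b, rfl⟩ := hx
    obtain ⟨c, d, rfl⟩ := hy
    refine ⟨a + c, b + d, ?_⟩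
    rw [map_add, map_add, add_mul]
    abel
  | ι_mul x v hx =>
    obtain ⟨a, b, rfl⟩ := hx
    refine ⟨vec (init k v) * a - v (Fin.last k) • involute b,
      vec (init k v) * b + v (Fin.last k) • involute a, ?_⟩
    have h : ι (negForm (k + 1)) v =
        clIncl k (vec (init k v)) + v (Fin.last k) • vec (lastVec k) := by
      rw [clIncl_vec, ← map_smul, ← map_add, ← eq_incl_add_smul_lastVec]
    rw [h]
    simp only [add_mul, mul_add, map_sub, map_add, map_mul, map_smul, smul_mul_assoc,
      lastVec_mul_clIncl, ← mul_assoc]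
    rw [mul_assoc _ (vec (lastVec k)) (vec (lastVec k)), lastVec_mul_self]
    simp only [mul_neg, mul_one, smul_neg]
    abel

instance finiteDimensional_cl (n : ℕ) : FiniteDimensional ℝ (Cl n) := by
  induction n with
  | zero =>
    refine Module.Finite.of_surjective (Algebra.linearMap ℝ (Cl 0)) fun x => ?_
    induction x using CliffordAlgebra.left_induction with
    | algebraMap r => exact ⟨r, rfl⟩
    | add x y hx hy =>
      obtain ⟨a, rfl⟩ := hx
      obtain ⟨b, rfl⟩ := hy
      exact ⟨a + b, map_add _ _ _⟩
    | ι_mul x v hx =>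
      refine ⟨0, ?_⟩
      rw [Subsingleton.elim v 0, map_zero, map_zero, zero_mul]
  | succ k ih =>
    refine Module.Finite.of_surjective
      ((clIncl k).toLinearMap.coprod
        ((LinearMap.mulRight ℝ (vec (lastVec k))) ∘ₗ (clIncl k).toLinearMap)) fun x => ?_
    obtain ⟨a, b, rfl⟩ := exists_eq_add_mul x
    exact ⟨(a, b), rfl⟩

theorem involute_clIncl (a : Cl k) : involute (clIncl k a) = clIncl k (involute a) := by
  induction a using CliffordAlgebra.induction with
  | algebraMap r => simp only [AlgHom.commutes]
  | ι v =>
    have h : clIncl k (ι (negForm k) v) = vec (incl k v) := clIncl_vec v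
    rw [involute_ι, map_neg, h, involute_ι]
  | mul a b ha hb => simp only [map_mul, ha, hb]
  | add a b ha hb => simp only [map_add, ha, hb]

/-- The elements `c` of the Clifford algebra such that `v c = α(c) v` for all vectors `v`, where `α`
is the grading involution, are the scalars. -/
theorem exists_eq_algebraMap {n : ℕ} (c : Cl n) (hc : ∀ v, vec v * c = involute c * vec v) :
    ∃ r : ℝ, c = algebraMap ℝ _ r := by
  induction n with
  | zero =>
    induction c using CliffordAlgebra.left_induction with
    | algebraMap r => exact ⟨r, rfl⟩
    | add x y hx hy =>
      obtain ⟨a, rfl⟩ := hx fun v => by rw [Subsingleton.elim v 0]; simp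
      obtain ⟨b, rfl⟩ := hy fun v => by rw [Subsingleton.elim v 0]; simp
      exact ⟨a + b, (map_add _ _ _).symm⟩
    | ι_mul x v hx =>
      refine ⟨0, ?_⟩
      rw [Subsingleton.elim v 0, map_zero, map_zero, zero_mul]
  | succ k ih =>
    obtain ⟨a, b, rfl⟩ := exists_eq_add_mul c
    have h1 := hc (lastVec k)
    simp only [map_add, map_mul, involute_clIncl, involute_ι] at h1
    have h2 : clIncl k (-involute b) + clIncl k (involute a) * vec (lastVec k) =
        clIncl k (involute b) + clIncl k (involute a) * vec (lastVec k) := by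
      have e1 : vec (lastVec k) * (clIncl k a + clIncl k b * vec (lastVec k)) =
          clIncl k (-involute b) + clIncl k (involute a) * vec (lastVec k) := by
        rw [mul_add, ← mul_assoc, lastVec_mul_clIncl, lastVec_mul_clIncl, mul_assoc,
          lastVec_mul_self, map_neg]
        noncomm_ring
      have e2 : (clIncl k (involute a) + clIncl k (involute b) * -vec (lastVec k)) *
          vec (lastVec k) = clIncl k (involute b) + clIncl k (involute a) * vec (lastVec k) := by
        rw [add_mul, mul_assoc, neg_mul, lastVec_mul_self]
        noncomm_ring
      rw [← e1, ← e2]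
      exact h1
    have h3 := congrArg (clPair k) h2
    rw [clPair_add_mul, clPair_add_mul] at h3
    have hb : b = 0 := by
      have h4 : -involute b = involute b := congrArg Prod.fst h3
      have h5 : involute b = 0 := by
        have h6 : (2 : ℝ) • involute b = 0 := by
          rw [two_smul]
          nth_rewrite 1 [← h4]
          exact neg_add_cancel _
        exact (smul_eq_zero.1 h6).resolve_left two_ne_zero
      rw [← involute_involute b, h5, map_zero]
    subst hb
    simp only [map_zero, zero_mul, add_zero] at hc ⊢
    obtain ⟨r, hr⟩ := ih a fun v => clIncl_injective (by
      rw [map_mul, map_mul, clIncl_vec, ← involute_clIncl]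
      exact hc _)
    exact ⟨r, by rw [hr, AlgHom.commutes]⟩

end CliffordDecomposition

end SpinCPreq
end

/-! ### The spin group of a subspace as a stabilizer -/

noncomputable section

namespace SpinCPreq

open CliffordAlgebra

section SpinElements

variable {n : ℕ}

theorem vec_add (u v : Euc n) : vec (u + v) = vec u + vec v := map_add _ _ _

theorem vec_sub (u v : Euc n) : vec (u - v) = vec u - vec v := map_sub _ _ _

theorem vec_smul (c : ℝ) (v : Euc n) : vec (c • v) = c • vec v := map_smul _ _ _

theorem vec_injective : Function.Injective (vec : Euc n → Cl n) := by
  intro u v huv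
  have h1 : vec (u - v) = 0 := by rw [vec_sub, huv, sub_self]
  have h2 := vec_mul_self (u - v)
  rw [h1, mul_zero] at h2
  have h3 := (algebraMap ℝ (Cl n)).injective (h2.symm.trans (map_zero _).symm)
  exact sub_eq_zero.1 (inner_self_eq_zero.1 (neg_eq_zero.1 h3))

theorem vec_mem_pinGroup {u : Euc n} (hu : ⟪u, u⟫ = 1) : vec u ∈ pinGroup (negForm n) := by
  have h1 : vec u * vec u = -1 := by rw [vec_mul_self, hu, map_neg, map_one]
  have h2 : star (vec u) = -vec u := by simp
  have h3 : vec u * -vec u = 1 := by rw [mul_neg, h1, neg_neg]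
  have h4 : -vec u * vec u = 1 := by rw [neg_mul, h1, neg_neg]
  refine ⟨⟨⟨vec u, -vec u, h3, h4⟩, Subgroup.subset_closure ⟨u, rfl⟩, rfl⟩, ?_, ?_⟩
  · rw [h2]
    exact h4
  · rw [h2]
    exact h3

theorem mem_even_of_involute_eq {x : Cl n} (hx : involute x = x) :
    x ∈ CliffordAlgebra.even (negForm n) := by
  have h := (evenOdd_isCompl (negForm n)).sup_eq_top
  obtain ⟨a, ha, b, hb, rfl⟩ := Submodule.mem_sup.1 (h ▸ Submodule.mem_top : x ∈ _)
  rw [map_add, involute_eq_of_mem_even ha, involute_eq_of_mem_odd hb] at hx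
  have hb0 : b = 0 := by
    have h6 : (2 : ℝ) • b = 0 := by
      rw [two_smul]
      have h7 : -b = b := add_left_cancel hx
      nth_rewrite 1 [← h7]
      exact neg_add_cancel _
    exact (smul_eq_zero.1 h6).resolve_left two_ne_zero
  rw [hb0, add_zero]
  exact ha

/-- The element `u₁ u₂` of `Spin(n)`, for unit vectors `u₁`, `u₂`. -/
def spinPair (u₁ u₂ : Euc n) (h₁ : ⟪u₁, u₁⟫ = 1) (h₂ : ⟪u₂, u₂⟫ = 1) : Spin n :=
  ⟨vec u₁ * vec u₂, spinGroup.mem_iff.2 ⟨mul_mem (vec_mem_pinGroup h₁) (vec_mem_pinGroup h₂),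
    mem_even_of_involute_eq (by simp)⟩⟩

theorem coe_spinPair (u₁ u₂ : Euc n) (h₁ : ⟪u₁, u₁⟫ = 1) (h₂ : ⟪u₂, u₂⟫ = 1) :
    (spinPair u₁ u₂ h₁ h₂ : Cl n) = vec u₁ * vec u₂ := rfl

theorem vec_mul_vec_mul_vec {u : Euc n} (hu : ⟪u, u⟫ = 1) (v : Euc n) :
    vec u * vec v * vec u = vec (v - (2 * ⟪u, v⟫) • u) := by
  have h1 := eq_sub_of_add_eq (vec_mul_add_swap u v)
  rw [h1, sub_mul, mul_assoc, vec_mul_self, hu, map_neg, map_one, mul_neg, mul_one, vec_sub,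
    vec_smul, ← Algebra.smul_def, neg_mul, neg_smul]
  abel

theorem rot_spinPair (u₁ u₂ : Euc n) (h₁ : ⟪u₁, u₁⟫ = 1) (h₂ : ⟪u₂, u₂⟫ = 1) (v : Euc n) :
    rot (spinPair u₁ u₂ h₁ h₂) v =
      v - (2 * ⟪u₂, v⟫) • u₂ - (2 * ⟪u₁, v - (2 * ⟪u₂, v⟫) • u₂⟫) • u₁ := by
  apply vec_injective
  rw [vec_rot, coe_spinPair, reverse.map_mul, reverse_ι, reverse_ι, ← vec_mul_vec_mul_vec h₁,
    ← vec_mul_vec_mul_vec h₂]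
  simp only [mul_assoc]

theorem reverse_coe (x : Spin n) : reverse (x : Cl n) = star (x : Cl n) := by
  rw [CliffordAlgebra.star_def, spinGroup.involute_eq x.2]

theorem rot_one (v : Euc n) : rot (1 : Spin n) v = v := by
  apply vec_injective
  rw [vec_rot]
  simp

theorem rot_mul (x y : Spin n) (v : Euc n) : rot (x * y) v = rot x (rot y v) := by
  apply vec_injective
  rw [vec_rot, vec_rot, vec_rot, Submonoid.coe_mul, reverse.map_mul]
  simp only [mul_assoc]

theorem rot_inv_rot (x : Spin n) (v : Euc n) : rot x⁻¹ (rot x v) = v := by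
  rw [← rot_mul, inv_mul_cancel, rot_one]

theorem rot_rot_inv (x : Spin n) (v : Euc n) : rot x (rot x⁻¹ v) = v := by
  rw [← rot_mul, mul_inv_cancel, rot_one]

theorem rot_spinIncl {k : ℕ} (x : Spin k) (v : Euc k) :
    rot (spinIncl k x) (incl k v) = incl k (rot x v) := by
  apply vec_injective
  rw [vec_rot, ← clIncl_vec (rot x v), vec_rot, map_mul, map_mul, clIncl_vec, reverse_coe,
    reverse_coe, ← star_clIncl]
  rfl

theorem rot_spinIncl_lastVec {k : ℕ} (x : Spin k) :
    rot (spinIncl k x) (lastVec k) = lastVec k := by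
  apply vec_injective
  have h1 : ((spinIncl k x : Spin (k + 1)) : Cl (k + 1)) = clIncl k (x : Cl k) := rfl
  have h2 := lastVec_mul_clIncl (x : Cl k)
  rw [spinGroup.involute_eq x.2] at h2
  rw [vec_rot, reverse_coe, h1, ← h2, mul_assoc, star_clIncl, ← map_mul,
    spinGroup.mul_star_self_of_mem x.2, map_one, mul_one]

end SpinElements

section Stabilizer

variable {n k : ℕ}

/-- Every linear isometry of `ℝⁿ` is induced by an element of `Pin(n)` (by the theorem of
Cartan and Dieudonné). -/
theorem exists_pin (T : Euc n ≃ₗᵢ[ℝ] Euc n) :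
    ∃ y ∈ pinGroup (negForm n), ∀ v, involute y * vec v = vec (T v) * y := by
  obtain ⟨l, -, rfl⟩ := T.reflections_generate_dim
  induction l with
  | nil => exact ⟨1, one_mem _, fun v => by simp⟩
  | cons u l ih =>
    obtain ⟨y, hy, h⟩ := ih
    rw [List.map_cons, List.prod_cons]
    by_cases hu : u = 0
    · refine ⟨y, hy, fun v => ?_⟩
      rw [h, LinearIsometryEquiv.coe_mul, Function.comp_apply]
      congr 2
      subst hu
      rw [Submodule.reflection_orthogonal_apply]
      simp
    · set w : Euc n := ‖u‖⁻¹ • u with hw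
      have hw1 : ⟪w, w⟫ = 1 := by
        rw [hw, inner_smul_left, inner_smul_right, real_inner_self_eq_norm_sq]
        have := norm_ne_zero_iff.2 hu
        simp
        field_simp
      refine ⟨vec w * y, mul_mem (vec_mem_pinGroup hw1) hy, fun v => ?_⟩
      set v' := (List.map (fun v => (ℝ ∙ v)ᗮ.reflection) l).prod v with hv'
      have h1 : (ℝ ∙ u)ᗮ.reflection v' = v' - (2 * ⟪w, v'⟫) • w := by
        rw [Submodule.reflection_orthogonal_apply, Submodule.reflection_singleton_apply, hw,
          inner_smul_left, smul_smul]
        have := norm_ne_zero_iff.2 hu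
        rw [neg_sub]
        congr 1
        rw [← Nat.cast_smul_eq_nsmul ℝ, smul_smul]
        congr 1
        simp
        field_simp
      rw [LinearIsometryEquiv.coe_mul, Function.comp_apply, ← hv', h1, map_mul, involute_ι,
        mul_assoc, h, ← vec_mul_vec_mul_vec hw1, neg_mul, ← mul_assoc,
        mul_assoc _ (vec w) (vec w * y), ← mul_assoc (vec w) (vec w) y, vec_mul_self, hw1, ← hv']
      simp

theorem neg_one_mem_pinGroup (hn : 1 ≤ n) : (-1 : Cl n) ∈ pinGroup (negForm n) := by
  have h : ⟪(EuclideanSpace.single ⟨0, hn⟩ 1 : Euc n), EuclideanSpace.single ⟨0, hn⟩ 1⟫ = 1 := by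
    simp
  have h1 := mul_mem (vec_mem_pinGroup h) (vec_mem_pinGroup h)
  rwa [vec_mul_self, h, map_neg, map_one] at h1

/-- An even unitary element of `C_n` that conjugates vectors to vectors lies in `Spin(n)`. -/
theorem mem_spinGroup_of_conj (hn : 1 ≤ n) {a : Cl n} (heven : involute a = a)
    (h1 : a * star a = 1) (h2 : star a * a = 1)
    (hconj : ∀ v : Euc n, ∃ w : Euc n, a * vec v * star a = vec w) :
    a ∈ spinGroup (negForm n) := by
  choose T hT using hconj
  have hTa : ∀ v, a * vec v = vec (T v) * a := fun v => by
    rw [← hT, mul_assoc, h2, mul_one]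
  have hadd : ∀ u v, T (u + v) = T u + T v := fun u v => vec_injective (by
    rw [vec_add, ← hT, ← hT, ← hT, vec_add, mul_add, add_mul])
  have hsmul : ∀ (c : ℝ) v, T (c • v) = c • T v := fun c v => vec_injective (by
    rw [vec_smul, ← hT, ← hT, vec_smul, mul_smul_comm, smul_mul_assoc])
  have hnorm : ∀ v, ‖T v‖ = ‖v‖ := by
    intro v
    have h3 : algebraMap ℝ (Cl n) (-⟪T v, T v⟫) = algebraMap ℝ (Cl n) (-⟪v, v⟫) := by
      have h4 : vec (T v) * a * (vec v * star a) = vec (T v) * vec (T v) := by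
        rw [mul_assoc, ← mul_assoc a, hT]
      rw [← vec_mul_self, ← h4, ← hTa, mul_assoc, ← mul_assoc (vec v), vec_mul_self,
        ← mul_assoc, ← Algebra.commutes, mul_assoc, h1, mul_one]
    have h5 := (algebraMap ℝ (Cl n)).injective h3
    rw [real_inner_self_eq_norm_sq, real_inner_self_eq_norm_sq, neg_inj] at h5
    exact (sq_eq_sq₀ (norm_nonneg _) (norm_nonneg _)).1 h5
  let L : Euc n →ₗᵢ[ℝ] Euc n :=
    { toFun := T, map_add' := hadd, map_smul' := hsmul, norm_map' := hnorm }
  obtain ⟨y, hy, hyT⟩ := exists_pin (L.toLinearIsometryEquiv rfl)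
  have hy1 := pinGroup.star_mul_self_of_mem hy
  have hy2 := pinGroup.mul_star_self_of_mem hy
  -- `y* a` is a scalar
  have hinv : involute (star y) * involute y = 1 := by rw [← map_mul, hy1, map_one]
  obtain ⟨r, hr⟩ := exists_eq_algebraMap (star y * a) (fun v => by
    have h3 : vec v * star y = involute (star y) * vec (T v) := by
      have h4 : involute y * vec v = vec (T v) * y := hyT v
      calc vec v * star y = involute (star y) * (involute y * vec v) * star y := by
            rw [← mul_assoc, hinv, one_mul]
        _ = involute (star y) * vec (T v) := by
            rw [h4, mul_assoc, mul_assoc, hy2, mul_one]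
    rw [← mul_assoc, h3, mul_assoc, ← hTa, map_mul, heven, mul_assoc])
  have ha : a = algebraMap ℝ (Cl n) r * y := by
    rw [Algebra.commutes, ← hr, ← mul_assoc, hy2, one_mul]
  have hr2 : r * r = 1 := by
    have h3 : algebraMap ℝ (Cl n) (r * r) = algebraMap ℝ (Cl n) 1 := by
      have h4 : star a = algebraMap ℝ (Cl n) r * star y := by
        rw [ha, star_mul, Algebra.commutes]
        simp [CliffordAlgebra.star_def]
      rw [map_one, ← h1, h4]
      nth_rewrite 1 [ha]
      rw [mul_assoc, ← mul_assoc y, ← Algebra.commutes r y, mul_assoc, hy2, mul_one, map_mul]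
    exact (algebraMap ℝ (Cl n)).injective h3
  refine spinGroup.mem_iff.2 ⟨?_, mem_even_of_involute_eq heven⟩
  rcases mul_self_eq_one_iff.1 hr2 with rfl | rfl
  · rw [ha, map_one, one_mul]
    exact hy
  · rw [ha, map_neg, map_one]
    exact mul_mem (neg_one_mem_pinGroup hn) hy

/-- The stabilizer of the last basis vector in `Spin(k+1)` is `Spin(k)`. -/
theorem exists_spinIncl_eq (hk : 1 ≤ k) {x : Spin (k + 1)} (hx : rot x (lastVec k) = lastVec k) :
    ∃ y : Spin k, spinIncl k y = x := by
  have hs1 := spinGroup.star_mul_self_of_mem x.2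
  have hs2 := spinGroup.mul_star_self_of_mem x.2
  have hrot : ∀ v, (x : Cl (k + 1)) * vec v = vec (rot x v) * x := by
    intro v
    rw [vec_rot, reverse_coe, mul_assoc, hs1, mul_one]
  have hcomm := hrot (lastVec k)
  rw [hx] at hcomm
  have heven := spinGroup.involute_eq x.2
  obtain ⟨a, b, hab⟩ := exists_eq_add_mul (x : Cl (k + 1))
  -- `x = a + b e` with `a, b ∈ C_k`: since `x` is even and commutes with `e`, `b = 0`
  have h1 : involute a = a ∧ involute b = -b := by
    rw [hab, map_add, map_mul, involute_clIncl, involute_clIncl, involute_ι, mul_neg, ← neg_mul,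
      ← map_neg] at heven
    have h3 := congrArg (clPair k) heven
    rw [clPair_add_mul, clPair_add_mul] at h3
    have h4 : -involute b = b := congrArg Prod.snd h3
    exact ⟨congrArg Prod.fst h3, by rw [← neg_neg (involute b), h4]⟩
  have hb : b = 0 := by
    have e1 : vec (lastVec k) * (clIncl k a + clIncl k b * vec (lastVec k)) =
        clIncl k b + clIncl k a * vec (lastVec k) := by
      rw [mul_add, ← mul_assoc, lastVec_mul_clIncl, lastVec_mul_clIncl, mul_assoc,
        lastVec_mul_self, h1.1, h1.2, map_neg]
      noncomm_ring
    have e2 : (clIncl k a + clIncl k b * vec (lastVec k)) * vec (lastVec k) =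
        clIncl k (-b) + clIncl k a * vec (lastVec k) := by
      rw [add_mul, mul_assoc, lastVec_mul_self, map_neg]
      noncomm_ring
    rw [hab, e1, e2] at hcomm
    have h3 := congrArg (clPair k) hcomm
    rw [clPair_add_mul, clPair_add_mul] at h3
    have h4 : -b = b := congrArg Prod.fst h3
    have h6 : (2 : ℝ) • b = 0 := by
      rw [two_smul]
      nth_rewrite 1 [← h4]
      exact neg_add_cancel _
    exact (smul_eq_zero.1 h6).resolve_left two_ne_zero
  rw [hb, map_zero, zero_mul, add_zero] at hab
  have ha1 : a * star a = 1 := clIncl_injective (by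
    rw [map_mul, ← star_clIncl, ← hab, hs2, map_one])
  have ha2 : star a * a = 1 := clIncl_injective (by
    rw [map_mul, ← star_clIncl, ← hab, hs1, map_one])
  have hmem := mem_spinGroup_of_conj hk h1.1 ha1 ha2 (fun v => by
    refine ⟨init k (rot x (incl k v)), ?_⟩
    have h3 := vec_rot x (incl k v)
    rw [reverse_coe, hab, star_clIncl, ← clIncl_vec, ← map_mul, ← map_mul] at h3
    rw [eq_incl_add_smul_lastVec (rot x (incl k v)), vec_add, vec_smul, ← clIncl_vec] at h3
    have h4 : clIncl k (vec (init k (rot x (incl k v)))) +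
        clIncl k (algebraMap ℝ _ (rot x (incl k v) (Fin.last k))) * vec (lastVec k) =
          clIncl k (a * vec v * star a) + clIncl k 0 * vec (lastVec k) := by
      rw [map_zero, zero_mul, add_zero, ← h3, AlgHom.commutes, ← Algebra.smul_def]
    have h5 := congrArg (clPair k) h4
    rw [clPair_add_mul, clPair_add_mul] at h5
    exact (congrArg Prod.fst h5).symm)
  exact ⟨⟨a, hmem⟩, Subtype.ext hab.symm⟩

end Stabilizer

end SpinCPreq
end

/-! ### Coordinates on Spinᶜ and stereographic rotations -/

noncomputable section

namespace SpinCPreq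

open CliffordAlgebra

section SpinCCoordinates

variable {n : ℕ}

theorem SpinC.exists_eq_mk (s : SpinC n) : ∃ x z, s = SpinC.mk x z := by
  obtain ⟨⟨x, z⟩, rfl⟩ := QuotientGroup.mk_surjective s
  exact ⟨x, z, rfl⟩

theorem SpinC.mk_mul_mk (x y : Spin n) (z w : Circle) :
    SpinC.mk x z * SpinC.mk y w = SpinC.mk (x * y) (z * w) := rfl

theorem SpinC.mk_inv (x : Spin n) (z : Circle) : (SpinC.mk x z)⁻¹ = SpinC.mk x⁻¹ z⁻¹ := rfl

theorem SpinC.coeff_mk (l : Module.Dual ℝ (Cl n)) (x : Spin n) (z : Circle) :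
    SpinC.coeff l (SpinC.mk x z) = (z : ℂ) * (l (x : Cl n) : ℂ) := rfl

/-- The conjugation of `C_n` as a linear map. -/
def starLin (n : ℕ) : Cl n →ₗ[ℝ] Cl n := reverse ∘ₗ (involute : Cl n →ₐ[ℝ] Cl n).toLinearMap

theorem SpinC.coeff_inv (l : Module.Dual ℝ (Cl n)) (s : SpinC n) :
    SpinC.coeff l s⁻¹ = (starRingEnd ℂ) (SpinC.coeff (l ∘ₗ starLin n) s) := by
  obtain ⟨x, z, rfl⟩ := s.exists_eq_mk
  rw [mk_inv, coeff_mk, coeff_mk, map_mul, Complex.conj_ofReal, Circle.coe_inv_eq_conj]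
  rfl

/-- The coordinates of a product are bilinear in those of the factors. -/
theorem SpinC.exists_coeff_mul (l : Module.Dual ℝ (Cl n)) :
    ∃ (N : ℕ) (b : Fin N → Module.Dual ℝ (Cl n)) (c : Fin N → Fin N → ℂ), ∀ s t : SpinC n,
      SpinC.coeff l (s * t) = ∑ i, ∑ j, SpinC.coeff (b i) s * SpinC.coeff (b j) t * c i j := by
  let B := Module.finBasis ℝ (Cl n)
  refine ⟨_, fun i => B.coord i, fun i j => (l (B i * B j) : ℂ), fun s t => ?_⟩
  obtain ⟨x, z, rfl⟩ := s.exists_eq_mk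
  obtain ⟨y, w, rfl⟩ := t.exists_eq_mk
  have h : (x : Cl n) * (y : Cl n) =
      ∑ i, ∑ j, (B.coord i (x : Cl n) * B.coord j (y : Cl n)) • (B i * B j) := by
    conv_lhs => rw [← B.sum_repr (x : Cl n), ← B.sum_repr (y : Cl n)]
    rw [Finset.sum_mul_sum]
    refine Finset.sum_congr rfl fun i _ => Finset.sum_congr rfl fun j _ => ?_
    rw [smul_mul_smul_comm]
    rfl
  rw [mk_mul_mk, coeff_mk, Submonoid.coe_mul, h]
  simp only [map_sum, map_smul, coeff_mk, Circle.coe_mul, smul_eq_mul, Complex.ofReal_sum,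
    Complex.ofReal_mul, Finset.mul_sum]
  refine Finset.sum_congr rfl fun i _ => Finset.sum_congr rfl fun j _ => ?_
  ring

section Smooth

variable {E H X : Type*} [NormedAddCommGroup E] [NormedSpace ℝ E] [TopologicalSpace H]
  [TopologicalSpace X] [ChartedSpace H X]

/-- A map into `Spinᶜ(n)`, seen in `C_n ⊗ ℂ`, is smooth on a set. -/
def SpinC.SmoothOn (I : ModelWithCorners ℝ E H) (f : X → SpinC n) (A : Set X) : Prop :=
  ∀ l, ContMDiffOn I 𝓘(ℝ, ℂ) ∞ (fun x => SpinC.coeff l (f x)) A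

variable {I : ModelWithCorners ℝ E H} {f h : X → SpinC n} {A : Set X}

theorem SpinC.SmoothOn.mul (hf : SpinC.SmoothOn I f A) (hh : SpinC.SmoothOn I h A) :
    SpinC.SmoothOn I (fun x => f x * h x) A := by
  intro l
  obtain ⟨N, b, c, hc⟩ := SpinC.exists_coeff_mul l
  simp only [hc]
  refine contMDiffOn_finsetSum fun i _ => contMDiffOn_finsetSum fun j _ => ?_
  have h2 : ContDiff ℝ ∞ (fun p : ℂ × ℂ => p.1 * p.2 * c i j) := by fun_prop
  exact h2.contMDiff.comp_contMDiffOn ((hf (b i)).prodMk_space (hh (b j)))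

theorem SpinC.SmoothOn.inv (hf : SpinC.SmoothOn I f A) :
    SpinC.SmoothOn I (fun x => (f x)⁻¹) A := by
  intro l
  simp only [SpinC.coeff_inv]
  exact (Complex.conjCLE.contDiff (n := ∞)).contMDiff.comp_contMDiffOn (hf _)

theorem SpinC.SmoothOn.const (s : SpinC n) : SpinC.SmoothOn I (fun _ : X => s) A :=
  fun _ => contMDiffOn_const

theorem SpinC.SmoothOn.congr (hf : SpinC.SmoothOn I f A) (hfh : ∀ x ∈ A, h x = f x) :
    SpinC.SmoothOn I h A := fun l => (hf l).congr fun x hx => by rw [hfh x hx]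

theorem SpinC.SmoothOn.comp {E' H' Y : Type*} [NormedAddCommGroup E'] [NormedSpace ℝ E']
    [TopologicalSpace H'] [TopologicalSpace Y] [ChartedSpace H' Y] {J : ModelWithCorners ℝ E' H'}
    {B : Set Y} {g : Y → X} (hf : SpinC.SmoothOn I f A) (hg : ContMDiffOn J I ∞ g B)
    (hgB : ∀ y ∈ B, g y ∈ A) : SpinC.SmoothOn J (fun y => f (g y)) B :=
  fun l => (hf l).comp hg hgB

/-- A map into `Spin(n)` that is smooth as a map into `C_n` gives smooth maps into `Spinᶜ(n)`. -/
theorem SpinC.SmoothOn.of_spin {f : X → Spin n}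
    (hf : ∀ l : Module.Dual ℝ (Cl n), ContMDiffOn I 𝓘(ℝ, ℝ) ∞ (fun x => l (f x : Cl n)) A) :
    SpinC.SmoothOn I (fun x => SpinC.mk (f x) 1) A := by
  intro l
  simp only [SpinC.coeff_mk, Circle.coe_one, one_mul]
  exact (Complex.ofRealCLM.contDiff (n := ∞)).contMDiff.comp_contMDiffOn (hf l)

end Smooth

end SpinCCoordinates

section Inclusion

variable {k : ℕ}

theorem spinCIncl_mk (x : Spin k) (z : Circle) :
    spinCIncl k (SpinC.mk x z) = SpinC.mk (spinIncl k x) z := rfl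

theorem spinCIncl_injective : Function.Injective (spinCIncl k) := by
  rw [injective_iff_map_eq_one]
  intro s hs
  obtain ⟨x, z, rfl⟩ := s.exists_eq_mk
  rw [spinCIncl_mk] at hs
  have h1 := (QuotientGroup.eq_one_iff (N := spinK (k + 1)) _).1 hs
  refine (QuotientGroup.eq_one_iff (N := spinK k) _).2 ?_
  rcases h1 with ⟨h1, h2⟩ | ⟨h1, h2⟩
  · exact Or.inl ⟨clIncl_injective (h1.trans (map_one _).symm), h2⟩
  · exact Or.inr ⟨clIncl_injective (h1.trans (by rw [map_neg, map_one])), h2⟩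

theorem coeff_spinCIncl (l : Module.Dual ℝ (Cl (k + 1))) (s : SpinC k) :
    SpinC.coeff l (spinCIncl k s) = SpinC.coeff (l ∘ₗ (clIncl k).toLinearMap) s := by
  obtain ⟨x, z, rfl⟩ := s.exists_eq_mk
  rfl

theorem coeff_eq_coeff_spinCIncl (l : Module.Dual ℝ (Cl k)) (s : SpinC k) :
    SpinC.coeff l s =
      SpinC.coeff (l ∘ₗ LinearMap.fst ℝ _ _ ∘ₗ clPair k) (spinCIncl k s) := by
  obtain ⟨x, z, rfl⟩ := s.exists_eq_mk
  rw [spinCIncl_mk, SpinC.coeff_mk, SpinC.coeff_mk]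
  have h : (clPair k (clIncl k (x : Cl k))).1 = x := by rw [clPair_clIncl]
  change (z : ℂ) * (l (x : Cl k) : ℂ) = (z : ℂ) * (l (clPair k (clIncl k (x : Cl k))).1 : ℂ)
  rw [h]

theorem exists_spinCIncl_eq (hk : 1 ≤ k) {x : Spin (k + 1)} (z : Circle)
    (hx : rot x (lastVec k) = lastVec k) : ∃ s : SpinC k, spinCIncl k s = SpinC.mk x z := by
  obtain ⟨y, rfl⟩ := exists_spinIncl_eq hk hx
  exact ⟨SpinC.mk y z, rfl⟩

variable {E H X : Type*} [NormedAddCommGroup E] [NormedSpace ℝ E] [TopologicalSpace H]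
  [TopologicalSpace X] [ChartedSpace H X] {I : ModelWithCorners ℝ E H}

theorem SpinC.smoothOn_spinCIncl_iff {f : X → SpinC k} {A : Set X} :
    SpinC.SmoothOn I (fun x => spinCIncl k (f x)) A ↔ SpinC.SmoothOn I f A := by
  constructor
  · intro h l
    simp only [coeff_eq_coeff_spinCIncl l]
    exact h _
  · intro h l
    simp only [coeff_spinCIncl]
    exact h _

end Inclusion

section Stereographic

variable {k : ℕ}

theorem inner_lastVec_self : ⟪lastVec k, lastVec k⟫ = (1 : ℝ) := by
  rw [inner_lastVec]; simp [lastVec]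

theorem inner_lastVec_incl (v : Euc k) : ⟪lastVec k, incl k v⟫ = 0 := by
  rw [real_inner_comm, inner_incl_lastVec]

theorem norm_init_sq_add (u : Euc (k + 1)) :
    ‖init k u‖ ^ 2 + u (Fin.last k) ^ 2 = ⟪u, u⟫ := by
  conv_rhs => rw [eq_incl_add_smul_lastVec u]
  rw [inner_add_left, inner_add_right, inner_add_right, inner_smul_left,
    inner_smul_right, inner_smul_left, inner_smul_right, inner_incl, inner_incl_lastVec,
    inner_lastVec_incl, inner_lastVec_self, real_inner_self_eq_norm_sq]
  simp [sq]

theorem one_add_norm_sq_pos (w : Euc k) : 0 < 1 + ‖w‖ ^ 2 := by positivity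

/-- The unit vector midway between the last basis vector and the point of the sphere with
stereographic coordinates `w`. -/
def midVec (w : Euc k) : Euc (k + 1) := (√(1 + ‖w‖ ^ 2))⁻¹ • (incl k w + lastVec k)

theorem inner_midVec (w : Euc k) : ⟪-midVec w, -midVec w⟫ = 1 := by
  have h := one_add_norm_sq_pos w
  have h2 : √(1 + ‖w‖ ^ 2) ≠ 0 := (Real.sqrt_pos.2 h).ne'
  have h3 := Real.mul_self_sqrt h.le
  rw [inner_neg_neg, midVec, inner_smul_left, inner_smul_right, inner_add_left, inner_add_right,
    inner_add_right, inner_incl, inner_incl_lastVec, inner_lastVec_incl,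
    inner_lastVec_self, real_inner_self_eq_norm_sq]
  simp
  field_simp
  nlinarith

/-- A smooth family of elements of `Spin(k+1)`, equal to `1` at `0`, that moves the last basis
vector to the point of the sphere with stereographic coordinates `w`. -/
def stereoSpin (w : Euc k) : Spin (k + 1) :=
  spinPair (-midVec w) (lastVec k) (inner_midVec w) inner_lastVec_self

theorem stereoSpin_zero : stereoSpin (0 : Euc k) = 1 := by
  apply Subtype.ext
  rw [stereoSpin, coe_spinPair, midVec]
  rw [Submonoid.coe_one, ← neg_neg (1 : Cl (k + 1)), ← lastVec_mul_self (k := k)]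
  simp only [map_zero, zero_add, norm_zero, ne_eq, OfNat.ofNat_ne_zero, not_false_eq_true,
    zero_pow, add_zero, Real.sqrt_one, inv_one, one_smul]
  rw [← neg_mul]
  congr 1
  exact map_neg _ _

theorem rot_stereoSpin (w : Euc k) :
    rot (stereoSpin w) (lastVec k) =
      (2 / (1 + ‖w‖ ^ 2)) • (incl k w + lastVec k) - lastVec k := by
  have h := one_add_norm_sq_pos w
  have h3 := Real.mul_self_sqrt h.le
  have h2 : √(1 + ‖w‖ ^ 2) ≠ 0 := (Real.sqrt_pos.2 h).ne'
  have h5 : lastVec k - (2 * (1 : ℝ)) • lastVec k = -lastVec k := by module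
  have h6 : ⟪-midVec w, -lastVec k⟫ = (√(1 + ‖w‖ ^ 2))⁻¹ := by
    rw [inner_neg_neg, midVec, inner_smul_left, inner_add_left, inner_incl_lastVec,
      inner_lastVec_self]
    simp
  rw [stereoSpin, rot_spinPair, inner_lastVec_self, h5, h6, midVec, smul_neg, smul_smul]
  have h7 : 2 * (√(1 + ‖w‖ ^ 2))⁻¹ * (√(1 + ‖w‖ ^ 2))⁻¹ = 2 / (1 + ‖w‖ ^ 2) := by
    rw [mul_assoc, ← mul_inv, h3]; rfl
  rw [h7]
  abel

theorem contDiff_midVec : ContDiff ℝ ∞ (midVec : Euc k → Euc (k + 1)) := by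
  unfold midVec
  have h1 : ContDiff ℝ ∞ (fun w : Euc k => incl k w) := (incl k).toContinuousLinearMap.contDiff
  have h2 : ContDiff ℝ ∞ (fun w : Euc k => 1 + ‖w‖ ^ 2) := contDiff_const.add (contDiff_norm_sq ℝ)
  refine ContDiff.smul (ContDiff.inv (h2.sqrt fun w => (one_add_norm_sq_pos w).ne') fun w => ?_)
    (h1.add contDiff_const)
  exact (Real.sqrt_pos.2 (one_add_norm_sq_pos w)).ne'

theorem contDiff_stereoSpin (l : Module.Dual ℝ (Cl (k + 1))) :
    ContDiff ℝ ∞ (fun w : Euc k => l (stereoSpin w : Cl (k + 1))) := by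
  let L : Euc (k + 1) →ₗ[ℝ] ℝ :=
    l ∘ₗ LinearMap.mulRight ℝ (vec (lastVec k)) ∘ₗ (ι (negForm (k + 1))) ∘ₗ (-LinearMap.id)
  exact L.toContinuousLinearMap.contDiff.comp contDiff_midVec

theorem smoothOn_stereoSpin :
    SpinC.SmoothOn 𝓘(ℝ, Euc k) (fun w : Euc k => SpinC.mk (stereoSpin w) 1) Set.univ :=
  SpinC.SmoothOn.of_spin fun l => (contDiff_stereoSpin l).contMDiff.contMDiffOn

/-- The stereographic coordinates of a point of the sphere other than minus the last basis
vector. -/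
def stereoCoord (u : Euc (k + 1)) : Euc k := (1 + u (Fin.last k))⁻¹ • init k u

theorem contDiffOn_stereoCoord :
    ContDiffOn ℝ ∞ (stereoCoord : Euc (k + 1) → Euc k) {u | -1 < u (Fin.last k)} := by
  unfold stereoCoord
  have h1 : ContDiff ℝ ∞ (fun u : Euc (k + 1) => init k u) :=
    (init k).toContinuousLinearMap.contDiff
  have h2 : ContDiff ℝ ∞ (fun u : Euc (k + 1) => 1 + u (Fin.last k)) := by fun_prop
  refine ContDiffOn.smul (ContDiffOn.inv h2.contDiffOn fun u hu => ?_) h1.contDiffOn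
  have : -1 < u (Fin.last k) := hu
  linarith

theorem stereoCoord_lastVec : stereoCoord (lastVec k) = 0 := by
  rw [stereoCoord, init_lastVec, smul_zero]

theorem rot_stereoSpin_stereoCoord {u : Euc (k + 1)} (hu : ⟪u, u⟫ = 1)
    (h : -1 < u (Fin.last k)) : rot (stereoSpin (stereoCoord u)) (lastVec k) = u := by
  have e1 := eq_incl_add_smul_lastVec u
  set a := u (Fin.last k) with ha
  set v := init k u with hv
  have e2 : ‖v‖ ^ 2 + a ^ 2 = 1 := (norm_init_sq_add u).trans hu
  have h1 : 0 < 1 + a := by linarith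
  rw [rot_stereoSpin, stereoCoord, ← ha, ← hv, norm_smul, norm_inv, Real.norm_eq_abs,
    abs_of_pos h1, map_smul]
  have h3 : 2 / (1 + ((1 + a)⁻¹ * ‖v‖) ^ 2) = 1 + a := by
    have h4 : 1 + ((1 + a)⁻¹ * ‖v‖) ^ 2 = 2 / (1 + a) := by
      rw [mul_pow, (by linarith : ‖v‖ ^ 2 = 1 - a ^ 2)]
      field_simp
      ring
    rw [h4]
    field_simp
  rw [h3, smul_add, smul_smul, mul_inv_cancel₀ h1.ne', one_smul]
  conv_rhs => rw [e1]
  module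

theorem stereoCoord_rot_stereoSpin (w : Euc k) :
    stereoCoord (rot (stereoSpin w) (lastVec k)) = w := by
  have h := one_add_norm_sq_pos w
  rw [rot_stereoSpin, stereoCoord, map_sub, map_smul, map_add, init_incl, init_lastVec]
  have h1 : ((2 / (1 + ‖w‖ ^ 2)) • (incl k w + lastVec k) - lastVec k : Euc (k + 1)) (Fin.last k)
      = 2 / (1 + ‖w‖ ^ 2) - 1 := by
    simp [incl_apply_last, lastVec]
  rw [h1, add_zero, sub_zero, smul_smul]
  have h2 : (1 + (2 / (1 + ‖w‖ ^ 2) - 1))⁻¹ * (2 / (1 + ‖w‖ ^ 2)) = 1 := by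
    field_simp
    ring
  rw [h2, one_smul]

theorem neg_one_lt_rot_stereoSpin (w : Euc k) :
    -1 < (rot (stereoSpin w) (lastVec k)) (Fin.last k) := by
  have h := one_add_norm_sq_pos w
  rw [rot_stereoSpin]
  have : 0 < 2 / (1 + ‖w‖ ^ 2) := by positivity
  simpa [incl_apply_last, lastVec] using this

/-- Every unit vector can be moved away from minus the last basis vector by an element of
`Spin(k+1)`. -/
theorem exists_rot_neg_one_lt (hk : 1 ≤ k) {u : Euc (k + 1)} (hu : ⟪u, u⟫ = 1) :
    ∃ x : Spin (k + 1), -1 < (rot x u) (Fin.last k) := by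
  by_cases h : -1 < u (Fin.last k)
  · exact ⟨1, by rwa [rot_one]⟩
  · have e1 := eq_incl_add_smul_lastVec u
    set a := u (Fin.last k) with ha
    set v := init k u with hv
    have e2 : ‖v‖ ^ 2 + a ^ 2 = 1 := (norm_init_sq_add u).trans hu
    have ha1 : a = -1 := by nlinarith [sq_nonneg ‖v‖]
    have hv0 : v = 0 := by
      have : ‖v‖ ^ 2 = 0 := by nlinarith
      simpa using this
    rw [hv0, ha1, map_zero, zero_add] at e1
    let w : Euc k := EuclideanSpace.single ⟨0, hk⟩ 1
    have hw : ⟪incl k w, incl k w⟫ = 1 := by rw [inner_incl]; simp [w]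
    refine ⟨spinPair (lastVec k) (incl k w) inner_lastVec_self hw, ?_⟩
    have h5 : rot (spinPair (lastVec k) (incl k w) inner_lastVec_self hw) u = lastVec k := by
      rw [rot_spinPair, e1, inner_smul_right, inner_incl_lastVec, mul_zero, mul_zero, zero_smul,
        sub_zero, inner_smul_right, inner_lastVec_self]
      module
    rw [h5]
    simp [lastVec]

end Stereographic

end SpinCPreq
end

/-! ### Smooth families in the principal action -/

noncomputable section

namespace SpinCPreq

namespace SpinCStructure

variable {d r : ℕ} {M : Type*} [TopologicalSpace M] [ChartedSpace (Euc d) M]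
  [IsManifold (𝓡 d) ∞ M] {Q : ∀ x : M, Set (Euc r →ₗ[ℝ] TangentSpace (𝓡 d) x)}
  {P : Type*} [TopologicalSpace P] [ChartedSpace (Euc (spinCDim d r)) P]
  [IsManifold (𝓡 (spinCDim d r)) ∞ P] (S : SpinCStructure r Q P)

theorem proj_act (p : P) (s : SpinC r) : S.proj (S.act p s) = S.proj p :=
  ((S.fibre p _).2 ⟨s, rfl⟩).symm

theorem act_inv_act (p : P) (s : SpinC r) : S.act (S.act p s) s⁻¹ = p := by
  rw [← S.act_mul, mul_inv_cancel, S.act_one]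

theorem act_act_inv (p : P) (s : SpinC r) : S.act (S.act p s⁻¹) s = p := by
  rw [← S.act_mul, inv_mul_cancel, S.act_one]

variable {e : ℕ} {X : Type*} [TopologicalSpace X] [ChartedSpace (Euc e) X]
  [IsManifold (𝓡 e) ∞ X]

/-- The principal action is smooth along smooth families of group elements on any manifold: near a
point, a family is the restriction of one parametrized by a vector space. -/
theorem contMDiffOn_act {A : Set X} (hA : IsOpen A) {f : X → P} {s : X → SpinC r}
    (hf : ContMDiffOn (𝓡 e) (𝓡 (spinCDim d r)) ∞ f A) (hs : SpinC.SmoothOn (𝓡 e) s A) :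
    ContMDiffOn (𝓡 e) (𝓡 (spinCDim d r)) ∞ (fun x => S.act (f x) (s x)) A := by
  intro x₀ hx₀
  refine ContMDiffAt.contMDiffWithinAt ?_
  set φ := extChartAt (𝓡 e) x₀ with hφ
  have hopen : IsOpen (φ.target ∩ φ.symm ⁻¹' A) :=
    (continuousOn_extChartAt_symm x₀).isOpen_inter_preimage (isOpen_extChartAt_target x₀) hA
  have hmem : φ x₀ ∈ φ.target ∩ φ.symm ⁻¹' A := by
    refine ⟨mem_extChartAt_target x₀, ?_⟩
    change φ.symm (φ x₀) ∈ A
    rw [hφ, extChartAt_to_inv]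
    exact hx₀
  obtain ⟨ε, hε, hball⟩ := Metric.isOpen_iff.1 hopen _ hmem
  let b := OpenPartialHomeomorph.univBall (φ x₀) ε
  have hbt : b.target = Metric.ball (φ x₀) ε := OpenPartialHomeomorph.univBall_target _ hε
  have hbmem : ∀ t, b t ∈ Metric.ball (φ x₀) ε := fun t =>
    hbt ▸ b.map_source (by rw [OpenPartialHomeomorph.univBall_source]; trivial)
  let γ : Euc e → SpinC r := fun t => s (φ.symm (b t))
  have hγ : ∀ l, ContDiff ℝ ∞ fun t => SpinC.coeff l (γ t) := by
    intro l
    rw [← contMDiff_iff_contDiff, ← contMDiffOn_univ]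
    refine (hs l).comp (t := A) (I' := 𝓡 e) ?_ (fun t _ => (hball (hbmem t)).2)
    refine (contMDiffOn_extChartAt_symm x₀).comp (I' := 𝓡 e) (t := φ.target) ?_
      (fun t _ => (hball (hbmem t)).1)
    exact (OpenPartialHomeomorph.contDiff_univBall (n := ⊤)).contMDiff.contMDiffOn
  have hnhds : ∀ᶠ x in nhds x₀, x ∈ φ.source ∧ φ x ∈ Metric.ball (φ x₀) ε :=
    Filter.Eventually.and (extChartAt_source_mem_nhds (I := 𝓡 e) x₀)
      ((continuousAt_extChartAt x₀).preimage_mem_nhds (Metric.ball_mem_nhds _ hε))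
  have hb : ContMDiffAt (𝓡 e) (𝓡 e) ∞ (fun x => b.symm (φ x)) x₀ := by
    have h1 : ContMDiffAt (𝓡 e) (𝓡 e) ∞ b.symm (φ x₀) :=
      ((OpenPartialHomeomorph.contDiffOn_univBall_symm (n := ⊤)).contDiffAt
        (Metric.ball_mem_nhds _ hε)).contMDiffAt
    exact h1.comp x₀ contMDiffAt_extChartAt
  have h2 : ContMDiffAt (𝓡 e) (𝓡 (spinCDim d r)) ∞
      (fun x => S.act (f x) (γ (b.symm (φ x)))) x₀ :=
    (S.act_smooth e γ hγ).contMDiffAt.comp x₀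
      (((hf x₀ hx₀).contMDiffAt (hA.mem_nhds hx₀)).prodMk hb)
  refine h2.congr_of_eventuallyEq ?_
  filter_upwards [hnhds] with x hx
  have h3 : b (b.symm (φ x)) = φ x := b.right_inv (hbt ▸ hx.2)
  change _ = S.act (f x) (s (φ.symm (b (b.symm (φ x)))))
  rw [h3, φ.left_inv hx.1]

theorem contMDiff_act_right (s : SpinC r) :
    ContMDiff (𝓡 (spinCDim d r)) (𝓡 (spinCDim d r)) ∞ (fun p => S.act p s) :=
  contMDiffOn_univ.1 (S.contMDiffOn_act isOpen_univ contMDiffOn_id (SpinC.SmoothOn.const s))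

/-- If two families of points of `P` differ by the action of a family of elements of `Spinᶜ(r)`,
then the latter is smooth if the former are. -/
theorem smoothOn_of_act_eq {E H Y : Type*} [NormedAddCommGroup E] [NormedSpace ℝ E]
    [TopologicalSpace H] [TopologicalSpace Y] [ChartedSpace H Y] {J : ModelWithCorners ℝ E H}
    {A : Set Y} {f h : Y → P} {s : Y → SpinC r}
    (hf : ContMDiffOn J (𝓡 (spinCDim d r)) ∞ f A)
    (hh : ContMDiffOn J (𝓡 (spinCDim d r)) ∞ h A) (hs : ∀ y ∈ A, S.act (f y) (s y) = h y) :
    SpinC.SmoothOn J s A := by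
  intro l y hy
  obtain ⟨U, hU, hxU, σ, τ, -, -, hτ, hτs⟩ := S.locally_trivial (S.proj (f y))
  have hproj : ∀ z ∈ A, S.proj (h z) = S.proj (f z) := fun z hz => by rw [← hs z hz, S.proj_act]
  set B : Set Y := A ∩ f ⁻¹' (S.proj ⁻¹' U) with hB
  have hBA : B ⊆ A := Set.inter_subset_left
  have h1 : SpinC.SmoothOn J (fun z => τ (f z)) B :=
    SpinC.SmoothOn.comp (A := S.proj ⁻¹' U) hτs (hf.mono hBA) (fun z hz => hz.2)
  have h2 : SpinC.SmoothOn J (fun z => τ (h z)) B :=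
    SpinC.SmoothOn.comp (A := S.proj ⁻¹' U) hτs (hh.mono hBA)
      (fun z hz => by rw [Set.mem_preimage, hproj z hz.1]; exact hz.2)
  have h3 : SpinC.SmoothOn J s B := (h1.inv.mul h2).congr fun z hz => by
    rw [eq_inv_mul_iff_mul_eq]
    refine S.act_free (σ (S.proj (f z))) _ _ ?_
    have e2 := hτ (h z) (by rw [hproj z hz.1]; exact hz.2)
    rw [hproj z hz.1] at e2
    rw [S.act_mul, hτ (f z) hz.2, e2, hs z hz.1]
  refine (h3 l y ⟨hy, hxU⟩).mono_of_mem_nhdsWithin ?_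
  have hopen : IsOpen (S.proj ⁻¹' U) := hU.preimage S.proj_smooth.continuous
  exact Filter.inter_mem self_mem_nhdsWithin
    ((hf.continuousOn y hy).preimage_mem_nhdsWithin (hopen.mem_nhds hxU))

end SpinCStructure

end SpinCPreq
end

/-! ### Pullbacks of differential forms -/

noncomputable section

namespace SpinCPreq

section PullbackSmooth

variable {V W F : Type*} [NormedAddCommGroup V] [NormedSpace ℝ V] [NormedAddCommGroup W]
  [NormedSpace ℝ W] [NormedAddCommGroup F] [NormedSpace ℝ F] {r : ℕ}

/-- A continuous left inverse of the inclusion of the alternating maps in the multilinear maps; it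
reduces the smoothness of pullbacks of alternating maps to that of multilinear maps. -/
def alternatizationCLM (V F : Type*) [NormedAddCommGroup V] [NormedSpace ℝ V]
    [NormedAddCommGroup F] [NormedSpace ℝ F] (r : ℕ) :
    ContinuousMultilinearMap ℝ (fun _ : Fin r => V) F →L[ℝ] (V [⋀^Fin r]→L[ℝ] F) :=
  LinearMap.mkContinuous
    { toFun := fun f => ((r.factorial : ℝ)⁻¹) • f.alternatization
      map_add' := fun f g => by rw [map_add, smul_add]
      map_smul' := fun c f => by
        ext v
        simp only [ContinuousAlternatingMap.smul_apply,
          ContinuousMultilinearMap.alternatization_apply_apply,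
          smul_apply, RingHom.id_apply, Finset.smul_sum]
        refine Finset.sum_congr rfl fun σ _ => ?_
        rw [smul_comm c, smul_comm c] } 1 (fun f => by
    refine ContinuousAlternatingMap.opNorm_le_bound _
      (mul_nonneg zero_le_one (norm_nonneg _)) fun v => ?_
    change ‖((r.factorial : ℝ)⁻¹) • f.alternatization v‖ ≤ _
    rw [ContinuousMultilinearMap.alternatization_apply_apply, norm_smul, norm_inv,
      Real.norm_natCast, one_mul, inv_mul_le_iff₀ (by positivity)]
    calc ‖∑ σ : Equiv.Perm (Fin r), Equiv.Perm.sign σ • f (v ∘ σ)‖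
        ≤ ∑ σ : Equiv.Perm (Fin r), ‖f‖ * ∏ i, ‖v i‖ := by
          refine norm_sum_le_of_le _ fun σ _ => ?_
          have h1 : ‖Equiv.Perm.sign σ • f (v ∘ σ)‖ = ‖f (v ∘ σ)‖ := by
            rcases Int.units_eq_one_or (Equiv.Perm.sign σ) with h | h <;> simp [h]
          rw [h1]
          refine (f.le_opNorm _).trans_eq ?_
          congr 1
          exact Equiv.prod_comp σ fun i => ‖v i‖
      _ = r.factorial * (‖f‖ * ∏ i, ‖v i‖) := by
          rw [Finset.sum_const, Finset.card_univ, Fintype.card_perm, Fintype.card_fin,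
            nsmul_eq_mul])

theorem alternatizationCLM_coe (f : V [⋀^Fin r]→L[ℝ] F) :
    alternatizationCLM V F r f.toContinuousMultilinearMap = f := by
  ext v
  change ((r.factorial : ℝ)⁻¹) • f.toContinuousMultilinearMap.alternatization v = f v
  rw [ContinuousMultilinearMap.alternatization_apply_apply]
  have h1 : ∀ σ : Equiv.Perm (Fin r),
      Equiv.Perm.sign σ • f.toContinuousMultilinearMap (v ∘ σ) = f v := by
    intro σ
    change Equiv.Perm.sign σ • f.toAlternatingMap (v ∘ σ) = f v
    rw [AlternatingMap.map_perm, smul_smul, Int.units_mul_self, one_smul]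
    rfl
  rw [Finset.sum_congr rfl fun σ _ => h1 σ, Finset.sum_const, Finset.card_univ,
    Fintype.card_perm, Fintype.card_fin, ← Nat.cast_smul_eq_nsmul ℝ, smul_smul,
    inv_mul_cancel₀ (by positivity), one_smul]

theorem contDiff_compContinuousLinearMap :
    ContDiff ℝ ∞ (fun y : (W [⋀^Fin r]→L[ℝ] F) × (V →L[ℝ] W) =>
      y.1.compContinuousLinearMap y.2) := by
  have h1 : (fun y : (W [⋀^Fin r]→L[ℝ] F) × (V →L[ℝ] W) => y.1.compContinuousLinearMap y.2) =
      fun y => alternatizationCLM V F r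
        (ContinuousMultilinearMap.compContinuousLinearMapContinuousMultilinear ℝ
          (fun _ : Fin r => V) (fun _ : Fin r => W) F (fun _ => y.2)
          (ContinuousAlternatingMap.toContinuousMultilinearMapCLM ℝ y.1)) := by
    funext y
    exact (alternatizationCLM_coe _).symm
  rw [h1]
  refine (alternatizationCLM V F r).contDiff.comp (ContDiff.clm_apply ?_ ?_)
  · refine (ContinuousMultilinearMap.contDiff _).comp ?_
    exact contDiff_pi.2 fun _ => contDiff_snd
  · exact (ContinuousLinearMap.contDiff _).comp contDiff_fst

end PullbackSmooth

namespace DForm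

variable {d e r : ℕ} {M N : Type*} [TopologicalSpace M] [ChartedSpace (Euc d) M]
  [TopologicalSpace N] [ChartedSpace (Euc e) N]
  {F : Type*} [NormedAddCommGroup F] [NormedSpace ℝ F]

theorem pullback_apply (f : M → N) (α : DForm e N r F) (x : M)
    (v : Fin r → TangentSpace (𝓡 d) x) :
    DForm.pullback (d := d) f α x v = α (f x) (fun i => mfderiv (𝓡 d) (𝓡 e) f x (v i)) := rfl

theorem pullback_comp_at {c : ℕ} {L : Type*} [TopologicalSpace L] [ChartedSpace (Euc c) L]
    {f : M → N} {g : N → L} (α : DForm c L r F) {x : M}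
    (hg : MDifferentiableAt (𝓡 e) (𝓡 c) g (f x)) (hf : MDifferentiableAt (𝓡 d) (𝓡 e) f x) :
    DForm.pullback (d := d) (g ∘ f) α x = DForm.pullback f (DForm.pullback (d := e) g α) x := by
  ext v
  rw [pullback_apply, pullback_apply, pullback_apply]
  rw [mfderiv_comp x hg hf]
  rfl

/-- The pullback along a surjective map with surjective differentials is injective. -/
theorem pullback_injective {f : M → N} (hf : Function.Surjective f)
    (hdf : ∀ x, Function.Surjective (mfderiv (𝓡 d) (𝓡 e) f x)) {α β : DForm e N r F}
    (h : DForm.pullback (d := d) f α = DForm.pullback (d := d) f β) : α = β := by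
  funext y
  obtain ⟨x, rfl⟩ := hf y
  ext v
  choose w hw using fun i => hdf x (v i)
  have h1 := congrArg (fun L => L w) (congrFun h x)
  simp only [pullback_apply, hw] at h1
  exact h1

theorem onVelocity_pullback {f : M → N} (α : DForm e N 1 F) {c : ℝ → M}
    (hf : MDifferentiableAt (𝓡 d) (𝓡 e) f (c 0))
    (hc : MDifferentiableAt 𝓘(ℝ, ℝ) (𝓡 d) c 0) :
    (DForm.pullback (d := d) f α).onVelocity c = α.onVelocity (fun t => f (c t)) := by
  have h1 : mfderiv 𝓘(ℝ, ℝ) (𝓡 e) (fun t => f (c t)) 0 =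
      (mfderiv (𝓡 d) (𝓡 e) f (c 0)).comp (mfderiv 𝓘(ℝ, ℝ) (𝓡 d) c 0) := mfderiv_comp 0 hf hc
  rw [onVelocity, onVelocity, h1]
  rfl

variable [IsManifold (𝓡 d) ∞ M] [IsManifold (𝓡 e) ∞ N]

/-- The chart expression of a pullback is the pullback of the chart expression. -/
theorem eventually_inChart_eq {β : DForm d M r F} {α : DForm e N r F} {i : M → N} {U : Set M}
    (hU : IsOpen U) (hi : ContMDiffOn (𝓡 d) (𝓡 e) ∞ i U)
    (hβ : ∀ y ∈ U, β y = DForm.pullback (d := d) i α y)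
    (x₀ : M) {t : Euc d} (ht : t ∈ (extChartAt (𝓡 d) x₀).target)
    (htU : (extChartAt (𝓡 d) x₀).symm t ∈ U) (z₀ : N)
    (hz : i ((extChartAt (𝓡 d) x₀).symm t) ∈ (extChartAt (𝓡 e) z₀).source) :
    ContDiffAt ℝ ∞ (fun s => extChartAt (𝓡 e) z₀ (i ((extChartAt (𝓡 d) x₀).symm s))) t ∧
    ∀ᶠ s in nhds t, β.inChart x₀ s =
      (α.inChart z₀ (extChartAt (𝓡 e) z₀ (i ((extChartAt (𝓡 d) x₀).symm s)))).compContinuousLinearMap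
        (fderiv ℝ (fun s => extChartAt (𝓡 e) z₀ (i ((extChartAt (𝓡 d) x₀).symm s))) s) := by
  set φ := extChartAt (𝓡 d) x₀ with hφ
  set ψ := extChartAt (𝓡 e) z₀ with hψ
  set D : Set (Euc d) := φ.target ∩ φ.symm ⁻¹' (U ∩ i ⁻¹' ψ.source) with hD
  have hUi : IsOpen (U ∩ i ⁻¹' ψ.source) :=
    hi.continuousOn.isOpen_inter_preimage hU (isOpen_extChartAt_source z₀)
  have hDo : IsOpen D :=
    (continuousOn_extChartAt_symm x₀).isOpen_inter_preimage (isOpen_extChartAt_target x₀) hUi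
  have htD : t ∈ D := ⟨ht, htU, hz⟩
  have hφs : ContMDiffOn 𝓘(ℝ, Euc d) (𝓡 d) ∞ φ.symm φ.target := contMDiffOn_extChartAt_symm x₀
  have hφs' : ∀ s ∈ D, ContMDiffAt 𝓘(ℝ, Euc d) (𝓡 d) ∞ φ.symm s := fun s hs =>
    hφs.contMDiffAt ((isOpen_extChartAt_target x₀).mem_nhds hs.1)
  have his : ∀ s ∈ D, ContMDiffAt (𝓡 d) (𝓡 e) ∞ i (φ.symm s) := fun s hs =>
    hi.contMDiffAt (hU.mem_nhds hs.2.1)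
  have hψs : ∀ s ∈ D, ContMDiffAt (𝓡 e) 𝓘(ℝ, Euc e) ∞ ψ (i (φ.symm s)) := fun s hs =>
    contMDiffAt_extChartAt' (by rw [← extChartAt_source (𝓡 e)]; exact hs.2.2)
  have hh : ∀ s ∈ D, ContMDiffAt 𝓘(ℝ, Euc d) 𝓘(ℝ, Euc e) ∞ (fun s => ψ (i (φ.symm s))) s :=
    fun s hs => (hψs s hs).comp s ((his s hs).comp s (hφs' s hs))
  refine ⟨(hh t htD).contDiffAt, ?_⟩
  filter_upwards [hDo.mem_nhds htD] with s hs
  -- on `D` the map `i ∘ φ⁻¹` is `ψ⁻¹ ∘ h`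
  have e1 : (fun s => i (φ.symm s)) =ᶠ[nhds s] fun s => ψ.symm (ψ (i (φ.symm s))) := by
    filter_upwards [hDo.mem_nhds hs] with s' hs'
    exact (ψ.left_inv hs'.2.2).symm
  have hψsymm : ContMDiffAt 𝓘(ℝ, Euc e) (𝓡 e) ∞ ψ.symm (ψ (i (φ.symm s))) :=
    (contMDiffOn_extChartAt_symm z₀).contMDiffAt
      ((isOpen_extChartAt_target z₀).mem_nhds (ψ.map_source hs.2.2))
  have hne : (∞ : WithTop ℕ∞) ≠ 0 := by simp
  have e2 : mfderiv 𝓘(ℝ, Euc d) (𝓡 e) (fun s => i (φ.symm s)) s =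
      (mfderiv (𝓡 d) (𝓡 e) i (φ.symm s)).comp (mfderiv 𝓘(ℝ, Euc d) (𝓡 d) φ.symm s) :=
    mfderiv_comp s ((his s hs).mdifferentiableAt hne) ((hφs' s hs).mdifferentiableAt hne)
  have e3 : mfderiv 𝓘(ℝ, Euc d) (𝓡 e) (fun s => ψ.symm (ψ (i (φ.symm s)))) s =
      (mfderiv 𝓘(ℝ, Euc e) (𝓡 e) ψ.symm (ψ (i (φ.symm s)))).comp
        (fderiv ℝ (fun s => ψ (i (φ.symm s))) s) := by
    have e6 : fderiv ℝ (fun s => ψ (i (φ.symm s))) s =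
        mfderiv 𝓘(ℝ, Euc d) 𝓘(ℝ, Euc e) (fun s => ψ (i (φ.symm s))) s := mfderiv_eq_fderiv.symm
    refine Eq.trans ?_ (congrArg (fun L => (mfderiv 𝓘(ℝ, Euc e) (𝓡 e) ψ.symm
      (ψ (i (φ.symm s)))).comp L) e6.symm)
    exact mfderiv_comp s (hψsymm.mdifferentiableAt hne) ((hh s hs).mdifferentiableAt hne)
  have e4 := e1.mfderiv_eq (I := 𝓘(ℝ, Euc d)) (I' := 𝓡 e)
  have e5 : i (φ.symm s) = ψ.symm (ψ (i (φ.symm s))) := e1.self_of_nhds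
  ext v
  change β (φ.symm s) (fun j => mfderiv 𝓘(ℝ, Euc d) (𝓡 d) φ.symm s (v j)) =
    α (ψ.symm (ψ (i (φ.symm s)))) (fun j => mfderiv 𝓘(ℝ, Euc e) (𝓡 e) ψ.symm (ψ (i (φ.symm s)))
      (fderiv ℝ (fun s => ψ (i (φ.symm s))) s (v j)))
  rw [hβ _ hs.2.1, pullback_apply]
  have key : ∀ (y : N) (L : Euc d →L[ℝ] Euc e), y = i (φ.symm s) →
      L = mfderiv 𝓘(ℝ, Euc d) (𝓡 e) (fun s => i (φ.symm s)) s →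
      α (i (φ.symm s)) (fun j => mfderiv (𝓡 d) (𝓡 e) i (φ.symm s)
        (mfderiv 𝓘(ℝ, Euc d) (𝓡 d) φ.symm s (v j))) = α y (fun j => L (v j)) := by
    rintro _ _ rfl rfl
    rw [e2]
    rfl
  exact key _ _ e5.symm (e3.symm.trans e4.symm)

/-- Smoothness of a form that is locally a pullback of a smooth form. -/
theorem IsSmooth.of_local_pullback {β : DForm d M r F} {α : DForm e N r F} (hα : α.IsSmooth)
    (h : ∀ y₀ : M, ∃ U : Set M, IsOpen U ∧ y₀ ∈ U ∧ ∃ i : M → N,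
      ContMDiffOn (𝓡 d) (𝓡 e) ∞ i U ∧ ∀ y ∈ U, β y = DForm.pullback (d := d) i α y) :
    β.IsSmooth := by
  intro x₀ t ht
  obtain ⟨U, hU, hyU, i, hi, hβ⟩ := h ((extChartAt (𝓡 d) x₀).symm t)
  obtain ⟨h1, h2⟩ := eventually_inChart_eq hU hi hβ x₀ ht hyU _ (mem_extChartAt_source _)
  refine ContDiffAt.contDiffWithinAt ?_
  refine ContDiffAt.congr_of_eventuallyEq ?_ h2
  have h3 := (hα (i ((extChartAt (𝓡 d) x₀).symm t))).contDiffAt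
    ((isOpen_extChartAt_target (I := 𝓡 e) (i ((extChartAt (𝓡 d) x₀).symm t))).mem_nhds
      (mem_extChartAt_target _))
  exact contDiff_compContinuousLinearMap.contDiffAt.comp t
    ((h3.comp t h1).prodMk (h1.fderiv_right (m := ∞) (by simp)))

theorem IsSmooth.pullback {α : DForm e N r F} (hα : α.IsSmooth) {f : M → N}
    (hf : ContMDiff (𝓡 d) (𝓡 e) ∞ f) : (DForm.pullback (d := d) f α).IsSmooth :=
  hα.of_local_pullback fun _ => ⟨Set.univ, isOpen_univ, trivial, f, hf.contMDiffOn,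
    fun _ _ => rfl⟩

/-- The exterior derivative commutes with pullbacks. -/
theorem extD_pullback {α : DForm e N r F} (hα : α.IsSmooth) {f : M → N}
    (hf : ContMDiff (𝓡 d) (𝓡 e) ∞ f) :
    (DForm.pullback (d := d) f α).extD = DForm.pullback f α.extD := by
  funext x
  have hx : (extChartAt (𝓡 d) x).symm (extChartAt (𝓡 d) x x) = x := extChartAt_to_inv x
  obtain ⟨h1, h2⟩ := eventually_inChart_eq isOpen_univ hf.contMDiffOn
    (β := DForm.pullback (d := d) f α) (fun _ _ => rfl) x
    (mem_extChartAt_target x) trivial (f x) (by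
      rw [hx]; exact mem_extChartAt_source _)
  set ψ := extChartAt (𝓡 e) (f x)
  set φ := extChartAt (𝓡 d) x
  set h := fun s => ψ (f (φ.symm s)) with hh
  have h3 : h (φ x) = ψ (f x) := by rw [hh]; exact congrArg (fun z => ψ (f z)) hx
  have hαd : DifferentiableAt ℝ (α.inChart (f x)) (h (φ x)) := by
    rw [h3]
    exact ((hα (f x)).contDiffAt ((isOpen_extChartAt_target (f x)).mem_nhds
      (mem_extChartAt_target _))).differentiableAt (by simp)
  have h4 := Filter.EventuallyEq.extDeriv_eq h2
  have h5 := extDeriv_pullback (𝕜 := ℝ) hαd h1 (by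
    rw [minSmoothness_of_isRCLikeNormedField]
    exact ENat.LEInfty.out)
  have hne : (∞ : WithTop ℕ∞) ≠ 0 := by simp
  -- the chain rule for `ψ ∘ f = h ∘ φ`
  have h6 : (fderiv ℝ h (φ x)).comp (mfderiv (𝓡 d) 𝓘(ℝ, Euc d) φ x) =
      (mfderiv (𝓡 e) 𝓘(ℝ, Euc e) ψ (f x)).comp (mfderiv (𝓡 d) (𝓡 e) f x) := by
    have hφ1 : MDifferentiableAt (𝓡 d) 𝓘(ℝ, Euc d) φ x :=
      (contMDiffAt_extChartAt (n := ∞)).mdifferentiableAt hne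
    have hψ1 : MDifferentiableAt (𝓡 e) 𝓘(ℝ, Euc e) ψ (f x) :=
      (contMDiffAt_extChartAt (n := ∞)).mdifferentiableAt hne
    have e1 : fderiv ℝ h (φ x) = mfderiv 𝓘(ℝ, Euc d) 𝓘(ℝ, Euc e) h (φ x) :=
      mfderiv_eq_fderiv.symm
    refine (congrArg (fun L => L.comp (mfderiv (𝓡 d) 𝓘(ℝ, Euc d) φ x)) e1).trans ?_
    refine (mfderiv_comp x (h1.contMDiffAt.mdifferentiableAt hne) hφ1).symm.trans ?_
    refine Eq.trans ?_ (mfderiv_comp x hψ1 ((hf x).mdifferentiableAt hne))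
    refine Filter.EventuallyEq.mfderiv_eq ?_
    filter_upwards [extChartAt_source_mem_nhds (I := 𝓡 d) x] with y hy
    exact congrArg (fun z => ψ (f z)) (φ.left_inv hy)
  ext v
  change extDeriv ((DForm.pullback (d := d) f α).inChart x) (φ x)
    (fun j => mfderiv (𝓡 d) 𝓘(ℝ, Euc d) φ x (v j)) =
    extDeriv (α.inChart (f x)) (ψ (f x)) (fun j => mfderiv (𝓡 e) 𝓘(ℝ, Euc e) ψ (f x)
      (mfderiv (𝓡 d) (𝓡 e) f x (v j)))
  rw [h4, h5, h3]
  have h7 : ∀ w : Euc d, fderiv ℝ h (φ x) (mfderiv (𝓡 d) 𝓘(ℝ, Euc d) φ x w) =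
      mfderiv (𝓡 e) 𝓘(ℝ, Euc e) ψ (f x) (mfderiv (𝓡 d) (𝓡 e) f x w) :=
    fun w => congrArg (fun L : Euc d →L[ℝ] Euc e => L w) h6
  exact congrArg (extDeriv (α.inChart (f x)) (ψ (f x))) (funext fun j => h7 (v j))

end DForm

end SpinCPreq
end

/-! ### Smooth sections and generators of circle actions -/

noncomputable section

namespace SpinCPreq

section SmoothSections

variable {m d : ℕ} {M N : Type*} [TopologicalSpace M] [ChartedSpace (Euc m) M]
  [TopologicalSpace N] [ChartedSpace (Euc d) N] {π : M → N}
  {E H Y : Type*} [NormedAddCommGroup E] [NormedSpace ℝ E] [TopologicalSpace H]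
  {J : ModelWithCorners ℝ E H} [TopologicalSpace Y] [ChartedSpace H Y]
  {E' H' X : Type*} [NormedAddCommGroup E'] [NormedSpace ℝ E'] [TopologicalSpace H']
  {J' : ModelWithCorners ℝ E' H'} [TopologicalSpace X] [ChartedSpace H' X]

theorem HasSmoothSections.surjective_mfderiv
    (hs : HasSmoothSections (m := m) (d := d) π) (x : M) :
    Function.Surjective (mfderiv (𝓡 m) (𝓡 d) π x) := by
  intro v
  obtain ⟨U, hU, hxU, i, hi, hix, hπi⟩ := hs.exists_section x
  have hne : (∞ : WithTop ℕ∞) ≠ 0 := by simp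
  have h1 : MDifferentiableAt (𝓡 d) (𝓡 m) i (π x) :=
    (hi.contMDiffAt (hU.mem_nhds hxU)).mdifferentiableAt hne
  have h2 : mfderiv (𝓡 d) (𝓡 d) (π ∘ i) (π x) = ContinuousLinearMap.id ℝ _ := by
    rw [← mfderiv_id]
    refine Filter.EventuallyEq.mfderiv_eq ?_
    filter_upwards [hU.mem_nhds hxU] with y hy
    exact hπi y hy
  rw [mfderiv_comp _ ((hs.contMDiff _).mdifferentiableAt hne) h1] at h2
  have h3 : ∀ x', x' = x → ∀ w : Euc m, mfderiv (𝓡 m) (𝓡 d) π x' w =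
      mfderiv (𝓡 m) (𝓡 d) π x w := by rintro _ rfl w; rfl
  refine ⟨mfderiv (𝓡 d) (𝓡 m) i (π x) v, ?_⟩
  refine (h3 _ hix _).symm.trans ?_
  exact congrArg (fun L : Euc d →L[ℝ] Euc d => L v) h2

theorem HasSmoothSections.contMDiffOn_of_comp
    (hs : HasSmoothSections (m := m) (d := d) π) (hsurj : Function.Surjective π) {f : N → Y}
    {A : Set N} (hA : IsOpen A)
    (hf : ContMDiffOn (𝓡 m) J ∞ (fun x => f (π x)) (π ⁻¹' A)) : ContMDiffOn (𝓡 d) J ∞ f A := by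
  intro y hy
  obtain ⟨x, rfl⟩ := hsurj y
  obtain ⟨U, hU, hxU, i, hi, hix, hπi⟩ := hs.exists_section x
  refine ContMDiffAt.contMDiffWithinAt ?_
  have hB : IsOpen (π ⁻¹' A) := hA.preimage hs.contMDiff.continuous
  have h1 : ContMDiffAt (𝓡 d) J ∞ (fun y => f (π (i y))) (π x) := by
    refine ContMDiffAt.comp (π x) (g := fun x => f (π x)) ?_ (hi.contMDiffAt (hU.mem_nhds hxU))
    rw [hix]
    exact hf.contMDiffAt (hB.mem_nhds hy)
  refine h1.congr_of_eventuallyEq ?_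
  filter_upwards [hU.mem_nhds hxU] with y hy
  rw [hπi y hy]

theorem HasSmoothSections.contMDiff_of_comp
    (hs : HasSmoothSections (m := m) (d := d) π) (hsurj : Function.Surjective π) {f : N → Y}
    (hf : ContMDiff (𝓡 m) J ∞ (fun x => f (π x))) : ContMDiff (𝓡 d) J ∞ f :=
  contMDiffOn_univ.1 (hs.contMDiffOn_of_comp hsurj isOpen_univ hf.contMDiffOn)

theorem HasSmoothSections.contMDiff_of_comp_prod
    (hs : HasSmoothSections (m := m) (d := d) π) (hsurj : Function.Surjective π) {f : N × X → Y}
    (hf : ContMDiff ((𝓡 m).prod J') J ∞ (fun x : M × X => f (π x.1, x.2))) :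
    ContMDiff ((𝓡 d).prod J') J ∞ f := by
  rintro ⟨y, z⟩
  obtain ⟨x, rfl⟩ := hsurj y
  obtain ⟨U, hU, hxU, i, hi, -, hπi⟩ := hs.exists_section x
  have h1 : ContMDiffAt ((𝓡 d).prod J') J ∞ (fun y : N × X => f (π (i y.1), y.2)) (π x, z) := by
    refine ContMDiffAt.comp (I := (𝓡 d).prod J') (I' := (𝓡 m).prod J') (π x, z)
      (f := fun y : N × X => (i y.1, y.2)) (g := fun x : M × X => f (π x.1, x.2)) (hf _) ?_
    refine ContMDiffAt.prodMk ?_ contMDiffAt_snd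
    exact ContMDiffAt.comp (I' := 𝓡 d) (π x, z) (hi.contMDiffAt (hU.mem_nhds hxU))
      contMDiffAt_fst
  refine h1.congr_of_eventuallyEq ?_
  filter_upwards [(hU.prod isOpen_univ).mem_nhds ⟨hxU, Set.mem_univ z⟩] with y hy
  rw [hπi y.1 hy.1]

theorem HasSmoothSections.contMDiff_of_prod_comp
    (hs : HasSmoothSections (m := m) (d := d) π) (hsurj : Function.Surjective π) {f : X × N → Y}
    (hf : ContMDiff (J'.prod (𝓡 m)) J ∞ (fun x : X × M => f (x.1, π x.2))) :
    ContMDiff (J'.prod (𝓡 d)) J ∞ f :=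
  (hs.contMDiff_of_comp_prod (J' := J') hsurj (f := fun y : N × X => f (y.2, y.1))
    (hf.comp (contMDiff_snd.prodMk contMDiff_fst))).comp (contMDiff_snd.prodMk contMDiff_fst)

end SmoothSections

section Generator

theorem exp_zero_smul {M : Type*} [MulAction Circle M] (x : M) : Circle.exp 0 • x = x := by
  rw [Circle.exp_zero, one_smul]

variable {m e : ℕ} {M N : Type*} [TopologicalSpace M] [ChartedSpace (Euc m) M]
  [TopologicalSpace N] [ChartedSpace (Euc e) N] [MulAction Circle M]

theorem contMDiff_orbit [ContMDiffSMul (𝓡 1) (𝓡 m) ∞ Circle M] (x : M) :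
    ContMDiff 𝓘(ℝ, ℝ) (𝓡 m) ∞ (fun t : ℝ => Circle.exp t • x) :=
  contMDiff_exp_smul.comp (contMDiff_id.prodMk contMDiff_const)

theorem mdifferentiableAt_orbit [ContMDiffSMul (𝓡 1) (𝓡 m) ∞ Circle M] (x : M) (t : ℝ) :
    MDifferentiableAt 𝓘(ℝ, ℝ) (𝓡 m) (fun t : ℝ => Circle.exp t • x) t :=
  (contMDiff_orbit x t).mdifferentiableAt (by simp)

theorem mfderiv_generator_eq [ContMDiffSMul (𝓡 1) (𝓡 m) ∞ Circle M] {f : M → N} {x : M}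
    (hf : MDifferentiableAt (𝓡 m) (𝓡 e) f x) :
    mfderiv (𝓡 m) (𝓡 e) f x (generator m x) =
      mfderiv 𝓘(ℝ, ℝ) (𝓡 e) (fun t : ℝ => f (Circle.exp t • x)) 0 (1 : ℝ) := by
  have h0 := exp_zero_smul x
  have h1 : MDifferentiableAt (𝓡 m) (𝓡 e) f (Circle.exp 0 • x) := by rw [h0]; exact hf
  have h2 : mfderiv 𝓘(ℝ, ℝ) (𝓡 e) (fun t : ℝ => f (Circle.exp t • x)) 0 =
      (mfderiv (𝓡 m) (𝓡 e) f (Circle.exp 0 • x)).comp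
        (mfderiv 𝓘(ℝ, ℝ) (𝓡 m) (fun t : ℝ => Circle.exp t • x) 0) :=
    mfderiv_comp (0 : ℝ) h1 (mdifferentiableAt_orbit x 0)
  have h3 : ∀ x', x' = x → ∀ w : Euc m, mfderiv (𝓡 m) (𝓡 e) f x w =
      mfderiv (𝓡 m) (𝓡 e) f x' w := by rintro _ rfl w; rfl
  rw [h2]
  exact h3 _ h0 _

/-- Equivariant maps preserve the generators of circle actions. -/
theorem mfderiv_generator [MulAction Circle N] [ContMDiffSMul (𝓡 1) (𝓡 m) ∞ Circle M]
    {f : M → N} {x : M}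
    (hf : MDifferentiableAt (𝓡 m) (𝓡 e) f x) (heq : ∀ (c : Circle) (y : M), f (c • y) = c • f y) :
    mfderiv (𝓡 m) (𝓡 e) f x (generator m x) = generator e (f x) := by
  have h1 : (fun t : ℝ => f (Circle.exp t • x)) = fun t => Circle.exp t • f x :=
    funext fun t => heq _ _
  refine (mfderiv_generator_eq hf).trans ?_
  rw [h1, exp_zero_smul]
  rfl

theorem contMDiff_circle_smul [ContMDiffSMul (𝓡 1) (𝓡 m) ∞ Circle M] (c : Circle) :
    ContMDiff (𝓡 m) (𝓡 m) ∞ (fun x : M => c • x) :=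
  (contMDiff_smul (I := 𝓡 1) (I' := 𝓡 m) (n := ∞) (G := Circle) (M := M)).comp
    (contMDiff_const.prodMk contMDiff_id)

theorem mfderiv_smul_generator [ContMDiffSMul (𝓡 1) (𝓡 m) ∞ Circle M] (c : Circle) (x : M) :
    mfderiv (𝓡 m) (𝓡 m) (fun y : M => c • y) x (generator m x) = generator m (c • x) :=
  mfderiv_generator ((contMDiff_circle_smul c x).mdifferentiableAt (by simp))
    fun c' y => smul_comm c c' y

/-- The generator of a free action has no zeros: in a slice chart the circle coordinate moves with
unit speed along the orbits. -/
theorem generator_ne_zero [IsManifold (𝓡 m) ∞ M] [T2Space M]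
    [ContMDiffSMul (𝓡 1) (𝓡 m) ∞ Circle M]
    (hfree : ∀ (c : Circle) (x : M), c • x = x → c = 1) (x : M) : generator m x ≠ 0 := by
  intro h0
  obtain ⟨χ⟩ := nonempty_circleSlice (m := m) hfree x
  have h1 : ContMDiffAt (𝓡 m) 𝓘(ℝ, ℂ) ∞ (fun y => (χ.toFun y : ℂ)) x :=
    contMDiff_circle_coe.contMDiffAt.comp x
      (χ.contMDiffOn.contMDiffAt (χ.isOpen_carrier.mem_nhds χ.mem_carrier))
  have h1' : MDifferentiableAt (𝓡 m) 𝓘(ℝ, ℂ) (fun y => (χ.toFun y : ℂ))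
      (Circle.exp 0 • x) := by
    rw [exp_zero_smul]
    exact h1.mdifferentiableAt (by simp)
  have h2 : mfderiv 𝓘(ℝ, ℝ) 𝓘(ℝ, ℂ) (fun t : ℝ => (χ.toFun (Circle.exp t • x) : ℂ)) 0 =
      (mfderiv (𝓡 m) 𝓘(ℝ, ℂ) (fun y => (χ.toFun y : ℂ)) (Circle.exp 0 • x)).comp
        (mfderiv 𝓘(ℝ, ℝ) (𝓡 m) (fun t : ℝ => Circle.exp t • x) 0) :=
    mfderiv_comp (0 : ℝ) h1' (mdifferentiableAt_orbit x 0)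
  have h3 : (fun t : ℝ => (χ.toFun (Circle.exp t • x) : ℂ)) =
      fun t : ℝ => Complex.exp (t * Complex.I) := by
    funext t
    rw [χ.map_smul _ _ χ.mem_carrier, χ.map_base, mul_one, Circle.coe_exp]
  have h4 : mfderiv 𝓘(ℝ, ℝ) (𝓡 m) (fun t : ℝ => Circle.exp t • x) 0 (1 : ℝ) = 0 := h0
  have h5 : HasDerivAt (fun t : ℝ => Complex.exp (t * Complex.I)) Complex.I 0 := by
    have := ((hasDerivAt_id (0 : ℝ)).ofReal_comp.mul_const Complex.I).cexp
    simpa using this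
  have h6 : fderiv ℝ (fun t : ℝ => Complex.exp (t * Complex.I)) 0 1 = 0 := by
    rw [h3, mfderiv_eq_fderiv] at h2
    have := congrArg (fun L : ℝ →L[ℝ] ℂ => L 1) h2
    refine this.trans ?_
    change (mfderiv (𝓡 m) 𝓘(ℝ, ℂ) (fun y => (χ.toFun y : ℂ)) (Circle.exp 0 • x))
      (mfderiv 𝓘(ℝ, ℝ) (𝓡 m) (fun t : ℝ => Circle.exp t • x) 0 (1 : ℝ)) = 0
    exact (congrArg _ h4).trans (ContinuousLinearMap.map_zero _)
  rw [h5.hasFDerivAt.fderiv] at h6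
  simp at h6

/-- The generator of a smooth circle action is a smooth vector field. -/
theorem contMDiff_generator [IsManifold (𝓡 m) ∞ M] [ContMDiffSMul (𝓡 1) (𝓡 m) ∞ Circle M] :
    ContMDiff (𝓡 m) (𝓡 m).tangent ∞
      (fun x : M => (⟨x, generator m x⟩ : TangentBundle (𝓡 m) M)) := by
  have : IsManifold (𝓡 m) (∞ + 1) M := by
    have h : (∞ : WithTop ℕ∞) + 1 = ∞ := by rfl
    rwa [h]
  have : IsManifold (𝓡 m) 1 M := IsManifold.of_le (n := ∞) (by simp)
  have h1 : ContMDiff (𝓡 m) (𝓘(ℝ, ℝ).tangent.prod (𝓡 m).tangent) ∞ (fun x : M =>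
      ((⟨0, (1 : ℝ)⟩ : TangentBundle 𝓘(ℝ, ℝ) ℝ), (⟨x, 0⟩ : TangentBundle (𝓡 m) M))) :=
    contMDiff_const.prodMk (Bundle.contMDiff_zeroSection ℝ (TangentSpace (𝓡 m)))
  have h2 := contMDiff_equivTangentBundleProd_symm (n := ∞) (I := 𝓘(ℝ, ℝ)) (M := ℝ) (I' := 𝓡 m)
    (M' := M)
  have h3 := (contMDiff_exp_smul (m := m) (M := M)).contMDiff_tangentMap (m := ∞) le_rfl
  have h4 := h3.comp (h2.comp h1)
  refine h4.congr fun x => ?_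
  have e0 := exp_zero_smul x
  have hd : MDifferentiableAt (𝓘(ℝ, ℝ).prod (𝓡 m)) (𝓡 m)
      (fun y : ℝ × M => Circle.exp y.1 • y.2) (0, x) :=
    (contMDiff_exp_smul (m := m) (M := M) _).mdifferentiableAt (by simp)
  have e1 := mfderiv_prod_eq_add_apply (v := ((1 : ℝ), (0 : Euc m))) hd
  have e2 : mfderiv (𝓘(ℝ, ℝ).prod (𝓡 m)) (𝓡 m) (fun y : ℝ × M => Circle.exp y.1 • y.2) (0, x)
      ((1 : ℝ), (0 : Euc m)) = generator m x := by
    refine e1.trans ?_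
    refine (congrArg₂ (· + ·) rfl (map_zero _)).trans (add_zero _)
  have e3 : ∀ (x' : M) (v : Euc m), x' = x → v = generator m x →
      (⟨x, generator m x⟩ : TangentBundle (𝓡 m) M) = ⟨x', v⟩ := by
    rintro _ _ rfl rfl; rfl
  exact e3 _ _ e0 e2

end Generator

end SpinCPreq
end

/-! ### Forms on quotients by circle actions -/

noncomputable section

namespace SpinCPreq

section CircleQuotient

variable {m d : ℕ} {M N : Type*} [TopologicalSpace M] [ChartedSpace (Euc m) M]
  [TopologicalSpace N] [ChartedSpace (Euc d) N]

/-- `π` is the quotient map of a free circle action on `M`, the quotient being a manifold for which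
`π` is a submersion (expressed by smooth local sections through all points). -/
structure IsCircleQuotient (m d : ℕ) {M N : Type*} [TopologicalSpace M] [ChartedSpace (Euc m) M]
    [TopologicalSpace N] [ChartedSpace (Euc d) N] [MulAction Circle M] (π : M → N) : Prop where
  dim : m = d + 1
  free : ∀ (c : Circle) (x : M), c • x = x → c = 1
  orbit : ∀ x y, π x = π y ↔ ∃ c : Circle, c • x = y
  surjective : Function.Surjective π
  sections : HasSmoothSections (m := m) (d := d) π

variable {π : M → N}

/-- A local section is a right inverse of the projection to first order. -/
theorem mfderiv_mfderiv_section (hπ : ContMDiff (𝓡 m) (𝓡 d) ∞ π) {i : N → M} {U : Set N}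
    (hU : IsOpen U) (hi : ContMDiffOn (𝓡 d) (𝓡 m) ∞ i U) (hπi : ∀ y ∈ U, π (i y) = y) {y : N}
    (hy : y ∈ U) (u : Euc d) :
    mfderiv (𝓡 m) (𝓡 d) π (i y) (mfderiv (𝓡 d) (𝓡 m) i y u) = u := by
  have hne : (∞ : WithTop ℕ∞) ≠ 0 := by simp
  have h1 : MDifferentiableAt (𝓡 d) (𝓡 m) i y :=
    (hi.contMDiffAt (hU.mem_nhds hy)).mdifferentiableAt hne
  have h2 : mfderiv (𝓡 d) (𝓡 d) (π ∘ i) y = ContinuousLinearMap.id ℝ _ := by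
    rw [← mfderiv_id]
    refine Filter.EventuallyEq.mfderiv_eq ?_
    filter_upwards [hU.mem_nhds hy] with z hz
    exact hπi z hz
  rw [mfderiv_comp _ ((hπ _).mdifferentiableAt hne) h1] at h2
  exact congrArg (fun L : Euc d →L[ℝ] Euc d => L u) h2

variable [MulAction Circle M]

namespace IsCircleQuotient

theorem map_smul (hq : IsCircleQuotient m d π) (c : Circle) (x : M) : π (c • x) = π x :=
  ((hq.orbit x _).2 ⟨c, rfl⟩).symm

theorem mdifferentiableAt (hq : IsCircleQuotient m d π) (x : M) :
    MDifferentiableAt (𝓡 m) (𝓡 d) π x :=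
  (hq.sections.contMDiff x).mdifferentiableAt (by simp)

variable [ContMDiffSMul (𝓡 1) (𝓡 m) ∞ Circle M]

theorem mfderiv_apply_generator (hq : IsCircleQuotient m d π) (x : M) :
    mfderiv (𝓡 m) (𝓡 d) π x (generator m x) = 0 := by
  have h1 : (fun t : ℝ => π (Circle.exp t • x)) = fun _ => π x := funext fun t => hq.map_smul _ _
  refine (mfderiv_generator_eq (hq.mdifferentiableAt x)).trans ?_
  rw [h1, mfderiv_const]
  rfl

theorem mfderiv_mfderiv_smul (hq : IsCircleQuotient m d π) (c : Circle) (x : M) (v : Euc m) :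
    mfderiv (𝓡 m) (𝓡 d) π (c • x) (mfderiv (𝓡 m) (𝓡 m) (fun y : M => c • y) x v) =
      mfderiv (𝓡 m) (𝓡 d) π x v := by
  have h1 : (fun y : M => π (c • y)) = π := funext fun y => hq.map_smul _ _
  have h2 : mfderiv (𝓡 m) (𝓡 d) (fun y : M => π (c • y)) x =
      (mfderiv (𝓡 m) (𝓡 d) π (c • x)).comp (mfderiv (𝓡 m) (𝓡 m) (fun y : M => c • y) x) :=
    mfderiv_comp x (hq.mdifferentiableAt _)
      ((contMDiff_circle_smul c x).mdifferentiableAt (by simp))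
  have h3 : ∀ f : M → N, f = π → ∀ v : Euc m,
      mfderiv (𝓡 m) (𝓡 d) f x v = mfderiv (𝓡 m) (𝓡 d) π x v := by rintro _ rfl v; rfl
  rw [← h3 _ h1 v, h2]
  rfl

theorem tangentMap_tangentMap_smul (hq : IsCircleQuotient m d π) (c : Circle)
    (w : TangentBundle (𝓡 m) M) :
    tangentMap (𝓡 m) (𝓡 d) π (tangentMap (𝓡 m) (𝓡 m) (fun y : M => c • y) w) =
      tangentMap (𝓡 m) (𝓡 d) π w := by
  obtain ⟨x, v⟩ := w
  have h : ∀ (y : N) (u u' : Euc d), y = π x → u = u' →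
      (⟨y, u⟩ : TangentBundle (𝓡 d) N) = ⟨π x, u'⟩ := by
    rintro _ _ _ rfl rfl
    rfl
  exact h _ _ _ (hq.map_smul c x) (hq.mfderiv_mfderiv_smul c x v)

variable [IsManifold (𝓡 m) ∞ M] [T2Space M]

theorem exists_eq_smul_generator (hq : IsCircleQuotient m d π) {x : M} {v : Euc m}
    (hv : mfderiv (𝓡 m) (𝓡 d) π x v = 0) : ∃ a : ℝ, v = a • (generator m x : Euc m) := by
  let L : Euc m →ₗ[ℝ] Euc d := (mfderiv (𝓡 m) (𝓡 d) π x).toLinearMap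
  have hL : Function.Surjective L := hq.sections.surjective_mfderiv x
  have h1 := LinearMap.finrank_range_add_finrank_ker L
  rw [LinearMap.range_eq_top.2 hL, finrank_top, finrank_euclideanSpace_fin,
    finrank_euclideanSpace_fin] at h1
  have hdim := hq.dim
  have h2 : Module.finrank ℝ (LinearMap.ker L) = 1 := by omega
  have h3 : (⟨generator m x, hq.mfderiv_apply_generator x⟩ : LinearMap.ker L) ≠ 0 := by
    intro h
    exact generator_ne_zero hq.free x (congrArg Subtype.val h)
  obtain ⟨a, ha⟩ := (finrank_eq_one_iff_of_nonzero' _ h3).1 h2 ⟨v, hv⟩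
  exact ⟨a, (congrArg Subtype.val ha).symm⟩

variable {r : ℕ} {F : Type*} [NormedAddCommGroup F] [NormedSpace ℝ F]

theorem _root_.ContinuousAlternatingMap.congr_of_sub_mem_ker {V : Type*} [NormedAddCommGroup V]
    [NormedSpace ℝ V] (f : V [⋀^Fin r]→L[ℝ] F) (X : V)
    (hX : ∀ v : Fin r → V, ∀ i, v i = X → f v = 0)
    {v w : Fin r → V} (h : ∀ i, ∃ a : ℝ, v i = w i + a • X) : f v = f w := by
  have h1 : ∀ s : Finset (Fin r), f (s.piecewise v w) = f w := by
    intro s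
    induction s using Finset.induction_on with
    | empty => rw [Finset.piecewise_empty]
    | insert j s hj ih =>
      obtain ⟨a, ha⟩ := h j
      rw [Finset.piecewise_insert, ha, ContinuousAlternatingMap.map_update_add,
        ContinuousAlternatingMap.map_update_smul,
        hX (Function.update _ j X) j (Function.update_self _ _ _), smul_zero, add_zero]
      have h2 : Function.update (s.piecewise v w) j (w j) = s.piecewise v w := by
        rw [Function.update_eq_iff]
        exact ⟨(Finset.piecewise_eq_of_notMem _ _ _ hj).symm, fun _ _ => rfl⟩
      rw [h2, ih]
  have h2 := h1 Finset.univ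
  rwa [Finset.piecewise_univ] at h2

/-- An invariant horizontal form takes the same values on all tuples of tangent vectors with the
same projection. -/
theorem form_eq_of_mfderiv_eq (hq : IsCircleQuotient m d π) {α : DForm m M r F}
    (hinv : ∀ c : Circle, DForm.pullback (fun x : M => c • x) α = α)
    (hhor : ∀ (x : M) (v : Fin r → Euc m) (i : Fin r), v i = generator m x → α x v = 0)
    {x x' : M} (hxx : π x = π x') {v w : Fin r → Euc m}
    (hvw : ∀ i, mfderiv (𝓡 m) (𝓡 d) π x' (w i) = mfderiv (𝓡 m) (𝓡 d) π x (v i)) :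
    α x' w = α x v := by
  obtain ⟨c, rfl⟩ := (hq.orbit _ _).1 hxx
  have h1 := congrArg (fun L => L v) (congrFun (hinv c) x)
  change α (c • x) (fun i => mfderiv (𝓡 m) (𝓡 m) (fun y : M => c • y) x (v i)) = α x v at h1
  rw [← h1]
  refine ContinuousAlternatingMap.congr_of_sub_mem_ker (V := Euc m) (α (c • x))
    (generator m (c • x)) (hhor _) fun i => ?_
  obtain ⟨a, ha⟩ := hq.exists_eq_smul_generator (x := c • x)
    (v := @HSub.hSub (Euc m) (Euc m) (Euc m) _ (w i)
      (mfderiv (𝓡 m) (𝓡 m) (fun y : M => c • y) x (v i))) (by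
      refine (ContinuousLinearMap.map_sub (M := Euc m) (M₂ := Euc d)
        (mfderiv (𝓡 m) (𝓡 d) π (c • x)) _ _).trans ?_
      refine (congrArg₂ (fun a b : Euc d => a - b) (hvw i)
        (hq.mfderiv_mfderiv_smul c x (v i))).trans ?_
      exact sub_self _)
  exact ⟨a, (sub_eq_iff_eq_add'.1 ha)⟩

/-- Invariant horizontal forms descend to the quotient. -/
theorem exists_pullback_eq [IsManifold (𝓡 d) ∞ N] (hq : IsCircleQuotient m d π)
    {α : DForm m M r F} (hα : α.IsSmooth)
    (hinv : ∀ c : Circle, DForm.pullback (fun x : M => c • x) α = α)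
    (hhor : ∀ (x : M) (v : Fin r → Euc m) (i : Fin r), v i = generator m x → α x v = 0) :
    ∃ β : DForm d N r F, β.IsSmooth ∧ α = DForm.pullback π β := by
  have hsec : ∀ y : N, ∃ U : Set N, IsOpen U ∧ y ∈ U ∧ ∃ i : N → M,
      ContMDiffOn (𝓡 d) (𝓡 m) ∞ i U ∧ ∀ z ∈ U, π (i z) = z := by
    intro y
    obtain ⟨x, rfl⟩ := hq.surjective y
    obtain ⟨U, hU, hx, i, hi, -, hπi⟩ := hq.sections.exists_section x
    exact ⟨U, hU, hx, i, hi, hπi⟩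
  choose U hU hyU i hi hπi using hsec
  have hdi : ∀ (y₀ : N) (y : N) (hy : y ∈ U y₀) (u : Euc d),
      mfderiv (𝓡 m) (𝓡 d) π (i y₀ y) (mfderiv (𝓡 d) (𝓡 m) (i y₀) y u) = u := fun y₀ y hy u =>
    mfderiv_mfderiv_section hq.sections.contMDiff (hU y₀) (hi y₀) (hπi y₀) hy u
  let β : DForm d N r F := fun y => DForm.pullback (d := d) (i y) α y
  refine ⟨β, DForm.IsSmooth.of_local_pullback hα fun y₀ =>
    ⟨U y₀, hU y₀, hyU y₀, i y₀, hi y₀, fun y hy => ?_⟩, ?_⟩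
  · ext v
    refine hq.form_eq_of_mfderiv_eq hinv hhor ?_ fun j => ?_
    · rw [hπi y₀ y hy, hπi y y (hyU y)]
    · exact (hdi y y (hyU y) (v j)).trans (hdi y₀ y hy (v j)).symm
  · funext x
    ext v
    refine hq.form_eq_of_mfderiv_eq hinv hhor ?_ fun j => ?_
    · exact hπi (π x) (π x) (hyU (π x))
    · exact (hdi (π x) (π x) (hyU (π x)) _).symm

end IsCircleQuotient

end CircleQuotient

end SpinCPreq
end

/-! ### Frames and the unit generator -/

noncomputable section

namespace SpinCPreq

section Metric

variable {d : ℕ} {M : Type*} [TopologicalSpace M] [ChartedSpace (Euc d) M]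
  [IsManifold (𝓡 d) ∞ M] (g : RiemMetric d M)
  {E H X : Type*} [NormedAddCommGroup E] [NormedSpace ℝ E] [TopologicalSpace H]
  {J : ModelWithCorners ℝ E H} [TopologicalSpace X] [ChartedSpace H X]

theorem contMDiffAt_inner {f : X → M} {a b : ∀ x, TangentSpace (𝓡 d) (f x)} {x₀ : X}
    (ha : ContMDiffAt J (𝓡 d).tangent ∞ (fun x => (⟨f x, a x⟩ : TangentBundle (𝓡 d) M)) x₀)
    (hb : ContMDiffAt J (𝓡 d).tangent ∞ (fun x => (⟨f x, b x⟩ : TangentBundle (𝓡 d) M)) x₀) :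
    ContMDiffAt J 𝓘(ℝ, ℝ) ∞ (fun x => g.inner (f x) (a x) (b x)) x₀ := by
  have hf : ContMDiffAt J (𝓡 d) ∞ f x₀ := by
    have ha' := ha
    rw [Bundle.contMDiffAt_totalSpace] at ha'
    exact ha'.1
  have h : ContMDiffAt J ((𝓡 d).prod 𝓘(ℝ, ℝ)) ∞
      (fun x => Bundle.TotalSpace.mk' ℝ (E := Bundle.Trivial M ℝ) (f x)
        (g.inner (f x) (a x) (b x))) x₀ := by
    apply ContMDiffAt.clm_bundle_apply₂ (F₁ := Euc d) (F₂ := Euc d)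
    · exact ContMDiffAt.comp x₀ g.contMDiff.contMDiffAt hf
    · exact ha
    · exact hb
  rw [Bundle.contMDiffAt_totalSpace] at h
  exact h.2

end Metric

section UnitGenerator

variable {k : ℕ} {Z : Type*} [TopologicalSpace Z] [ChartedSpace (Euc (k + 1)) Z]
  [IsManifold (𝓡 (k + 1)) ∞ Z] [MulAction Circle Z] (g : RiemMetric (k + 1) Z)

theorem inner_unitGenerator (x : Z) (hx : generator (k + 1) x ≠ 0) :
    g.inner x (unitGenerator g x) (unitGenerator g x) = 1 := by
  have h := g.pos x _ hx
  have h1 := Real.sqrt_pos.2 h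
  have h2 := Real.mul_self_sqrt h.le
  rw [unitGenerator]
  simp only [map_smul, smul_apply, smul_eq_mul]
  rw [← mul_assoc, ← mul_inv, h2, inv_mul_cancel₀ h.ne']

theorem mem_normalSpace_iff (x : Z) (hx : generator (k + 1) x ≠ 0)
    (v : TangentSpace (𝓡 (k + 1)) x) :
    v ∈ normalSpace g x ↔ g.inner x (unitGenerator g x) v = 0 := by
  have h1 := Real.sqrt_pos.2 (g.pos x _ hx)
  change g.inner x (generator (k + 1) x) v = 0 ↔ _
  rw [unitGenerator]
  simp only [map_smul, smul_apply, smul_eq_mul]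
  rw [mul_eq_zero, or_iff_right (inv_ne_zero h1.ne')]

theorem contMDiff_unitGenerator [ContMDiffSMul (𝓡 1) (𝓡 (k + 1)) ∞ Circle Z]
    (hgen : ∀ x : Z, generator (k + 1) x ≠ 0) :
    ContMDiff (𝓡 (k + 1)) (𝓡 (k + 1)).tangent ∞
      (fun x : Z => (⟨x, unitGenerator g x⟩ : TangentBundle (𝓡 (k + 1)) Z)) := by
  have h1 := contMDiff_generator (m := k + 1) (M := Z)
  intro x
  have h2 : ContMDiffAt (𝓡 (k + 1)) 𝓘(ℝ, ℝ) ∞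
      (fun x : Z => g.inner x (generator (k + 1) x) (generator (k + 1) x)) x :=
    contMDiffAt_inner g (h1 x) (h1 x)
  have h3 : ContDiffAt ℝ ∞ (fun t : ℝ => (√t)⁻¹)
      (g.inner x (generator (k + 1) x) (generator (k + 1) x)) :=
    (Real.contDiffAt_sqrt (g.pos x _ (hgen x)).ne').inv
      (Real.sqrt_pos.2 (g.pos x _ (hgen x))).ne'
  exact (h3.contMDiffAt.comp x h2).smul_section (h1 x)

/-- Isometries that preserve the generator preserve the unit generator. -/
theorem mfderiv_unitGenerator {f : Z → Z} {x : Z}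
    (hf : mfderiv (𝓡 (k + 1)) (𝓡 (k + 1)) f x (generator (k + 1) x) = generator (k + 1) (f x))
    (hiso : g.inner (f x) (mfderiv (𝓡 (k + 1)) (𝓡 (k + 1)) f x (generator (k + 1) x))
      (mfderiv (𝓡 (k + 1)) (𝓡 (k + 1)) f x (generator (k + 1) x)) =
        g.inner x (generator (k + 1) x) (generator (k + 1) x)) :
    mfderiv (𝓡 (k + 1)) (𝓡 (k + 1)) f x (unitGenerator g x) = unitGenerator g (f x) := by
  rw [hf] at hiso
  rw [unitGenerator, unitGenerator, map_smul, hf, hiso]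

theorem eta_incl (x : Z) (f : Euc k →ₗ[ℝ] TangentSpace (𝓡 (k + 1)) x) (v : Euc k) :
    eta g x f (incl k v) = f v := by
  have h : (EuclideanSpace.proj (𝕜 := ℝ) (Fin.last k) : Euc (k + 1) →L[ℝ] ℝ) (incl k v) = 0 :=
    incl_apply_last v
  change f (init k (incl k v)) + (EuclideanSpace.proj (𝕜 := ℝ) (Fin.last k) :
    Euc (k + 1) →L[ℝ] ℝ) (incl k v) • unitGenerator g x = f v
  rw [h, zero_smul, add_zero, init_incl]

theorem eta_lastVec (x : Z) (f : Euc k →ₗ[ℝ] TangentSpace (𝓡 (k + 1)) x) :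
    eta g x f (lastVec k) = unitGenerator g x := by
  have h : (EuclideanSpace.proj (𝕜 := ℝ) (Fin.last k) : Euc (k + 1) →L[ℝ] ℝ) (lastVec k) = 1 :=
    lastVec_last
  change f (init k (lastVec k)) + (EuclideanSpace.proj (𝕜 := ℝ) (Fin.last k) :
    Euc (k + 1) →L[ℝ] ℝ) (lastVec k) • unitGenerator g x = _
  rw [h, one_smul, init_lastVec, map_zero, zero_add]

theorem linearMap_eq_of_incl_of_lastVec {V : Type*} [AddCommGroup V] [Module ℝ V]
    {f h : Euc (k + 1) →ₗ[ℝ] V} (h1 : ∀ v, f (incl k v) = h (incl k v))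
    (h2 : f (lastVec k) = h (lastVec k)) : f = h := by
  ext1 v
  rw [eq_incl_add_smul_lastVec v, map_add, map_add, map_smul, map_smul, h1, h2]

end UnitGenerator

section FrameCoord

variable {k : ℕ} {Z : Type*} [TopologicalSpace Z] [ChartedSpace (Euc (k + 1)) Z]
  [IsManifold (𝓡 (k + 1)) ∞ Z] {g : RiemMetric (k + 1) Z}
  {o : ManifoldOrientation (k + 1) Z}
  {P : Type*} [TopologicalSpace P] [ChartedSpace (Euc (spinCDim (k + 1) (k + 1))) P]
  [IsManifold (𝓡 (spinCDim (k + 1) (k + 1))) ∞ P]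
  (S : SpinCStructure (k + 1) (SOF g o) P)

theorem SpinCStructure.inner_frame (p : P) (u v : Euc (k + 1)) :
    g.inner (S.proj p) (S.frame p u) (S.frame p v) = ⟪u, v⟫ := (S.frame_mem p).1 u v

theorem SpinCStructure.frame_injective (p : P) : Function.Injective (S.frame p) := by
  rw [← LinearMap.ker_eq_bot, LinearMap.ker_eq_bot']
  intro v hv
  have h := S.inner_frame p v v
  rw [hv, map_zero] at h
  exact inner_self_eq_zero.1 h.symm

theorem SpinCStructure.frame_surjective (p : P) : Function.Surjective (S.frame p) :=
  LinearMap.surjective_of_injective (V := Euc (k + 1))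
    (f := (S.frame p : Euc (k + 1) →ₗ[ℝ] Euc (k + 1))) (S.frame_injective p)

variable [MulAction Circle Z]

/-- The coordinates of the unit generator in the frame of a point of `P`. -/
def frameCoord (p : P) : Euc (k + 1) :=
  WithLp.toLp 2 fun i => g.inner (S.proj p) (S.frame p (EuclideanSpace.single i 1))
    (unitGenerator g (S.proj p))

theorem frame_frameCoord (p : P) : S.frame p (frameCoord S p) = unitGenerator g (S.proj p) := by
  obtain ⟨v, hv⟩ := S.frame_surjective p (unitGenerator g (S.proj p))
  have h : frameCoord S p = v := by
    ext i
    change g.inner (S.proj p) (S.frame p (EuclideanSpace.single i 1)) _ = v i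
    rw [← hv, S.inner_frame, EuclideanSpace.inner_single_left]
    simp
  rw [h, hv]

theorem frameCoord_eq_iff (p : P) (v : Euc (k + 1)) :
    frameCoord S p = v ↔ S.frame p v = unitGenerator g (S.proj p) := by
  rw [← frame_frameCoord S p, (S.frame_injective p).eq_iff, eq_comm]

theorem frameCoord_eq_iff_mk_eq (p : P) (v : Euc (k + 1)) :
    frameCoord S p = v ↔ (⟨S.proj p, S.frame p v⟩ : TangentBundle (𝓡 (k + 1)) Z) =
      ⟨S.proj p, unitGenerator g (S.proj p)⟩ := by
  rw [frameCoord_eq_iff]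
  constructor
  · intro h
    rw [h]
  · intro h
    exact eq_of_heq (Bundle.TotalSpace.mk.inj h).2

theorem inner_frameCoord (p : P) (hx : generator (k + 1) (S.proj p) ≠ 0) :
    ⟪frameCoord S p, frameCoord S p⟫ = 1 := by
  rw [← S.inner_frame p, frame_frameCoord, inner_unitGenerator g _ hx]

theorem frameCoord_act (p : P) (x : Spin (k + 1)) (z : Circle) :
    frameCoord S (S.act p (SpinC.mk x z)) = rot x⁻¹ (frameCoord S p) := by
  rw [frameCoord_eq_iff_mk_eq, S.frame_act, rot_rot_inv, frame_frameCoord, S.proj_act]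

/-- The points of `η^*(P)` are the points of `P` whose frame ends with the unit generator. -/
theorem mem_etaPullback_iff (hgen : ∀ x : Z, generator (k + 1) x ≠ 0) (p : P) :
    (∃ f ∈ SOFV g o (S.proj p), S.frame p = eta g (S.proj p) f) ↔
      frameCoord S p = lastVec k := by
  rw [frameCoord_eq_iff]
  constructor
  · rintro ⟨f, -, hf⟩
    rw [hf, eta_lastVec]
  · intro h
    have h1 : S.frame p = eta g (S.proj p) (S.frame p ∘ₗ incl k) :=
      linearMap_eq_of_incl_of_lastVec
        (fun v => (eta_incl g _ (S.frame p ∘ₗ incl k) v).symm)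
        (h.trans (eta_lastVec g _ _).symm)
    refine ⟨S.frame p ∘ₗ incl k, ⟨fun u => ?_, fun u v => ?_, ?_⟩, h1⟩
    · rw [mem_normalSpace_iff g _ (hgen _), ← h, LinearMap.comp_apply, S.inner_frame,
        inner_lastVec_incl]
    · rw [LinearMap.comp_apply, LinearMap.comp_apply, S.inner_frame, inner_incl]
    · rw [← h1]
      exact S.frame_mem p

theorem contMDiff_frameCoord [ContMDiffSMul (𝓡 1) (𝓡 (k + 1)) ∞ Circle Z]
    (hgen : ∀ x : Z, generator (k + 1) x ≠ 0) :
    ContMDiff (𝓡 (spinCDim (k + 1) (k + 1))) 𝓘(ℝ, Euc (k + 1)) ∞ (frameCoord S) := by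
  have h1 : ContMDiff (𝓡 (spinCDim (k + 1) (k + 1))) 𝓘(ℝ, Fin (k + 1) → ℝ) ∞
      (fun p i => g.inner (S.proj p) (S.frame p (EuclideanSpace.single i 1))
        (unitGenerator g (S.proj p))) := by
    rw [contMDiff_pi_space]
    intro i p
    exact contMDiffAt_inner g (S.frame_smooth _ p)
      ((contMDiff_unitGenerator g hgen).comp S.proj_smooth p)
  exact (EuclideanSpace.equiv (Fin (k + 1)) ℝ).symm.contDiff.contMDiff.comp h1

/-- The lift of an isometry of `Z` that preserves the generator preserves the frame coordinates. -/
theorem frameCoord_map {F : P → P} {f : Z → Z} {p : P}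
    (hf : mfderiv (𝓡 (k + 1)) (𝓡 (k + 1)) f (S.proj p) (generator (k + 1) (S.proj p)) =
      generator (k + 1) (f (S.proj p)))
    (hiso : ∀ u v, g.inner (f (S.proj p)) (mfderiv (𝓡 (k + 1)) (𝓡 (k + 1)) f (S.proj p) u)
      (mfderiv (𝓡 (k + 1)) (𝓡 (k + 1)) f (S.proj p) v) = g.inner (S.proj p) u v)
    (hproj : S.proj (F p) = f (S.proj p))
    (hframe : ∀ v, (⟨S.proj (F p), S.frame (F p) v⟩ : TangentBundle (𝓡 (k + 1)) Z) =
      tangentMap (𝓡 (k + 1)) (𝓡 (k + 1)) f ⟨S.proj p, S.frame p v⟩) :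
    frameCoord S (F p) = frameCoord S p := by
  rw [frameCoord_eq_iff_mk_eq, hframe, tangentMap, frame_frameCoord, hproj]
  exact congrArg (Bundle.TotalSpace.mk (f (S.proj p))) (mfderiv_unitGenerator g hf (hiso _ _))

end FrameCoord

end SpinCPreq
end

/-! ### The reduced bundle as an embedded submanifold -/

noncomputable section

namespace SpinCPreq

open Topology

section EtaManifold

variable {k : ℕ} {Z : Type*} [TopologicalSpace Z] [ChartedSpace (Euc (k + 1)) Z]
  [IsManifold (𝓡 (k + 1)) ∞ Z] [MulAction Circle Z] {g : RiemMetric (k + 1) Z}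
  {o : ManifoldOrientation (k + 1) Z}
  {P : Type*} [TopologicalSpace P] [ChartedSpace (Euc (spinCDim (k + 1) (k + 1))) P]
  [IsManifold (𝓡 (spinCDim (k + 1) (k + 1))) ∞ P]
  (S : SpinCStructure (k + 1) (SOF g o) P)

/-- The points of `P` whose frame does not end with minus the unit generator. -/
def etaNhd : Set P := {p | -1 < frameCoord S p (Fin.last k)}

/-- The element of `Spinᶜ(k+1)` with stereographic coordinates `w`. -/
def stereoSpinC (w : Euc k) : SpinC (k + 1) := SpinC.mk (stereoSpin w) 1

/-- The retraction of a neighbourhood of `η^*(P)` in `P` onto `η^*(P)`, given by the rotation of the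
last frame vector to the unit generator along a great circle. -/
def etaRetract (p : P) : P := S.act p (stereoSpinC (stereoCoord (frameCoord S p)))

variable {S}

theorem etaRetract_mem (hgen : ∀ x : Z, generator (k + 1) x ≠ 0) {p : P} (hp : p ∈ etaNhd S) :
    ∃ f ∈ SOFV g o (S.proj (etaRetract S p)), S.frame (etaRetract S p) =
      eta g (S.proj (etaRetract S p)) f := by
  rw [mem_etaPullback_iff S hgen, etaRetract, stereoSpinC, frameCoord_act]
  have h := rot_stereoSpin_stereoCoord (inner_frameCoord S p (hgen _)) hp
  nth_rewrite 2 [← h]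
  rw [rot_inv_rot]

theorem frameCoord_coe (hgen : ∀ x : Z, generator (k + 1) x ≠ 0) (p : EtaPullback S) :
    frameCoord S (p : P) = lastVec k := (mem_etaPullback_iff S hgen _).1 p.2

theorem coe_mem_etaNhd (hgen : ∀ x : Z, generator (k + 1) x ≠ 0) (p : EtaPullback S) :
    (p : P) ∈ etaNhd S := by
  rw [etaNhd, Set.mem_ofPred_eq, frameCoord_coe hgen, lastVec_last]
  norm_num

theorem etaRetract_coe (hgen : ∀ x : Z, generator (k + 1) x ≠ 0) (p : EtaPullback S) :
    etaRetract S (p : P) = p := by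
  rw [etaRetract, frameCoord_coe hgen, stereoCoord_lastVec, stereoSpinC, stereoSpin_zero]
  exact S.act_one _

theorem smoothOn_stereoSpinC :
    SpinC.SmoothOn 𝓘(ℝ, Euc k) (stereoSpinC (k := k)) Set.univ := smoothOn_stereoSpin

variable [ContMDiffSMul (𝓡 1) (𝓡 (k + 1)) ∞ Circle Z]

theorem isOpen_etaNhd (hgen : ∀ x : Z, generator (k + 1) x ≠ 0) : IsOpen (etaNhd S) := by
  have h1 : Continuous fun u : Euc (k + 1) => u (Fin.last k) := by fun_prop
  exact isOpen_lt continuous_const (h1.comp (contMDiff_frameCoord S hgen).continuous)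

theorem contMDiffOn_stereoCoord_frameCoord (hgen : ∀ x : Z, generator (k + 1) x ≠ 0) :
    ContMDiffOn (𝓡 (spinCDim (k + 1) (k + 1))) 𝓘(ℝ, Euc k) ∞
      (fun p => stereoCoord (frameCoord S p)) (etaNhd S) :=
  contDiffOn_stereoCoord.contMDiffOn.comp (contMDiff_frameCoord S hgen).contMDiffOn fun _ hp => hp

theorem contMDiffOn_etaRetract (hgen : ∀ x : Z, generator (k + 1) x ≠ 0) :
    ContMDiffOn (𝓡 (spinCDim (k + 1) (k + 1))) (𝓡 (spinCDim (k + 1) (k + 1))) ∞ (etaRetract S)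
      (etaNhd S) :=
  S.contMDiffOn_act (isOpen_etaNhd hgen) contMDiffOn_id
    (SpinC.SmoothOn.comp smoothOn_stereoSpinC (contMDiffOn_stereoCoord_frameCoord hgen)
      fun _ _ => trivial)

open Classical in
/-- `η^*(P)` as a retract of a neighbourhood; off that neighbourhood the retraction is a constant
without significance. -/
def etaLocalRetract (hgen : ∀ x : Z, generator (k + 1) x ≠ 0) (p₀ : EtaPullback S) :
    LocalRetract P (EtaPullback S) where
  incl := Subtype.val
  retr p := if hp : p ∈ etaNhd S then ⟨etaRetract S p, etaRetract_mem hgen hp⟩ else p₀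
  dom := Set.univ
  nhd := etaNhd S
  isOpen_dom := isOpen_univ
  isOpen_nhd := isOpen_etaNhd hgen
  continuousOn_incl := continuous_subtype_val.continuousOn
  continuousOn_retr := by
    refine IsInducing.subtypeVal.continuousOn_iff.2 ?_
    refine (contMDiffOn_etaRetract hgen).continuousOn.congr fun p hp => ?_
    simp only [Function.comp_apply, dif_pos hp]
  mapsTo_incl := fun p _ => coe_mem_etaNhd hgen p
  mapsTo_retr := fun _ _ => trivial
  retr_incl := by
    intro p _
    rw [dif_pos (coe_mem_etaNhd hgen p)]
    exact Subtype.ext (etaRetract_coe hgen p)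

theorem etaLocalRetract_incl_retr (hgen : ∀ x : Z, generator (k + 1) x ≠ 0) (p₀ : EtaPullback S)
    {p : P} (hp : p ∈ etaNhd S) :
    (((etaLocalRetract hgen p₀).retr p : EtaPullback S) : P) = etaRetract S p := by
  have h : (etaLocalRetract hgen p₀).retr p = ⟨etaRetract S p, etaRetract_mem hgen hp⟩ :=
    dif_pos hp
  rw [h]

/-- The rank of the retraction onto `η^*(P)`: its fibres are parametrized by stereographic
coordinates. -/
theorem finrank_ker_etaRetract (hgen : ∀ x : Z, generator (k + 1) x ≠ 0) (p₀ : EtaPullback S)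
    {e : P → P} (he : ∀ p ∈ etaNhd S, e p = etaRetract S p) :
    Module.finrank ℝ (LinearMap.ker (mfderiv (𝓡 (spinCDim (k + 1) (k + 1)))
      (𝓡 (spinCDim (k + 1) (k + 1))) e p₀).toLinearMap) = Module.finrank ℝ (Euc k) := by
  have hmem := coe_mem_etaNhd hgen p₀
  have hopen := isOpen_etaNhd (S := S) hgen
  have hact : ∀ w, frameCoord S (S.act (p₀ : P) (stereoSpinC w)⁻¹) =
      rot (stereoSpin w) (lastVec k) := by
    intro w
    rw [stereoSpinC, SpinC.mk_inv, frameCoord_act, frameCoord_coe hgen, inv_inv]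
  have hnhd : ∀ w, S.act (p₀ : P) (stereoSpinC w)⁻¹ ∈ etaNhd S := by
    intro w
    rw [etaNhd, Set.mem_ofPred_eq, hact]
    exact neg_one_lt_rot_stereoSpin w
  -- the fibre through `p₀` consists of the points obtained by undoing rotations
  refine finrank_ker_mfderiv (F := fun p => stereoCoord (frameCoord S p))
    (Ψ := fun y : P × Euc k => S.act y.1 (stereoSpinC y.2)⁻¹) ?_ ?_ ?_ ?_ ?_ ?_ ?_
  · rw [he _ hmem, etaRetract_coe hgen]
  · refine (((contMDiffOn_etaRetract hgen).congr he).contMDiffAt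
      (hopen.mem_nhds hmem)).mdifferentiableAt (by simp)
  · exact ((contMDiffOn_stereoCoord_frameCoord hgen).contMDiffAt
      (hopen.mem_nhds hmem)).mdifferentiableAt (by simp)
  · refine (S.act_smooth k (fun w => (stereoSpinC w)⁻¹) (fun l => ?_)).mdifferentiableAt (by simp)
    exact contMDiff_iff_contDiff.1 (contMDiffOn_univ.1 (smoothOn_stereoSpinC.inv l))
  · filter_upwards [hopen.mem_nhds hmem] with p hp
    rw [he p hp, etaRetract, S.act_inv_act]
  · refine Filter.Eventually.of_forall fun w => ?_
    rw [hact, stereoCoord_rot_stereoSpin]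
  · refine Filter.Eventually.of_forall fun w => ?_
    rw [he _ (hnhd w), etaRetract, hact, stereoCoord_rot_stereoSpin, S.act_act_inv]

/-- The manifold structure of `η^*(P)` is compatible with the one of `P`: the inclusion is smooth
and has a smooth left inverse on a neighbourhood of `η^*(P)`, over the identity of `Z`. -/
structure HasEtaRetraction (S : SpinCStructure (k + 1) (SOF g o) P)
    [ChartedSpace (Euc (spinCDim (k + 1) k)) (EtaPullback S)] : Prop where
  contMDiff_coe : ContMDiff (𝓡 (spinCDim (k + 1) k)) (𝓡 (spinCDim (k + 1) (k + 1))) ∞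
    (Subtype.val : EtaPullback S → P)
  exists_retract : Nonempty (EtaPullback S) → ∃ e : P → EtaPullback S,
    ContMDiffOn (𝓡 (spinCDim (k + 1) (k + 1))) (𝓡 (spinCDim (k + 1) k)) ∞ e (etaNhd S) ∧
    (∀ p ∈ etaNhd S, S.proj (e p) = S.proj p) ∧ ∀ p : EtaPullback S, e p = p

/-- `η^*(P)` is an embedded submanifold of `P`. -/
theorem exists_isManifold_etaPullback (hgen : ∀ x : Z, generator (k + 1) x ≠ 0) :
    ∃ (_ : ChartedSpace (Euc (spinCDim (k + 1) k)) (EtaPullback S))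
      (_ : IsManifold (𝓡 (spinCDim (k + 1) k)) ∞ (EtaPullback S)),
      Manifold.IsSmoothEmbedding (𝓡 (spinCDim (k + 1) k)) (𝓡 (spinCDim (k + 1) (k + 1))) ∞
        (Subtype.val : EtaPullback S → P) ∧ HasEtaRetraction S := by
  have hsm : ∀ a b : EtaPullback S, ContMDiffOn (𝓡 (spinCDim (k + 1) (k + 1)))
      (𝓡 (spinCDim (k + 1) (k + 1))) ∞
      ((etaLocalRetract hgen b).incl ∘ (etaLocalRetract hgen a).retr)
      ((etaLocalRetract hgen a).nhd ∩ (etaLocalRetract hgen a).retr ⁻¹'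
        (etaLocalRetract hgen b).dom) := fun a b =>
    ((contMDiffOn_etaRetract hgen).congr fun p hp => etaLocalRetract_incl_retr hgen a hp).mono
      Set.inter_subset_left
  have hdim : spinCDim (k + 1) (k + 1) = spinCDim (k + 1) k + Module.finrank ℝ (Euc k) := by
    rw [finrank_euclideanSpace_fin, spinCDim, spinCDim, Nat.choose_succ_succ' k 1,
      Nat.choose_one_right]
    ring
  obtain ⟨cs, ism, h⟩ := LocalRetract.exists_isManifold (W := Euc k)
    (d := spinCDim (k + 1) k) (fun p : EtaPullback S => etaLocalRetract hgen p) id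
    (fun _ => trivial) Function.surjective_id hsm
    (fun a => finrank_ker_etaRetract hgen a fun p hp => etaLocalRetract_incl_retr hgen a hp) hdim
  refine ⟨cs, ism, ⟨⟨Euc k, inferInstance, inferInstance, fun a => (h a).2.2.1⟩,
    IsEmbedding.subtypeVal⟩, fun a => (h a).1.contMDiffAt (Filter.univ_mem), ?_⟩
  rintro ⟨p₀⟩
  refine ⟨(etaLocalRetract hgen p₀).retr, (h p₀).2.1, fun p hp => ?_, fun p =>
    (etaLocalRetract hgen p₀).retr_incl p trivial⟩
  rw [etaLocalRetract_incl_retr hgen p₀ hp, etaRetract, S.proj_act]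

end EtaManifold

end SpinCPreq
end

/-! ### The spinᶜ structure on the normal bundle -/

noncomputable section

namespace SpinCPreq

section EtaSpinC

variable {k : ℕ} {Z : Type*} [TopologicalSpace Z] [ChartedSpace (Euc (k + 1)) Z]
  [IsManifold (𝓡 (k + 1)) ∞ Z] [MulAction Circle Z] {g : RiemMetric (k + 1) Z}
  {o : ManifoldOrientation (k + 1) Z}
  {P : Type*} [TopologicalSpace P] [ChartedSpace (Euc (spinCDim (k + 1) (k + 1))) P]
  [IsManifold (𝓡 (spinCDim (k + 1) (k + 1))) ∞ P]
  {S : SpinCStructure (k + 1) (SOF g o) P}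

theorem spinCIncl_act_mem (hgen : ∀ x : Z, generator (k + 1) x ≠ 0) (p : EtaPullback S)
    (s : SpinC k) : ∃ f ∈ SOFV g o (S.proj (S.act p (spinCIncl k s))),
      S.frame (S.act p (spinCIncl k s)) = eta g (S.proj (S.act p (spinCIncl k s))) f := by
  obtain ⟨x, z, rfl⟩ := s.exists_eq_mk
  rw [mem_etaPullback_iff S hgen, spinCIncl_mk, frameCoord_act, frameCoord_coe hgen, ← map_inv,
    rot_spinIncl_lastVec]

/-- The points of `η^*(P)` over a point of `Z` form an orbit of `Spinᶜ(k)`. -/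
theorem exists_spinCIncl_act_eq (hk : 1 ≤ k) (hgen : ∀ x : Z, generator (k + 1) x ≠ 0)
    {p p' : EtaPullback S} (h : S.proj p = S.proj p') :
    ∃ s : SpinC k, S.act p (spinCIncl k s) = p' := by
  obtain ⟨s, hs⟩ := (S.fibre _ _).1 h
  obtain ⟨x, z, rfl⟩ := s.exists_eq_mk
  have h1 := frameCoord_coe hgen p'
  rw [← hs, frameCoord_act, frameCoord_coe hgen] at h1
  obtain ⟨t, ht⟩ := exists_spinCIncl_eq hk z (x := x) (by
    nth_rewrite 1 [← h1]
    rw [rot_rot_inv])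
  exact ⟨t, by rw [ht, hs]⟩

variable [ChartedSpace (Euc (spinCDim (k + 1) k)) (EtaPullback S)]

/-- A map into `η^*(P)` is smooth if it is smooth as a map into `P`. -/
theorem HasEtaRetraction.contMDiffOn (he : HasEtaRetraction S)
    (hgen : ∀ x : Z, generator (k + 1) x ≠ 0) {E H Y : Type*} [NormedAddCommGroup E]
    [NormedSpace ℝ E] [TopologicalSpace H] {J : ModelWithCorners ℝ E H} [TopologicalSpace Y]
    [ChartedSpace H Y] {f : Y → EtaPullback S} {A : Set Y}
    (hf : ContMDiffOn J (𝓡 (spinCDim (k + 1) (k + 1))) ∞ (fun y => (f y : P)) A) :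
    ContMDiffOn J (𝓡 (spinCDim (k + 1) k)) ∞ f A := by
  rcases A.eq_empty_or_nonempty with rfl | ⟨y, -⟩
  · exact fun y hy => hy.elim
  · obtain ⟨e, he1, -, he2⟩ := he.exists_retract ⟨f y⟩
    exact (he1.comp hf fun y _ => coe_mem_etaNhd hgen (f y)).congr fun y _ => (he2 _).symm

theorem HasEtaRetraction.contMDiff (he : HasEtaRetraction S)
    (hgen : ∀ x : Z, generator (k + 1) x ≠ 0) {E H Y : Type*} [NormedAddCommGroup E]
    [NormedSpace ℝ E] [TopologicalSpace H] {J : ModelWithCorners ℝ E H} [TopologicalSpace Y]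
    [ChartedSpace H Y] {f : Y → EtaPullback S}
    (hf : ContMDiff J (𝓡 (spinCDim (k + 1) (k + 1))) ∞ (fun y => (f y : P))) :
    ContMDiff J (𝓡 (spinCDim (k + 1) k)) ∞ f :=
  contMDiffOn_univ.1 (he.contMDiffOn hgen hf.contMDiffOn)

/-- Local sections of `η^*(P) → Z`: rotate a section of `P` away from the frames that end with minus
the unit generator, and retract. -/
theorem HasEtaRetraction.exists_section (he : HasEtaRetraction S) (hk : 1 ≤ k)
    [ContMDiffSMul (𝓡 1) (𝓡 (k + 1)) ∞ Circle Z]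
    (hgen : ∀ x : Z, generator (k + 1) x ≠ 0) (x₀ : Z) :
    ∃ U : Set Z, IsOpen U ∧ x₀ ∈ U ∧ ∃ σ : Z → EtaPullback S,
      (∀ x ∈ U, S.proj (σ x) = x) ∧ ContMDiffOn (𝓡 (k + 1)) (𝓡 (spinCDim (k + 1) k)) ∞ σ U := by
  obtain ⟨U, hU, hxU, σ, -, hσ, hσs, -, -⟩ := S.locally_trivial x₀
  obtain ⟨y, hy⟩ := exists_rot_neg_one_lt hk (inner_frameCoord S (σ x₀) (hgen _))
  have hσ2 : ContMDiffOn (𝓡 (k + 1)) (𝓡 (spinCDim (k + 1) (k + 1))) ∞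
      (fun x => S.act (σ x) (SpinC.mk y⁻¹ 1)) U :=
    (S.contMDiff_act_right (SpinC.mk y⁻¹ 1)).comp_contMDiffOn hσs
  have h0 : S.act (σ x₀) (SpinC.mk y⁻¹ 1) ∈ etaNhd S := by
    rw [etaNhd, Set.mem_ofPred_eq, frameCoord_act, inv_inv]
    exact hy
  obtain ⟨e, he1, he3, he2⟩ := he.exists_retract ⟨⟨_, etaRetract_mem hgen h0⟩⟩
  refine ⟨U ∩ (fun x => S.act (σ x) (SpinC.mk y⁻¹ 1)) ⁻¹' etaNhd S,
    hσ2.continuousOn.isOpen_inter_preimage hU (isOpen_etaNhd hgen), ⟨hxU, h0⟩,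
    fun x => e (S.act (σ x) (SpinC.mk y⁻¹ 1)), fun x hx => ?_, ?_⟩
  · rw [he3 _ hx.2, S.proj_act, hσ x hx.1]
  · exact he1.comp (hσ2.mono Set.inter_subset_left) fun x hx => hx.2

variable [IsManifold (𝓡 (spinCDim (k + 1) k)) ∞ (EtaPullback S)]

open Classical in
/-- The spinᶜ structure `η^*(P) → SOF(V) → Z`. -/
def etaSpinC (he : HasEtaRetraction S) (hk : 1 ≤ k) [ContMDiffSMul (𝓡 1) (𝓡 (k + 1)) ∞ Circle Z]
    (hgen : ∀ x : Z, generator (k + 1) x ≠ 0) :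
    SpinCStructure k (SOFV g o) (EtaPullback S) where
  proj p := S.proj p
  act p s := ⟨S.act p (spinCIncl k s), spinCIncl_act_mem hgen p s⟩
  frame p := S.frame p ∘ₗ incl k
  proj_smooth := S.proj_smooth.comp he.contMDiff_coe
  act_one p := Subtype.ext ((congrArg (S.act (p : P)) (map_one (spinCIncl k))).trans (S.act_one _))
  act_mul p s t :=
    Subtype.ext ((congrArg (S.act (p : P)) (map_mul (spinCIncl k) s t)).trans (S.act_mul _ _ _))
  act_smooth m γ hγ := by
    refine he.contMDiff hgen ?_
    have h1 : ∀ l, ContDiff ℝ ∞ fun t => SpinC.coeff l (spinCIncl k (γ t)) := fun l => by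
      simp only [coeff_spinCIncl]
      exact hγ _
    exact (S.act_smooth m _ h1).comp
      ((he.contMDiff_coe.comp contMDiff_fst).prodMk contMDiff_snd)
  act_free p s t h := spinCIncl_injective (S.act_free p _ _ (congrArg Subtype.val h))
  fibre p p' := by
    constructor
    · intro h
      obtain ⟨s, hs⟩ := exists_spinCIncl_act_eq hk hgen h
      exact ⟨s, Subtype.ext hs⟩
    · rintro ⟨s, rfl⟩
      exact (S.proj_act _ _).symm
  locally_trivial x₀ := by
    obtain ⟨U, hU, hxU, σ, hσ, hσs⟩ := he.exists_section hk hgen x₀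
    have hex : ∀ p : EtaPullback S, S.proj p ∈ U →
        ∃ s : SpinC k, S.act (σ (S.proj p)) (spinCIncl k s) = p := fun p hp =>
      exists_spinCIncl_act_eq hk hgen (hσ _ hp)
    let τ : EtaPullback S → SpinC k := fun p =>
      if hp : S.proj p ∈ U then (hex p hp).choose else 1
    have hτ : ∀ p : EtaPullback S, S.proj p ∈ U →
        S.act (σ (S.proj p)) (spinCIncl k (τ p)) = p := by
      intro p hp
      have h : τ p = (hex p hp).choose := dif_pos hp
      rw [h]
      exact (hex p hp).choose_spec
    refine ⟨U, hU, hxU, σ, τ, hσ, hσs, fun p hp => Subtype.ext (hτ p hp), ?_⟩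
    refine SpinC.smoothOn_spinCIncl_iff.1 (S.smoothOn_of_act_eq
      (f := fun p : EtaPullback S => (σ (S.proj p) : P)) (h := Subtype.val) ?_
      he.contMDiff_coe.contMDiffOn fun p hp => hτ p hp)
    exact he.contMDiff_coe.comp_contMDiffOn
      (hσs.comp (S.proj_smooth.comp he.contMDiff_coe).contMDiffOn fun p hp => hp)
  frame_mem p := by
    obtain ⟨f, hf, hpf⟩ := p.2
    have h : S.frame (p : P) ∘ₗ incl k = f := by
      ext1 v
      rw [LinearMap.comp_apply, hpf, eta_incl]
    rw [h]
    exact hf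
  frame_smooth v := (S.frame_smooth (incl k v)).comp he.contMDiff_coe
  frame_act p x z v := by
    have h := S.frame_act p (spinIncl k x) z (incl k v)
    rw [rot_spinIncl] at h
    exact h

end EtaSpinC

section Equivariance

variable {k : ℕ} {Z : Type*} [TopologicalSpace Z] [ChartedSpace (Euc (k + 1)) Z]
  [IsManifold (𝓡 (k + 1)) ∞ Z] [MulAction Circle Z] {g : RiemMetric (k + 1) Z}
  {o : ManifoldOrientation (k + 1) Z}
  {P : Type*} [TopologicalSpace P] [ChartedSpace (Euc (spinCDim (k + 1) (k + 1))) P]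
  [IsManifold (𝓡 (spinCDim (k + 1) (k + 1))) ∞ P]
  {S : SpinCStructure (k + 1) (SOF g o) P}
  {E H : Type*} [NormedAddCommGroup E] [NormedSpace ℝ E] [TopologicalSpace H]
  {I : ModelWithCorners ℝ E H} {G : Type*} [TopologicalSpace G] [ChartedSpace H G] [Group G]
  [MulAction G Z] [MulAction G P]

/-- Lifts to `P` of isometries of `Z` that preserve the generator preserve `η^*(P)`. -/
theorem frameCoord_smul (hiso : ActsByOrientedIsometries G g o) (hS : S.IsEquivariant I G)
    (hgenG : ∀ (a : G) (x : Z), mfderiv (𝓡 (k + 1)) (𝓡 (k + 1)) (fun y : Z => a • y) x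
      (generator (k + 1) x) = generator (k + 1) (a • x)) (a : G) (p : P) :
    frameCoord S (a • p) = frameCoord S p :=
  frameCoord_map S (F := fun p => a • p) (f := fun y : Z => a • y) (hgenG a _)
    (fun u v => hiso.isometry a _ u v) (hS.proj_smul a p) (hS.frame_smul a p)

/-- The induced action on `η^*(P)`. -/
@[reducible] def etaMulAction (hgen : ∀ x : Z, generator (k + 1) x ≠ 0)
    (hpres : ∀ (a : G) (p : P), frameCoord S (a • p) = frameCoord S p) :
    MulAction G (EtaPullback S) where
  smul a p := ⟨a • (p : P), (mem_etaPullback_iff S hgen _).2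
    ((hpres a p).trans (frameCoord_coe hgen p))⟩
  one_smul p := Subtype.ext (one_smul G (p : P))
  mul_smul a b p := Subtype.ext (mul_smul a b (p : P))

variable [ChartedSpace (Euc (spinCDim (k + 1) k)) (EtaPullback S)]
  [IsManifold (𝓡 (spinCDim (k + 1) k)) ∞ (EtaPullback S)]

theorem etaSpinC_isEquivariant (he : HasEtaRetraction S) (hk : 1 ≤ k)
    [ContMDiffSMul (𝓡 1) (𝓡 (k + 1)) ∞ Circle Z] (hgen : ∀ x : Z, generator (k + 1) x ≠ 0)
    (hS : S.IsEquivariant I G) [MulAction G (EtaPullback S)]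
    (hcoe : ∀ (a : G) (p : EtaPullback S), ((a • p : EtaPullback S) : P) = a • (p : P)) :
    (etaSpinC he hk hgen).IsEquivariant I G where
  smooth_base := hS.smooth_base
  smooth_total := by
    have := hS.smooth_total
    refine ⟨he.contMDiff hgen ?_⟩
    simp only [hcoe]
    exact (contMDiff_smul (I := I) (I' := 𝓡 (spinCDim (k + 1) (k + 1))) (n := ∞) (G := G)
      (M := P)).comp (contMDiff_fst.prodMk (he.contMDiff_coe.comp contMDiff_snd))
  smul_act a p s := Subtype.ext (by
    rw [hcoe]
    change S.act ((a • p : EtaPullback S) : P) _ = _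
    rw [hcoe]
    exact hS.smul_act a p _)
  proj_smul a p := by
    change S.proj ((a • p : EtaPullback S) : P) = _
    rw [hcoe]
    exact hS.proj_smul a p
  frame_smul a p v := by
    change (⟨S.proj ((a • p : EtaPullback S) : P), S.frame ((a • p : EtaPullback S) : P) _⟩ :
      TangentBundle (𝓡 (k + 1)) Z) = _
    rw [hcoe]
    exact hS.frame_smul a p _

end Equivariance

end SpinCPreq
end

/-! ### The quotient metric -/

noncomputable section

namespace SpinCPreq

open Topology

section MetricOfForms

variable {d : ℕ} {N : Type*} [TopologicalSpace N] [ChartedSpace (Euc d) N]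

theorem contMDiffAt_clm_of_apply {E H F : Type*} [NormedAddCommGroup E] [NormedSpace ℝ E]
    [TopologicalSpace H] {J : ModelWithCorners ℝ E H} {X : Type*} [TopologicalSpace X]
    [ChartedSpace H X] [NormedAddCommGroup F] [NormedSpace ℝ F] {f : X → Euc d →L[ℝ] F} {x : X}
    (h : ∀ v, ContMDiffAt J 𝓘(ℝ, F) ∞ (fun y => f y v) x) :
    ContMDiffAt J 𝓘(ℝ, Euc d →L[ℝ] F) ∞ f x := by
  let e₁ : Euc d ≃L[ℝ] (Fin d → ℝ) := EuclideanSpace.equiv (Fin d) ℝ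
  let e₂ := (e₁.arrowCongr (1 : F ≃L[ℝ] F)).trans (ContinuousLinearEquiv.piRing (Fin d))
  rw [← Function.id_comp f, ← e₂.symm_comp_self]
  exact (e₂.symm.contDiff.contMDiff (n := ∞)).contMDiffAt.comp x
    (contMDiffAt_pi_space.2 fun i => h _)

/-- The unit ball of a positive definite bilinear form on `ℝᵈ` is bounded, since the form is bounded
below on the unit sphere. -/
theorem isVonNBounded_of_pos (B : Euc d →L[ℝ] Euc d →L[ℝ] ℝ) (hB : ∀ v, v ≠ 0 → 0 < B v v) :
    Bornology.IsVonNBounded ℝ {v : Euc d | B v v < 1} := by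
  have hc : Continuous fun v => B v v := by fun_prop
  obtain ⟨c, hc0, hc1⟩ := (isCompact_sphere (0 : Euc d) 1).exists_forall_le' (a := (0 : ℝ))
    hc.continuousOn fun v hv => hB v fun h => by simp [h] at hv
  rw [NormedSpace.isVonNBounded_iff, isBounded_iff_forall_norm_le]
  refine ⟨1 / √c, fun v hv => ?_⟩
  by_cases hv0 : v = 0
  · rw [hv0, norm_zero]
    positivity
  have hn : 0 < ‖v‖ := norm_pos_iff.2 hv0
  have h1 := hc1 (‖v‖⁻¹ • v) (by simp [norm_smul, hn.ne'])
  simp only [map_smul, smul_apply, smul_eq_mul] at h1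
  have h2 : c * ‖v‖ ^ 2 ≤ B v v := by
    have h3 := mul_le_mul_of_nonneg_right h1 (sq_nonneg ‖v‖)
    refine h3.trans_eq ?_
    field_simp
  rw [Set.mem_ofPred_eq] at hv
  rw [le_div_iff₀ (Real.sqrt_pos.2 hc0)]
  refine abs_le_of_sq_le_sq' ?_ zero_le_one |>.2
  rw [mul_pow, Real.sq_sqrt hc0.le]
  linarith

variable [IsManifold (𝓡 d) ∞ N]

/-- A family of inner products that is smooth on smooth local vector fields is a Riemannian
metric. -/
theorem exists_riemMetric (B : N → Euc d →L[ℝ] Euc d →L[ℝ] ℝ) (hsymm : ∀ y u v, B y u v = B y v u)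
    (hpos : ∀ y v, v ≠ 0 → 0 < B y v v)
    (hB : ∀ (y₀ : N) (X Y : ∀ y : N, TangentSpace (𝓡 d) y),
      ContMDiffAt (𝓡 d) (𝓡 d).tangent ∞ (fun y => (⟨y, X y⟩ : TangentBundle (𝓡 d) N)) y₀ →
      ContMDiffAt (𝓡 d) (𝓡 d).tangent ∞ (fun y => (⟨y, Y y⟩ : TangentBundle (𝓡 d) N)) y₀ →
      ContMDiffAt (𝓡 d) 𝓘(ℝ, ℝ) ∞ (fun y => B y (X y) (Y y)) y₀) :
    ∃ g : RiemMetric d N, ∀ y, g.inner y = B y := by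
  refine ⟨⟨fun y => B y, hsymm, hpos, fun y => isVonNBounded_of_pos (B y) (hpos y), ?_⟩,
    fun y => rfl⟩
  intro y₀
  refine (contMDiffAt_hom_bundle (F₁ := Euc d) (E₁ := fun y : N => TangentSpace (𝓡 d) y)
    (F₂ := Euc d →L[ℝ] ℝ) (E₂ := fun y : N => TangentSpace (𝓡 d) y →L[ℝ] ℝ) _).2
    ⟨contMDiffAt_id, ?_⟩
  refine contMDiffAt_clm_of_apply fun v => contMDiffAt_clm_of_apply fun w => ?_
  let e := trivializationAt (Euc d) (fun y : N => TangentSpace (𝓡 d) y) y₀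
  have hy₀ : y₀ ∈ e.baseSet := FiberBundle.mem_baseSet_trivializationAt' y₀
  have hsec : ∀ v : Euc d, ContMDiffAt (𝓡 d) (𝓡 d).tangent ∞
      (fun y => (⟨y, e.symm y v⟩ : TangentBundle (𝓡 d) N)) y₀ := by
    intro v
    rw [e.contMDiffAt_section_iff hy₀]
    refine (contMDiffAt_const (c := v)).congr_of_eventuallyEq ?_
    filter_upwards [e.open_baseSet.mem_nhds hy₀] with y hy
    exact congrArg Prod.snd (e.apply_mk_symm hy v)
  refine (hB y₀ _ _ (hsec v) (hsec w)).congr_of_eventuallyEq ?_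
  filter_upwards [e.open_baseSet.mem_nhds hy₀] with y hy
  refine (inCoordinates_apply_eq₂ (E₃ := Bundle.Trivial N ℝ) hy hy
    (Set.mem_univ _)).trans ?_
  simp [e]
  rfl

end MetricOfForms

section QuotientMetric

variable {k : ℕ} {Z : Type*} [TopologicalSpace Z] [ChartedSpace (Euc (k + 1)) Z]
  [IsManifold (𝓡 (k + 1)) ∞ Z] [MulAction Circle Z]
  [ContMDiffSMul (𝓡 1) (𝓡 (k + 1)) ∞ Circle Z]
  {N : Type*} [TopologicalSpace N] [ChartedSpace (Euc k) N] {π : Z → N}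

namespace IsCircleQuotient

theorem mfderiv_unitGenerator_eq_zero (hq : IsCircleQuotient (k + 1) k π)
    (g : RiemMetric (k + 1) Z) (x : Z) :
    mfderiv (𝓡 (k + 1)) (𝓡 k) π x (unitGenerator g x) = 0 := by
  rw [unitGenerator, _root_.map_smul, hq.mfderiv_apply_generator, smul_zero]

theorem mfderiv_sub_smul_unitGenerator (hq : IsCircleQuotient (k + 1) k π)
    (g : RiemMetric (k + 1) Z) (x : Z) (v : TangentSpace (𝓡 (k + 1)) x) (a : ℝ) :
    mfderiv (𝓡 (k + 1)) (𝓡 k) π x (v - a • unitGenerator g x) =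
      mfderiv (𝓡 (k + 1)) (𝓡 k) π x v := by
  rw [map_sub, _root_.map_smul, hq.mfderiv_unitGenerator_eq_zero, smul_zero, sub_zero]

theorem mfderiv_smul_mem_normalSpace {g : RiemMetric (k + 1) Z} {o : ManifoldOrientation (k + 1) Z}
    (hiso : ActsByOrientedIsometries Circle g o) (c : Circle)
    {x : Z} {v : TangentSpace (𝓡 (k + 1)) x} (hv : v ∈ normalSpace g x) :
    mfderiv (𝓡 (k + 1)) (𝓡 (k + 1)) (fun y : Z => c • y) x v ∈ normalSpace g (c • x) := by
  change g.inner (c • x) (generator (k + 1) (c • x)) _ = 0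
  rw [← mfderiv_smul_generator c x, hiso.isometry]
  exact hv

variable [T2Space Z]

theorem generator_ne_zero (hq : IsCircleQuotient (k + 1) k π) (x : Z) :
    generator (k + 1) x ≠ 0 := SpinCPreq.generator_ne_zero hq.free x

/-- The normal part of a tangent vector. -/
theorem sub_mem_normalSpace (hq : IsCircleQuotient (k + 1) k π) (g : RiemMetric (k + 1) Z) (x : Z)
    (v : TangentSpace (𝓡 (k + 1)) x) :
    v - g.inner x (unitGenerator g x) v • unitGenerator g x ∈ normalSpace g x := by
  rw [mem_normalSpace_iff g x (hq.generator_ne_zero x), map_sub, _root_.map_smul,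
    inner_unitGenerator g x (hq.generator_ne_zero x), smul_eq_mul, mul_one, sub_self]

theorem inner_sub_smul_unitGenerator (hq : IsCircleQuotient (k + 1) k π)
    (g : RiemMetric (k + 1) Z) (x : Z) (v w : TangentSpace (𝓡 (k + 1)) x) :
    g.inner x (v - g.inner x (unitGenerator g x) v • unitGenerator g x)
      (w - g.inner x (unitGenerator g x) w • unitGenerator g x) =
      g.inner x v w - g.inner x (unitGenerator g x) v * g.inner x (unitGenerator g x) w := by
  have h := (mem_normalSpace_iff g x (hq.generator_ne_zero x) _).1 (hq.sub_mem_normalSpace g x w)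
  rw [map_sub (g.inner x), sub_apply, _root_.map_smul (g.inner x),
    smul_apply, h, smul_zero, sub_zero, map_sub, _root_.map_smul, smul_eq_mul,
    g.symm x v (unitGenerator g x), mul_comm]

/-- Horizontal lifts. -/
theorem exists_horizontalLift (hq : IsCircleQuotient (k + 1) k π) (g : RiemMetric (k + 1) Z)
    (x : Z) : ∃ L : Euc k →L[ℝ] Euc (k + 1), (∀ u, mfderiv (𝓡 (k + 1)) (𝓡 k) π x (L u) = u) ∧
      ∀ u, L u ∈ normalSpace g x := by
  let T : Euc (k + 1) →ₗ[ℝ] Euc k := (mfderiv (𝓡 (k + 1)) (𝓡 k) π x).toLinearMap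
  obtain ⟨R, hR⟩ := T.exists_rightInverse_of_surjective
    (LinearMap.range_eq_top.2 (hq.sections.surjective_mfderiv x))
  let U : Euc (k + 1) := unitGenerator g x
  let gU : Euc (k + 1) →ₗ[ℝ] ℝ := (g.inner x (unitGenerator g x)).toLinearMap
  let L : Euc k →ₗ[ℝ] Euc (k + 1) := R - (gU ∘ₗ R).smulRight U
  refine ⟨L.toContinuousLinearMap, fun u => ?_, fun u => hq.sub_mem_normalSpace g x (R u)⟩
  refine (hq.mfderiv_sub_smul_unitGenerator g x (R u) _).trans ?_
  exact congrArg (fun L : Euc k →ₗ[ℝ] Euc k => L u) hR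

variable {g : RiemMetric (k + 1) Z} {o : ManifoldOrientation (k + 1) Z}

theorem eq_of_mfderiv_eq (hq : IsCircleQuotient (k + 1) k π) {x : Z} {v w : Euc (k + 1)}
    (hv : v ∈ normalSpace g x) (hw : w ∈ normalSpace g x)
    (h : mfderiv (𝓡 (k + 1)) (𝓡 k) π x v = mfderiv (𝓡 (k + 1)) (𝓡 k) π x w) : v = w := by
  obtain ⟨a, ha⟩ := hq.exists_eq_smul_generator (x := x) (v := v - w)
    ((ContinuousLinearMap.map_sub (M := Euc (k + 1)) (M₂ := Euc k)
        (mfderiv (𝓡 (k + 1)) (𝓡 k) π x) v w).trans (sub_eq_zero.2 h))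
  have h1 : g.inner x (generator (k + 1) x) (v - w) = 0 := sub_mem hv hw
  have h2 : g.inner x (generator (k + 1) x) (a • generator (k + 1) x) = 0 :=
    (congrArg (g.inner x (generator (k + 1) x)) ha).symm.trans h1
  rw [_root_.map_smul, smul_eq_mul] at h2
  rcases mul_eq_zero.1 h2 with h3 | h3
  · rw [h3, zero_smul] at ha
    exact sub_eq_zero.1 ha
  · exact absurd h3 (g.pos x _ (hq.generator_ne_zero x)).ne'

theorem mfderiv_smul_eq (hq : IsCircleQuotient (k + 1) k π)
    (hiso : ActsByOrientedIsometries Circle g o) (c : Circle) {x : Z} {v w : Euc (k + 1)}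
    (hv : v ∈ normalSpace g x) (hw : w ∈ normalSpace g (c • x))
    (h : mfderiv (𝓡 (k + 1)) (𝓡 k) π (c • x) w = mfderiv (𝓡 (k + 1)) (𝓡 k) π x v) :
    w = mfderiv (𝓡 (k + 1)) (𝓡 (k + 1)) (fun y : Z => c • y) x v :=
  hq.eq_of_mfderiv_eq hw (mfderiv_smul_mem_normalSpace hiso c hv)
    (h.trans (hq.mfderiv_mfderiv_smul c x v).symm)

/-- The inner product of normal vectors depends only on their projections. -/
theorem inner_eq_of_mfderiv_eq (hq : IsCircleQuotient (k + 1) k π)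
    (hiso : ActsByOrientedIsometries Circle g o) {x x' : Z} (hx : π x = π x')
    {u v u' v' : Euc (k + 1)} (hu : u ∈ normalSpace g x) (hv : v ∈ normalSpace g x)
    (hu' : u' ∈ normalSpace g x') (hv' : v' ∈ normalSpace g x')
    (h1 : mfderiv (𝓡 (k + 1)) (𝓡 k) π x' u' = mfderiv (𝓡 (k + 1)) (𝓡 k) π x u)
    (h2 : mfderiv (𝓡 (k + 1)) (𝓡 k) π x' v' = mfderiv (𝓡 (k + 1)) (𝓡 k) π x v) :
    g.inner x' u' v' = g.inner x u v := by
  obtain ⟨c, rfl⟩ := (hq.orbit _ _).1 hx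
  rw [hq.mfderiv_smul_eq hiso c hu hu' h1, hq.mfderiv_smul_eq hiso c hv hv' h2]
  exact hiso.isometry c x u v

variable [IsManifold (𝓡 k) ∞ N]

/-- The quotient metric, for which `V → T(Z / S¹)` is fibrewise isometric. -/
theorem exists_riemMetric (hq : IsCircleQuotient (k + 1) k π)
    (hiso : ActsByOrientedIsometries Circle g o) :
    ∃ gB : RiemMetric k N, ∀ (x : Z), ∀ u ∈ normalSpace g x, ∀ v ∈ normalSpace g x,
      gB.inner (π x) (mfderiv (𝓡 (k + 1)) (𝓡 k) π x u) (mfderiv (𝓡 (k + 1)) (𝓡 k) π x v) =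
        g.inner x u v := by
  choose L hL1 hL2 using fun x => hq.exists_horizontalLift g x
  let s : N → Z := Function.surjInv hq.surjective
  have hs : ∀ y, π (s y) = y := Function.surjInv_eq hq.surjective
  let B : N → Euc k →L[ℝ] Euc k →L[ℝ] ℝ := fun y =>
    ContinuousLinearMap.bilinearComp (E := Euc (k + 1)) (F := Euc (k + 1)) (g.inner (s y))
      (L (s y)) (L (s y))
  have hBeq : ∀ (x : Z) (y : N), π x = y → ∀ u ∈ normalSpace g x, ∀ v ∈ normalSpace g x,
      ∀ u' v' : Euc k, mfderiv (𝓡 (k + 1)) (𝓡 k) π x u = u' →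
        mfderiv (𝓡 (k + 1)) (𝓡 k) π x v = v' → B y u' v' = g.inner x u v := by
    intro x y hxy u hu v hv u' v' hu' hv'
    exact hq.inner_eq_of_mfderiv_eq hiso (hxy.trans (hs y).symm) hu hv (hL2 _ _) (hL2 _ _)
      ((hL1 _ _).trans hu'.symm) ((hL1 _ _).trans hv'.symm)
  have hsm : ∀ (y₀ : N) (X Y : ∀ y : N, TangentSpace (𝓡 k) y),
      ContMDiffAt (𝓡 k) (𝓡 k).tangent ∞ (fun y => (⟨y, X y⟩ : TangentBundle (𝓡 k) N)) y₀ →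
      ContMDiffAt (𝓡 k) (𝓡 k).tangent ∞ (fun y => (⟨y, Y y⟩ : TangentBundle (𝓡 k) N)) y₀ →
      ContMDiffAt (𝓡 k) 𝓘(ℝ, ℝ) ∞ (fun y => B y (X y) (Y y)) y₀ := by
    intro y₀ X Y hX hY
    obtain ⟨x₀, rfl⟩ := hq.surjective y₀
    obtain ⟨U, hU, hxU, i, hi, hix, hπi⟩ := hq.sections.exists_section x₀
    have hlift : ∀ X : ∀ y : N, TangentSpace (𝓡 k) y,
        ContMDiffAt (𝓡 k) (𝓡 k).tangent ∞ (fun y => (⟨y, X y⟩ : TangentBundle (𝓡 k) N)) (π x₀) →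
        ContMDiffAt (𝓡 k) (𝓡 (k + 1)).tangent ∞ (fun y =>
          (⟨i y, mfderiv (𝓡 k) (𝓡 (k + 1)) i y (X y)⟩ : TangentBundle (𝓡 (k + 1)) Z)) (π x₀) := by
      intro X hX
      have : IsManifold (𝓡 k) (∞ + 1) N := by
        have h : (∞ : WithTop ℕ∞) + 1 = ∞ := by rfl
        rwa [h]
      have : IsManifold (𝓡 k) 1 N := IsManifold.of_le (n := ∞) (by simp)
      have : IsManifold (𝓡 (k + 1)) 1 Z := IsManifold.of_le (n := ∞) (by simp)
      have h1 := hi.contMDiffOn_tangentMapWithin (m := ∞) le_rfl hU.uniqueMDiffOn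
      have hopen : IsOpen (Bundle.TotalSpace.proj ⁻¹' U : Set (TangentBundle (𝓡 k) N)) :=
        hU.preimage (FiberBundle.continuous_proj (Euc k) (TangentSpace (𝓡 k)))
      have h2 : ContMDiffAt (𝓡 k) (𝓡 (k + 1)).tangent ∞
          (fun y => tangentMapWithin (𝓡 k) (𝓡 (k + 1)) i U ⟨y, X y⟩) (π x₀) :=
        ContMDiffAt.comp (π x₀) (h1.contMDiffAt (hopen.mem_nhds hxU)) hX
      refine h2.congr_of_eventuallyEq ?_
      filter_upwards [hU.mem_nhds hxU] with y hy
      rw [tangentMapWithin, mfderivWithin_of_isOpen hU hy]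
    have hgen := contMDiff_unitGenerator g hq.generator_ne_zero
    have hU' : ContMDiffAt (𝓡 k) (𝓡 (k + 1)).tangent ∞ (fun y =>
        (⟨i y, unitGenerator g (i y)⟩ : TangentBundle (𝓡 (k + 1)) Z)) (π x₀) :=
      hgen.contMDiffAt.comp (π x₀) (hi.contMDiffAt (hU.mem_nhds hxU))
    -- with `u` the unit generator, the horizontal part of `di X` is `di X - ⟨u, di X⟩ u`, and so
    -- `B(X, Y) = ⟨di X, di Y⟩ - ⟨u, di X⟩ ⟨u, di Y⟩`
    refine ((contMDiffAt_inner g (hlift X hX) (hlift Y hY)).sub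
      ((contMDiffAt_inner g hU' (hlift X hX)).mul
        (contMDiffAt_inner g hU' (hlift Y hY)))).congr_of_eventuallyEq ?_
    filter_upwards [hU.mem_nhds hxU] with y hy
    refine (hBeq (i y) y (hπi y hy) _ (hq.sub_mem_normalSpace g _ _) _
      (hq.sub_mem_normalSpace g _ _) _ _ ?_ ?_).trans (hq.inner_sub_smul_unitGenerator g (i y)
        (mfderiv (𝓡 k) (𝓡 (k + 1)) i y (X y)) (mfderiv (𝓡 k) (𝓡 (k + 1)) i y (Y y)))
    · exact (hq.mfderiv_sub_smul_unitGenerator g _ _ _).trans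
        (mfderiv_mfderiv_section hq.sections.contMDiff hU hi hπi hy _)
    · exact (hq.mfderiv_sub_smul_unitGenerator g _ _ _).trans
        (mfderiv_mfderiv_section hq.sections.contMDiff hU hi hπi hy _)
  obtain ⟨gB, hgB⟩ := SpinCPreq.exists_riemMetric B (fun y u v => g.symm (s y) _ _)
    (fun y v hv => g.pos (s y) _ fun h => hv (by
      refine (hL1 (s y) v).symm.trans ?_
      exact (congrArg (mfderiv (𝓡 (k + 1)) (𝓡 k) π (s y)) h).trans (map_zero _))) hsm
  refine ⟨gB, fun x u hu v hv => ?_⟩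
  rw [hgB]
  exact hBeq x _ rfl u hu v hv _ _ rfl rfl

end IsCircleQuotient

end QuotientMetric

end SpinCPreq
end

/-! ### The quotient orientation -/

noncomputable section

namespace SpinCPreq

open Topology

section Determinants

variable {k : ℕ} {V W : Type*} [AddCommGroup V] [Module ℝ V] [AddCommGroup W] [Module ℝ W]

/-- The determinant of two bases with the same last vector is the one of the bases that they induce
on the quotient by that vector. -/
theorem det_eq_det_of_map {B B' : Module.Basis (Fin (k + 1)) ℝ V} {b b' : Module.Basis (Fin k) ℝ W}
    (T : V →ₗ[ℝ] W) (h : ∀ i, T (B i.castSucc) = b i) (h' : ∀ i, T (B' i.castSucc) = b' i)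
    (h0 : T (B (Fin.last k)) = 0) (hlast : B (Fin.last k) = B' (Fin.last k)) :
    B.det B' = b.det b' := by
  have hrepr : ∀ (w : V) (j : Fin k), b.repr (T w) j = B.repr w j.castSucc := by
    intro w j
    have h1 : (b.coord j) ∘ₗ T = B.coord j.castSucc := by
      refine B.ext fun i => ?_
      refine Fin.lastCases ?_ (fun i => ?_) i
      · rw [LinearMap.comp_apply, h0, map_zero, Module.Basis.coord_apply, B.repr_self,
          Finsupp.single_eq_of_ne j.castSucc_lt_last.ne]
      · rw [LinearMap.comp_apply, h, Module.Basis.coord_apply, Module.Basis.coord_apply,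
          b.repr_self, B.repr_self, Finsupp.single_apply, Finsupp.single_apply]
        simp only [Fin.castSucc_inj]
    exact LinearMap.congr_fun h1 w
  rw [Module.Basis.det_apply, Module.Basis.det_apply, Matrix.det_succ_column _ (Fin.last k),
    Fin.sum_univ_castSucc, Finset.sum_eq_zero, zero_add]
  · have hll : B.toMatrix B' (Fin.last k) (Fin.last k) = 1 := by
      rw [Module.Basis.toMatrix_apply, ← hlast, B.repr_self, Finsupp.single_eq_same]
    rw [hll, mul_one, (Even.add_self (Fin.last k : ℕ)).neg_one_pow, one_mul]
    congr 1
    ext i j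
    rw [Matrix.submatrix_apply, Fin.succAbove_last, Module.Basis.toMatrix_apply,
      Module.Basis.toMatrix_apply, ← h', hrepr]
  · intro i _
    rw [Module.Basis.toMatrix_apply, ← hlast, B.repr_self,
      Finsupp.single_eq_of_ne i.castSucc_lt_last.ne]
    ring

theorem exists_basis_of_injective {n : ℕ} (f : Euc n →ₗ[ℝ] Euc n) (hf : Function.Injective f) :
    ∃ b : Module.Basis (Fin n) ℝ (Euc n), ∀ i, b i = f (EuclideanSpace.single i 1) := by
  refine ⟨(EuclideanSpace.basisFun (Fin n) ℝ).toBasis.map (LinearEquiv.ofInjectiveEndo f hf),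
    fun i => ?_⟩
  simp

end Determinants

section NormalFrames

variable {k : ℕ} {Z : Type*} [TopologicalSpace Z] [ChartedSpace (Euc (k + 1)) Z]
  [IsManifold (𝓡 (k + 1)) ∞ Z] [MulAction Circle Z] {g : RiemMetric (k + 1) Z}
  {o : ManifoldOrientation (k + 1) Z}

/-- `f` is an isometry onto the fibre of the normal bundle. -/
structure IsNormalFrame (g : RiemMetric (k + 1) Z) (x : Z)
    (f : Euc k →ₗ[ℝ] TangentSpace (𝓡 (k + 1)) x) : Prop where
  mem : ∀ u, f u ∈ normalSpace g x
  inner : ∀ u v, g.inner x (f u) (f v) = ⟪u, v⟫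

variable {x : Z} {f f' : Euc k →ₗ[ℝ] TangentSpace (𝓡 (k + 1)) x}

theorem IsNormalFrame.inner_eta (hf : IsNormalFrame g x f) (hx : generator (k + 1) x ≠ 0)
    (u v : Euc (k + 1)) : g.inner x (eta g x f u) (eta g x f v) = ⟪u, v⟫ := by
  have h1 := fun u => (mem_normalSpace_iff g x hx _).1 (hf.mem u)
  rw [eq_incl_add_smul_lastVec u, eq_incl_add_smul_lastVec v]
  simp only [map_add, map_smul, eta_incl, eta_lastVec, add_apply, smul_apply, smul_eq_mul,
    hf.inner, h1, g.symm x (f _) (unitGenerator g x), inner_unitGenerator g x hx, inner_add_left,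
    inner_add_right, inner_smul_left, inner_smul_right, inner_incl, inner_incl_lastVec,
    inner_lastVec_incl, inner_lastVec_self]
  simp

theorem injective_of_inner_eq {n d : ℕ} {M : Type*} [TopologicalSpace M] [ChartedSpace (Euc d) M]
    [IsManifold (𝓡 d) ∞ M] {g : RiemMetric d M} {x : M} {f : Euc n →ₗ[ℝ] TangentSpace (𝓡 d) x}
    (hf : ∀ u v, g.inner x (f u) (f v) = ⟪u, v⟫) : Function.Injective f := by
  rw [← LinearMap.ker_eq_bot, LinearMap.ker_eq_bot']
  intro v hv
  have h := hf v v
  rw [hv, map_zero] at h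
  exact inner_self_eq_zero.1 h.symm

theorem IsNormalFrame.exists_basis_eta (hf : IsNormalFrame g x f)
    (hx : generator (k + 1) x ≠ 0) : ∃ B : Module.Basis (Fin (k + 1)) ℝ (Euc (k + 1)),
      ∀ i, B i = eta g x f (EuclideanSpace.single i 1) :=
  exists_basis_of_injective (eta g x f : Euc (k + 1) →ₗ[ℝ] Euc (k + 1))
    (injective_of_inner_eq (hf.inner_eta hx))

theorem IsNormalFrame.mem_SOFV_iff (hf : IsNormalFrame g x f) (hx : generator (k + 1) x ≠ 0)
    {B : Module.Basis (Fin (k + 1)) ℝ (Euc (k + 1))}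
    (hB : ∀ i, B i = eta g x f (EuclideanSpace.single i 1)) :
    f ∈ SOFV g o x ↔ B.orientation = o.orientation x := by
  constructor
  · rintro ⟨-, -, -, B', hB', hB'o⟩
    rw [← hB'o]
    exact congrArg Module.Basis.orientation (Module.Basis.eq_of_apply_eq fun i =>
      (hB i).trans (hB' i).symm)
  · intro h
    exact ⟨hf.mem, hf.inner, hf.inner_eta hx, B, hB, h⟩

theorem isNormalFrame_of_mem_SOFV (hf : f ∈ SOFV g o x) : IsNormalFrame g x f := ⟨hf.1, hf.2.1⟩

theorem ActsByOrientedIsometries.mem_normalSpace {G : Type*} [Group G]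
    [MulAction G Z] (hiso : ActsByOrientedIsometries G g o)
    (hgenG : ∀ (a : G) (x : Z), mfderiv (𝓡 (k + 1)) (𝓡 (k + 1)) (fun y : Z => a • y) x
      (generator (k + 1) x) = generator (k + 1) (a • x)) (a : G)
    {v : TangentSpace (𝓡 (k + 1)) x} (hv : v ∈ normalSpace g x) :
    mfderiv (𝓡 (k + 1)) (𝓡 (k + 1)) (fun y : Z => a • y) x v ∈ normalSpace g (a • x) := by
  change g.inner (a • x) (generator (k + 1) (a • x)) _ = 0
  rw [← hgenG a x, hiso.isometry]
  exact hv

/-- A group of oriented isometries that preserve the generator acts on the oriented normal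
frames. -/
theorem ActsByOrientedIsometries.comp_mem_SOFV {G : Type*} [Group G]
    [MulAction G Z] (hiso : ActsByOrientedIsometries G g o)
    (hgen : ∀ x : Z, generator (k + 1) x ≠ 0)
    (hgenG : ∀ (a : G) (x : Z), mfderiv (𝓡 (k + 1)) (𝓡 (k + 1)) (fun y : Z => a • y) x
      (generator (k + 1) x) = generator (k + 1) (a • x)) (a : G) (hf : f ∈ SOFV g o x) :
    (mfderiv (𝓡 (k + 1)) (𝓡 (k + 1)) (fun y : Z => a • y) x).toLinearMap ∘ₗ f ∈
      SOFV g o (a • x) := by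
  let D : TangentSpace (𝓡 (k + 1)) x →ₗ[ℝ] TangentSpace (𝓡 (k + 1)) (a • x) :=
    (mfderiv (𝓡 (k + 1)) (𝓡 (k + 1)) (fun y : Z => a • y) x).toLinearMap
  have hD : eta g (a • x) (D ∘ₗ f) = D ∘ₗ eta g x f := by
    refine linearMap_eq_of_incl_of_lastVec (fun v => ?_) ?_
    · rw [eta_incl, LinearMap.comp_apply, LinearMap.comp_apply, eta_incl]
    · rw [eta_lastVec, LinearMap.comp_apply, eta_lastVec]
      exact (mfderiv_unitGenerator (f := fun y : Z => a • y) g (hgenG a x)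
        (hiso.isometry a x _ _)).symm
  have hn : IsNormalFrame g (a • x) (D ∘ₗ f) :=
    ⟨fun u => hiso.mem_normalSpace hgenG a (hf.1 u),
      fun u v => (hiso.isometry a x _ _).trans (hf.2.1 u v)⟩
  refine ⟨hn.mem, hn.inner, hn.inner_eta (hgen _), ?_⟩
  change o.IsPositive _ fun i => eta g (a • x) (D ∘ₗ f) _
  rw [hD]
  exact hiso.positive a x _ hf.2.2.2

variable [ContMDiffSMul (𝓡 1) (𝓡 (k + 1)) ∞ Circle Z]
  {N : Type*} [TopologicalSpace N] [ChartedSpace (Euc k) N] {π : Z → N}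

theorem incl_single (i : Fin k) :
    incl k (EuclideanSpace.single i 1) = EuclideanSpace.single i.castSucc 1 := by
  ext j
  refine Fin.lastCases ?_ (fun j => ?_) j
  · rw [incl_apply_last, PiLp.single_apply, if_neg i.castSucc_lt_last.ne']
  · rw [incl_apply_castSucc, PiLp.single_apply, PiLp.single_apply]
    simp only [Fin.castSucc_inj]

variable [T2Space Z]

theorem IsNormalFrame.exists_basis (hf : IsNormalFrame g x f) (hq : IsCircleQuotient (k + 1) k π) :
    ∃ b : Module.Basis (Fin k) ℝ (Euc k), ∀ i, b i =
      mfderiv (𝓡 (k + 1)) (𝓡 k) π x (f (EuclideanSpace.single i 1)) := by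
  refine exists_basis_of_injective
    ((mfderiv (𝓡 (k + 1)) (𝓡 k) π x).toLinearMap ∘ₗ f : Euc k →ₗ[ℝ] Euc k) fun u v huv => ?_
  exact injective_of_inner_eq hf.inner (hq.eq_of_mfderiv_eq (hf.mem u) (hf.mem v) huv)

/-- Two normal frames at a point project to bases of the same orientation if and only if their
completions by the unit generator have the same orientation. -/
theorem IsNormalFrame.orientation_eq_iff (hf : IsNormalFrame g x f) (hf' : IsNormalFrame g x f')
    (hq : IsCircleQuotient (k + 1) k π) {b b' : Module.Basis (Fin k) ℝ (Euc k)}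
    (hb : ∀ i, b i = mfderiv (𝓡 (k + 1)) (𝓡 k) π x (f (EuclideanSpace.single i 1)))
    (hb' : ∀ i, b' i = mfderiv (𝓡 (k + 1)) (𝓡 k) π x (f' (EuclideanSpace.single i 1)))
    (h : f' ∈ SOFV g o x) : f ∈ SOFV g o x ↔ b.orientation = b'.orientation := by
  have hx := hq.generator_ne_zero x
  obtain ⟨B, hB⟩ := hf.exists_basis_eta hx
  obtain ⟨B', hB'⟩ := hf'.exists_basis_eta hx
  have hdet : B.det B' = b.det b' := by
    have hcast : ∀ (f : Euc k →ₗ[ℝ] TangentSpace (𝓡 (k + 1)) x)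
        (B : Module.Basis (Fin (k + 1)) ℝ (Euc (k + 1)))
        (_ : ∀ i, B i = eta g x f (EuclideanSpace.single i 1)) (i : Fin k),
        B i.castSucc = f (EuclideanSpace.single i 1) := by
      intro f B hB i
      rw [hB, ← incl_single, eta_incl]
    have hlast : ∀ (f : Euc k →ₗ[ℝ] TangentSpace (𝓡 (k + 1)) x)
        (B : Module.Basis (Fin (k + 1)) ℝ (Euc (k + 1)))
        (_ : ∀ i, B i = eta g x f (EuclideanSpace.single i 1)),
        B (Fin.last k) = unitGenerator g x := by
      intro f B hB
      exact (hB _).trans (eta_lastVec g x f)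
    let T : Euc (k + 1) →ₗ[ℝ] Euc k := (mfderiv (𝓡 (k + 1)) (𝓡 k) π x).toLinearMap
    refine det_eq_det_of_map T (fun i => ?_) (fun i => ?_) ?_ ?_
    · exact (congrArg T (hcast f B hB i)).trans (hb i).symm
    · exact (congrArg T (hcast f' B' hB' i)).trans (hb' i).symm
    · exact (congrArg T (hlast f B hB)).trans (hq.mfderiv_unitGenerator_eq_zero g x)
    · exact (hlast f B hB).trans (hlast f' B' hB').symm
  rw [hf.mem_SOFV_iff hx hB, ← (hf'.mem_SOFV_iff hx hB').1 h]
  rw [Module.Basis.orientation_eq_iff_det_pos, Module.Basis.orientation_eq_iff_det_pos, hdet]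

/-- The circle acts on the oriented normal frames, without changing their projections. -/
theorem IsCircleQuotient.exists_mem_SOFV_smul (hq : IsCircleQuotient (k + 1) k π)
    (hiso : ActsByOrientedIsometries Circle g o) (c : Circle) (hf : f ∈ SOFV g o x) :
    ∃ f₁ ∈ SOFV g o (c • x), ∀ u, (mfderiv (𝓡 (k + 1)) (𝓡 k) π (c • x) (f₁ u) : Euc k) =
      mfderiv (𝓡 (k + 1)) (𝓡 k) π x (f u) :=
  ⟨_, hiso.comp_mem_SOFV hq.generator_ne_zero mfderiv_smul_generator c hf,
    fun u => hq.mfderiv_mfderiv_smul c x (f u)⟩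

/-- Oriented normal frames at points of an orbit project to bases of the same orientation. -/
theorem IsCircleQuotient.mem_SOFV_iff (hq : IsCircleQuotient (k + 1) k π)
    (hiso : ActsByOrientedIsometries Circle g o) {x' : Z} (hx : π x = π x')
    {f' : Euc k →ₗ[ℝ] TangentSpace (𝓡 (k + 1)) x'} (hf : f ∈ SOFV g o x)
    (hf' : IsNormalFrame g x' f') {b b' : Module.Basis (Fin k) ℝ (Euc k)}
    (hb : ∀ i, b i = mfderiv (𝓡 (k + 1)) (𝓡 k) π x (f (EuclideanSpace.single i 1)))
    (hb' : ∀ i, b' i = mfderiv (𝓡 (k + 1)) (𝓡 k) π x' (f' (EuclideanSpace.single i 1))) :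
    f' ∈ SOFV g o x' ↔ b'.orientation = b.orientation := by
  obtain ⟨c, rfl⟩ := (hq.orbit _ _).1 hx
  obtain ⟨f₁, hf₁, h₁⟩ := hq.exists_mem_SOFV_smul hiso c hf
  exact hf'.orientation_eq_iff (isNormalFrame_of_mem_SOFV hf₁) hq hb'
    (fun i => (hb i).trans (h₁ _).symm) hf₁

variable [IsManifold (𝓡 k) ∞ N]

/-- The quotient orientation, for which `V → T(Z / S¹)` is orientation preserving; it has oriented
local frames since there are local families `F` of oriented normal frames. -/
theorem IsCircleQuotient.exists_orientation (hq : IsCircleQuotient (k + 1) k π)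
    (hiso : ActsByOrientedIsometries Circle g o)
    (hF : ∀ y₀ : N, ∃ W : Set N, IsOpen W ∧ y₀ ∈ W ∧ ∃ (j : N → Z)
      (F : ∀ y, Euc k →ₗ[ℝ] TangentSpace (𝓡 (k + 1)) (j y)), (∀ y ∈ W, π (j y) = y) ∧
      (∀ y, F y ∈ SOFV g o (j y)) ∧ ∀ v, ContMDiffAt (𝓡 k) (𝓡 (k + 1)).tangent ∞
        (fun y => (⟨j y, F y v⟩ : TangentBundle (𝓡 (k + 1)) Z)) y₀)
    (gB : RiemMetric k N) (hgB : ∀ (x : Z), ∀ u ∈ normalSpace g x, ∀ v ∈ normalSpace g x,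
      gB.inner (π x) (mfderiv (𝓡 (k + 1)) (𝓡 k) π x u) (mfderiv (𝓡 (k + 1)) (𝓡 k) π x v) =
        g.inner x u v) :
    ∃ oB : ManifoldOrientation k N, ∀ (x : Z) (f : Euc k →ₗ[ℝ] TangentSpace (𝓡 (k + 1)) x),
      (∀ u, f u ∈ normalSpace g x) → (f ∈ SOFV g o x ↔
        (mfderiv (𝓡 (k + 1)) (𝓡 k) π x).toLinearMap ∘ₗ f ∈ SOF gB oB (π x)) := by
  have hbase : ∀ y : N, ∃ (x : Z) (f : Euc k →ₗ[ℝ] TangentSpace (𝓡 (k + 1)) x)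
      (b : Module.Basis (Fin k) ℝ (Euc k)), π x = y ∧ f ∈ SOFV g o x ∧
      ∀ i, b i = mfderiv (𝓡 (k + 1)) (𝓡 k) π x (f (EuclideanSpace.single i 1)) := by
    intro y
    obtain ⟨W, -, hyW, j, F, hj, hF, -⟩ := hF y
    obtain ⟨b, hb⟩ := (isNormalFrame_of_mem_SOFV (hF y)).exists_basis hq
    exact ⟨j y, F y, b, hj y hyW, hF y, hb⟩
  choose X f b hX hf hb using hbase
  have key : ∀ (x : Z) (y : N) (_ : π x = y) (f' : Euc k →ₗ[ℝ] TangentSpace (𝓡 (k + 1)) x)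
      (_ : IsNormalFrame g x f') (b' : Module.Basis (Fin k) ℝ (Euc k))
      (_ : ∀ i, b' i = mfderiv (𝓡 (k + 1)) (𝓡 k) π x (f' (EuclideanSpace.single i 1))),
      f' ∈ SOFV g o x ↔ b'.orientation = (b y).orientation := fun x y hxy f' hf' b' hb' =>
    hq.mem_SOFV_iff hiso ((hX y).trans hxy.symm) (hf y) hf' (hb y) hb'
  refine ⟨⟨fun y => (b y).orientation, fun y₀ => ?_⟩, fun x f' hf' => ?_⟩
  · obtain ⟨W, hW, hyW, j, F, hj, hF, hFs⟩ := hF y₀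
    refine ⟨fun i y => (mfderiv (𝓡 (k + 1)) (𝓡 k) π (j y) (F y (EuclideanSpace.single i 1)) :
      Euc k), fun i => ?_, ?_⟩
    · have h1 : ContMDiff (𝓡 (k + 1)).tangent (𝓡 k).tangent ∞ (tangentMap (𝓡 (k + 1)) (𝓡 k) π) :=
        hq.sections.contMDiff.contMDiff_tangentMap (by rfl)
      refine (h1.contMDiffAt.comp y₀ (hFs (EuclideanSpace.single i 1))).congr_of_eventuallyEq ?_
      filter_upwards [hW.mem_nhds hyW] with y hy
      have h2 : ∀ (y' : N) (_ : y' = y) (w : Euc k),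
          (⟨y, w⟩ : TangentBundle (𝓡 k) N) = ⟨y', w⟩ := by
        rintro _ rfl w
        rfl
      exact h2 _ (hj y hy) _
    · filter_upwards [hW.mem_nhds hyW] with y hy
      obtain ⟨b', hb'⟩ := (isNormalFrame_of_mem_SOFV (hF y)).exists_basis hq
      exact ⟨b', hb', (key _ y (hj y hy) _ (isNormalFrame_of_mem_SOFV (hF y)) b' hb').1 (hF y)⟩
  · constructor
    · intro h
      have hn := isNormalFrame_of_mem_SOFV h
      obtain ⟨b', hb'⟩ := hn.exists_basis hq
      exact ⟨fun u v => (hgB x _ (hf' u) _ (hf' v)).trans (hn.inner u v), b', hb',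
        (key x _ rfl f' hn b' hb').1 h⟩
    · rintro ⟨h1, b', hb', ho⟩
      exact (key x _ rfl f' ⟨hf', fun u v => (hgB x _ (hf' u) _ (hf' v)).symm.trans (h1 u v)⟩
        b' hb').2 ho

end NormalFrames

end SpinCPreq
end

/-! ### The spinᶜ structure on the quotient -/

noncomputable section

namespace SpinCPreq

open Topology

section CircleQuotients

variable {M X : Type*} [TopologicalSpace M] [TopologicalSpace X] [MulAction Circle M] {π : M → X}

theorem isOpenQuotientMap_of_orbits [ContinuousConstSMul Circle M] (hπ : IsQuotientMap π)
    (horb : ∀ x y, π x = π y ↔ ∃ c : Circle, c • x = y) : IsOpenQuotientMap π := by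
  refine ⟨hπ.surjective, hπ.continuous, fun U hU => ?_⟩
  rw [← hπ.isOpen_preimage]
  have h : π ⁻¹' (π '' U) = ⋃ c : Circle, (fun x => c • x) ⁻¹' U := by
    ext x
    simp only [Set.mem_preimage, Set.mem_image, Set.mem_iUnion]
    constructor
    · rintro ⟨y, hy, hyx⟩
      obtain ⟨c, rfl⟩ := (horb _ _).1 hyx.symm
      exact ⟨c, hy⟩
    · rintro ⟨c, hc⟩
      exact ⟨c • x, hc, ((horb _ _).2 ⟨c, rfl⟩).symm⟩
  rw [h]
  exact isOpen_iUnion fun c => hU.preimage (continuous_const_smul c)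

theorem t2Space_of_orbits [ContinuousSMul Circle M] [T2Space M] (hπ : IsOpenQuotientMap π)
    (horb : ∀ x y, π x = π y ↔ ∃ c : Circle, c • x = y) : T2Space X := by
  rw [t2Space_iff_of_isOpenQuotientMap hπ]
  have h1 : IsClosed {w : Circle × M × M | w.1 • w.2.1 = w.2.2} :=
    isClosed_eq (by fun_prop) (by fun_prop)
  have h2 := isClosedMap_snd_of_compactSpace (X := Circle) _ h1
  convert h2 using 1
  ext ⟨x, y⟩
  simp only [Set.mem_image, Set.mem_ofPred_eq, Prod.exists]
  constructor
  · intro h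
    obtain ⟨c, hc⟩ := (horb _ _).1 h
    exact ⟨c, x, y, hc, rfl⟩
  · rintro ⟨c, x', y', hc, hxy⟩
    obtain ⟨rfl, rfl⟩ := Prod.mk.inj hxy
    exact (horb _ _).2 ⟨c, hc⟩

variable {m d : ℕ} [ChartedSpace (Euc m) M] [T2Space M] [IsManifold (𝓡 m) ∞ M]
  [ContMDiffSMul (𝓡 1) (𝓡 m) ∞ Circle M]

/-- The quotient of a manifold by a free circle action is a manifold. -/
theorem exists_isCircleQuotient (hdim : m = d + 1) (hπ : IsOpenQuotientMap π)
    (horb : ∀ x y, π x = π y ↔ ∃ c : Circle, c • x = y)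
    (hfree : ∀ (c : Circle) (x : M), c • x = x → c = 1) :
    ∃ (_ : ChartedSpace (Euc d) X) (_ : IsManifold (𝓡 d) ∞ X),
      Manifold.IsSubmersion (𝓡 m) (𝓡 d) ∞ π ∧ IsCircleQuotient m d π := by
  obtain ⟨cs, ism, h1, h2⟩ :=
    exists_isManifold_quotient hdim hπ horb (nonempty_circleSlice hfree)
  exact ⟨cs, ism, h1, hdim, hfree, horb, hπ.surjective, h2⟩

/-- If two families of points differ by the free action of a family of elements of the circle, then
the latter is smooth if the former are. -/
theorem contMDiffOn_of_smul_eq (hfree : ∀ (c : Circle) (x : M), c • x = x → c = 1)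
    {E H Y : Type*} [NormedAddCommGroup E] [NormedSpace ℝ E] [TopologicalSpace H]
    [TopologicalSpace Y] [ChartedSpace H Y] {J : ModelWithCorners ℝ E H} {A : Set Y} {a b : Y → M}
    {c : Y → Circle} (ha : ContMDiffOn J (𝓡 m) ∞ a A) (hb : ContMDiffOn J (𝓡 m) ∞ b A)
    (hc : ∀ y ∈ A, c y • a y = b y) : ContMDiffOn J (𝓡 1) ∞ c A := by
  intro y hy
  obtain ⟨χ⟩ := nonempty_circleSlice (m := m) hfree (a y)
  have ha' : ContMDiffWithinAt J (𝓡 1) ∞ (fun z => χ.toFun (a z)) A y :=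
    (χ.contMDiffOn.contMDiffAt (χ.isOpen_carrier.mem_nhds χ.mem_carrier)).comp_contMDiffWithinAt y
      (ha y hy)
  have hby : b y ∈ χ.carrier := by
    rw [← hc y hy]
    exact χ.smul_mem _ _ χ.mem_carrier
  have hb' : ContMDiffWithinAt J (𝓡 1) ∞ (fun z => χ.toFun (b z)) A y :=
    (χ.contMDiffOn.contMDiffAt (χ.isOpen_carrier.mem_nhds hby)).comp_contMDiffWithinAt y (hb y hy)
  refine (hb'.mul ha'.inv).congr_of_eventuallyEq ?_ ?_
  · filter_upwards [self_mem_nhdsWithin, (ha y hy).continuousWithinAt.preimage_mem_nhdsWithin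
      (χ.isOpen_carrier.mem_nhds χ.mem_carrier)] with z hz hz2
    change c z = χ.toFun (b z) * (χ.toFun (a z))⁻¹
    rw [← hc z hz, χ.map_smul _ _ hz2, mul_inv_cancel_right]
  · change c y = χ.toFun (b y) * (χ.toFun (a y))⁻¹
    rw [← hc y hy, χ.map_smul _ _ χ.mem_carrier, mul_inv_cancel_right]

end CircleQuotients

section QuotientSpinC

variable {k : ℕ} {Z : Type*} [TopologicalSpace Z] [ChartedSpace (Euc (k + 1)) Z]
  [IsManifold (𝓡 (k + 1)) ∞ Z] [MulAction Circle Z] {g : RiemMetric (k + 1) Z}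
  {o : ManifoldOrientation (k + 1) Z}
  {N : Type*} [TopologicalSpace N] [ChartedSpace (Euc k) N] {π : Z → N}
  {P' : Type*} [TopologicalSpace P'] [ChartedSpace (Euc (spinCDim (k + 1) k)) P']
  [IsManifold (𝓡 (spinCDim (k + 1) k)) ∞ P'] [MulAction Circle P']
  {PB : Type*} [TopologicalSpace PB] [ChartedSpace (Euc (spinCDim k k)) PB] {q : P' → PB}

/-- The projection `P' / S¹ → Z / S¹`, computed at a representative. -/
def quotProj (S' : SpinCStructure k (SOFV g o) P')
    (hqP : IsCircleQuotient (spinCDim (k + 1) k) (spinCDim k k) q) (π : Z → N) (y : PB) : N :=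
  π (S'.proj (Function.surjInv hqP.surjective y))

/-- The action of `Spinᶜ(k)` on `P' / S¹`, computed at a representative. -/
def quotAct (S' : SpinCStructure k (SOFV g o) P')
    (hqP : IsCircleQuotient (spinCDim (k + 1) k) (spinCDim k k) q) (y : PB) (s : SpinC k) : PB :=
  q (S'.act (Function.surjInv hqP.surjective y) s)

/-- The frame given by a point of `P' / S¹`: the projection of the frame given by a
representative. -/
def quotFrame (S' : SpinCStructure k (SOFV g o) P')
    (hqP : IsCircleQuotient (spinCDim (k + 1) k) (spinCDim k k) q) (π : Z → N) (y : PB) :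
    Euc k →ₗ[ℝ] TangentSpace (𝓡 k) (quotProj S' hqP π y) :=
  (mfderiv (𝓡 (k + 1)) (𝓡 k) π (S'.proj (Function.surjInv hqP.surjective y))).toLinearMap ∘ₗ
    S'.frame (Function.surjInv hqP.surjective y)

theorem IsCircleQuotient.exists_smul_eq_surjInv {m d : ℕ} {M N : Type*} [TopologicalSpace M]
    [ChartedSpace (Euc m) M] [TopologicalSpace N] [ChartedSpace (Euc d) N] [MulAction Circle M]
    {π : M → N} (hq : IsCircleQuotient m d π) (x : M) :
    ∃ c : Circle, c • x = Function.surjInv hq.surjective (π x) :=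
  (hq.orbit _ _).1 (Function.surjInv_eq hq.surjective (π x)).symm

variable {S' : SpinCStructure k (SOFV g o) P'}

theorem quotProj_apply (hq : IsCircleQuotient (k + 1) k π)
    (hqP : IsCircleQuotient (spinCDim (k + 1) k) (spinCDim k k) q)
    (hS' : S'.IsEquivariant (𝓡 1) Circle) (p : P') :
    quotProj S' hqP π (q p) = π (S'.proj p) := by
  obtain ⟨c, hc⟩ := hqP.exists_smul_eq_surjInv p
  rw [quotProj, ← hc, hS'.proj_smul, hq.map_smul]

theorem quotAct_apply (hqP : IsCircleQuotient (spinCDim (k + 1) k) (spinCDim k k) q)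
    (hS' : S'.IsEquivariant (𝓡 1) Circle) (p : P') (s : SpinC k) :
    quotAct S' hqP (q p) s = q (S'.act p s) := by
  obtain ⟨c, hc⟩ := hqP.exists_smul_eq_surjInv p
  rw [quotAct, ← hc, hS'.smul_act, hqP.map_smul]

theorem quotFrame_apply (hq : IsCircleQuotient (k + 1) k π)
    (hqP : IsCircleQuotient (spinCDim (k + 1) k) (spinCDim k k) q)
    (hS' : S'.IsEquivariant (𝓡 1) Circle) (p : P') (v : Euc k) :
    (⟨quotProj S' hqP π (q p), quotFrame S' hqP π (q p) v⟩ : TangentBundle (𝓡 k) N) =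
      tangentMap (𝓡 (k + 1)) (𝓡 k) π ⟨S'.proj p, S'.frame p v⟩ := by
  have := hS'.smooth_base
  obtain ⟨c, hc⟩ := hqP.exists_smul_eq_surjInv p
  change tangentMap (𝓡 (k + 1)) (𝓡 k) π ⟨S'.proj (Function.surjInv hqP.surjective (q p)),
    S'.frame (Function.surjInv hqP.surjective (q p)) v⟩ = _
  rw [← hc, hS'.frame_smul, hq.tangentMap_tangentMap_smul]

theorem quotAct_free (hq : IsCircleQuotient (k + 1) k π)
    (hqP : IsCircleQuotient (spinCDim (k + 1) k) (spinCDim k k) q)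
    (hS' : S'.IsEquivariant (𝓡 1) Circle) (y : PB) (s t : SpinC k)
    (h : quotAct S' hqP y s = quotAct S' hqP y t) : s = t := by
  obtain ⟨p, rfl⟩ := hqP.surjective y
  rw [quotAct_apply hqP hS', quotAct_apply hqP hS', hqP.orbit] at h
  obtain ⟨c, hc⟩ := h
  have h1 : c • S'.proj p = S'.proj p := by
    rw [← S'.proj_act p s, ← hS'.proj_smul, hc, S'.proj_act, S'.proj_act]
  rw [hq.free c _ h1, one_smul] at hc
  exact S'.act_free p s t hc

theorem quotProj_eq_iff (hq : IsCircleQuotient (k + 1) k π)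
    (hqP : IsCircleQuotient (spinCDim (k + 1) k) (spinCDim k k) q)
    (hS' : S'.IsEquivariant (𝓡 1) Circle) (y y' : PB) :
    quotProj S' hqP π y = quotProj S' hqP π y' ↔ ∃ s, quotAct S' hqP y s = y' := by
  obtain ⟨p, rfl⟩ := hqP.surjective y
  obtain ⟨p', rfl⟩ := hqP.surjective y'
  rw [quotProj_apply hq hqP hS', quotProj_apply hq hqP hS', hq.orbit]
  constructor
  · rintro ⟨c, hc⟩
    rw [← hS'.proj_smul] at hc
    obtain ⟨s, hs⟩ := (S'.fibre _ _).1 hc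
    exact ⟨s, by rw [quotAct_apply hqP hS', ← hs, hS'.smul_act, hqP.map_smul]⟩
  · rintro ⟨s, hs⟩
    rw [quotAct_apply hqP hS', hqP.orbit] at hs
    obtain ⟨c, hc⟩ := hs
    exact ⟨c, by rw [← hc, hS'.proj_smul, S'.proj_act]⟩

variable [T2Space Z]

open Classical in
/-- A local trivialization of `P'` and a local section of `π` give a local trivialization of
`P' / S¹`. -/
theorem exists_quot_trivialization (hq : IsCircleQuotient (k + 1) k π)
    (hqP : IsCircleQuotient (spinCDim (k + 1) k) (spinCDim k k) q)
    (hS' : S'.IsEquivariant (𝓡 1) Circle) (y₀ : N) :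
    ∃ U : Set N, IsOpen U ∧ y₀ ∈ U ∧ ∃ (σ : N → PB) (τ : PB → SpinC k),
      (∀ x ∈ U, quotProj S' hqP π (σ x) = x) ∧ ContMDiffOn (𝓡 k) (𝓡 (spinCDim k k)) ∞ σ U ∧
      (∀ p, quotProj S' hqP π p ∈ U → quotAct S' hqP (σ (quotProj S' hqP π p)) (τ p) = p) ∧
      ∀ l, ContMDiffOn (𝓡 (spinCDim k k)) 𝓘(ℝ, ℂ) ∞ (fun p => SpinC.coeff l (τ p))
        (quotProj S' hqP π ⁻¹' U) := by
  have := hS'.smooth_base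
  have := hS'.smooth_total
  obtain ⟨x₀, rfl⟩ := hq.surjective y₀
  obtain ⟨U', hU', hxU', σ', -, hσ', hσs', -⟩ := S'.locally_trivial x₀
  obtain ⟨U, hU, hxU, i, hi, hix, hπi⟩ := hq.sections.exists_section x₀
  let W : Set N := U ∩ i ⁻¹' U'
  have hW : IsOpen W := hi.continuousOn.isOpen_inter_preimage hU hU'
  let σ : N → PB := fun y => q (σ' (i y))
  have hσ : ∀ y ∈ W, quotProj S' hqP π (σ y) = y := fun y hy => by
    rw [quotProj_apply hq hqP hS', hσ' _ hy.2, hπi y hy.1]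
  have hex : ∀ p, quotProj S' hqP π p ∈ W →
      ∃ s, quotAct S' hqP (σ (quotProj S' hqP π p)) s = p := fun p hp =>
    (quotProj_eq_iff hq hqP hS' _ _).1 (hσ _ hp)
  let τ : PB → SpinC k := fun p => if hp : quotProj S' hqP π p ∈ W then (hex p hp).choose else 1
  have hτ : ∀ p, quotProj S' hqP π p ∈ W → quotAct S' hqP (σ (quotProj S' hqP π p)) (τ p) = p := by
    intro p hp
    have h : τ p = (hex p hp).choose := dif_pos hp
    rw [h]
    exact (hex p hp).choose_spec
  have hσs : ContMDiffOn (𝓡 k) (𝓡 (spinCDim (k + 1) k)) ∞ (fun y => σ' (i y)) W :=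
    hσs'.comp (hi.mono Set.inter_subset_left) fun y hy => hy.2
  have hproj : ContMDiff (𝓡 (spinCDim (k + 1) k)) (𝓡 k) ∞ (fun p => π (S'.proj p)) :=
    hq.sections.contMDiff.comp S'.proj_smooth
  have hcont : Continuous (quotProj S' hqP π) := by
    have h1 : ContMDiff (𝓡 (spinCDim k k)) (𝓡 k) ∞ (quotProj S' hqP π) := by
      refine hqP.sections.contMDiff_of_comp hqP.surjective ?_
      simp only [quotProj_apply hq hqP hS']
      exact hproj
    exact h1.continuous
  refine ⟨W, hW, ⟨hxU, by rw [Set.mem_preimage, hix]; exact hxU'⟩, σ, τ, hσ,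
    hqP.sections.contMDiff.comp_contMDiffOn hσs, hτ, fun l => ?_⟩
  refine hqP.sections.contMDiffOn_of_comp hqP.surjective (hW.preimage hcont) ?_
  -- on `P'`, the element `τ` compares `p` with the point `c • σ' (i (π (proj p)))` over `proj p`
  let A : Set P' := q ⁻¹' (quotProj S' hqP π ⁻¹' W)
  have hA : ∀ p ∈ A, π (S'.proj p) ∈ W := fun p hp => by
    rw [← quotProj_apply hq hqP hS']
    exact hp
  have hc : ∀ p : P', ∃ c : Circle, p ∈ A →
      c • S'.act (σ' (i (π (S'.proj p)))) (τ (q p)) = p := by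
    intro p
    by_cases hp : p ∈ A
    · have h1 := hτ (q p) hp
      rw [quotProj_apply hq hqP hS', quotAct_apply hqP hS', hqP.orbit] at h1
      obtain ⟨c, hc⟩ := h1
      exact ⟨c, fun _ => hc⟩
    · exact ⟨1, fun h => (hp h).elim⟩
  choose c hc using hc
  have hbase : ContMDiffOn (𝓡 (spinCDim (k + 1) k)) (𝓡 (k + 1)) ∞
      (fun p => i (π (S'.proj p))) A :=
    hi.comp hproj.contMDiffOn fun p hp => (hA p hp).1
  have hcs : ContMDiffOn (𝓡 (spinCDim (k + 1) k)) (𝓡 1) ∞ c A := by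
    refine contMDiffOn_of_smul_eq hq.free hbase S'.proj_smooth.contMDiffOn fun p hp => ?_
    have h1 := congrArg S'.proj (hc p hp)
    rwa [hS'.proj_smul, S'.proj_act, hσ' _ (hA p hp).2] at h1
  refine S'.smoothOn_of_act_eq (s := fun p => τ (q p))
    (f := fun p => c p • σ' (i (π (S'.proj p)))) (h := id) ?_ contMDiffOn_id
    (fun p hp => (hS'.smul_act _ _ _).trans (hc p hp)) l
  exact (contMDiff_smul (I := 𝓡 1) (I' := 𝓡 (spinCDim (k + 1) k)) (n := ∞) (G := Circle)
    (M := P')).comp_contMDiffOn (hcs.prodMk (hσs.comp hproj.contMDiffOn hA))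

variable [IsManifold (𝓡 k) ∞ N] [IsManifold (𝓡 (spinCDim k k)) ∞ PB]
  {gB : RiemMetric k N} {oB : ManifoldOrientation k N}

/-- The spinᶜ structure `P' / S¹ → SOF(Z / S¹) → Z / S¹`. -/
def quotSpinC (hq : IsCircleQuotient (k + 1) k π)
    (hqP : IsCircleQuotient (spinCDim (k + 1) k) (spinCDim k k) q)
    (hS' : S'.IsEquivariant (𝓡 1) Circle)
    (hSOF : ∀ (x : Z), ∀ f ∈ SOFV g o x,
      (mfderiv (𝓡 (k + 1)) (𝓡 k) π x).toLinearMap ∘ₗ f ∈ SOF gB oB (π x)) :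
    SpinCStructure k (SOF gB oB) PB where
  proj := quotProj S' hqP π
  act := quotAct S' hqP
  frame := quotFrame S' hqP π
  proj_smooth := by
    refine hqP.sections.contMDiff_of_comp hqP.surjective ?_
    simp only [quotProj_apply hq hqP hS']
    exact hq.sections.contMDiff.comp S'.proj_smooth
  act_one y := by
    obtain ⟨p, rfl⟩ := hqP.surjective y
    rw [quotAct_apply hqP hS', S'.act_one]
  act_mul y s t := by
    obtain ⟨p, rfl⟩ := hqP.surjective y
    rw [quotAct_apply hqP hS', quotAct_apply hqP hS', quotAct_apply hqP hS', S'.act_mul]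
  act_smooth m γ hγ := by
    refine hqP.sections.contMDiff_of_comp_prod hqP.surjective ?_
    simp only [quotAct_apply hqP hS']
    exact hqP.sections.contMDiff.comp (S'.act_smooth m γ hγ)
  act_free := quotAct_free hq hqP hS'
  fibre := quotProj_eq_iff hq hqP hS'
  locally_trivial := exists_quot_trivialization hq hqP hS'
  frame_mem _ := hSOF _ _ (S'.frame_mem _)
  frame_smooth v := by
    refine hqP.sections.contMDiff_of_comp hqP.surjective ?_
    simp only [quotFrame_apply hq hqP hS']
    exact (hq.sections.contMDiff.contMDiff_tangentMap (m := ∞) (by rfl)).comp (S'.frame_smooth v)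
  frame_act y x z v := by
    obtain ⟨p, rfl⟩ := hqP.surjective y
    rw [quotAct_apply hqP hS', quotFrame_apply hq hqP hS', quotFrame_apply hq hqP hS',
      S'.frame_act]

end QuotientSpinC

end SpinCPreq
end

/-! ### Induced actions on quotients -/

noncomputable section

namespace SpinCPreq

open Topology

theorem SpinCStructure.proj_surjective {d r : ℕ} {M : Type*} [TopologicalSpace M]
    [ChartedSpace (Euc d) M] [IsManifold (𝓡 d) ∞ M]
    {Q : ∀ x : M, Set (Euc r →ₗ[ℝ] TangentSpace (𝓡 d) x)} {P : Type*} [TopologicalSpace P]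
    [ChartedSpace (Euc (spinCDim d r)) P] [IsManifold (𝓡 (spinCDim d r)) ∞ P]
    (S : SpinCStructure r Q P) : Function.Surjective S.proj := by
  intro x
  obtain ⟨U, -, hx, σ, -, hσ, -⟩ := S.locally_trivial x
  exact ⟨σ x, hσ x hx⟩

theorem contMDiff_smul_left {m : ℕ} {M : Type*} [TopologicalSpace M] [ChartedSpace (Euc m) M]
    {E H : Type*} [NormedAddCommGroup E] [NormedSpace ℝ E] [TopologicalSpace H]
    (I : ModelWithCorners ℝ E H) {G : Type*} [TopologicalSpace G] [ChartedSpace H G] [Group G]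
    [MulAction G M] [ContMDiffSMul I (𝓡 m) ∞ G M] (a : G) :
    ContMDiff (𝓡 m) (𝓡 m) ∞ (fun x : M => a • x) :=
  (contMDiff_smul (I := I) (I' := 𝓡 m) (n := ∞) (G := G) (M := M)).comp
    (contMDiff_const.prodMk contMDiff_id)

section InducedAction

variable {m d : ℕ} {M N : Type*} [TopologicalSpace M] [ChartedSpace (Euc m) M]
  [TopologicalSpace N] [ChartedSpace (Euc d) N] [MulAction Circle M] {π : M → N}
  {E H : Type*} [NormedAddCommGroup E] [NormedSpace ℝ E] [TopologicalSpace H]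
  {I : ModelWithCorners ℝ E H} {G : Type*} [TopologicalSpace G] [ChartedSpace H G] [Group G]
  [MulAction G M]

/-- An action that commutes with the circle action descends to the quotient. -/
theorem IsCircleQuotient.exists_mulAction {G : Type*} [Group G] [MulAction G M]
    (hq : IsCircleQuotient m d π) (hcomm : ∀ (a : G) (c : Circle) (x : M), a • c • x = c • a • x) :
    ∃ _ : MulAction G N, ∀ (a : G) (x : M), a • π x = π (a • x) := by
  have key : ∀ (a : G) (x : M), π (a • Function.surjInv hq.surjective (π x)) = π (a • x) := by
    intro a x
    obtain ⟨c, hc⟩ := hq.exists_smul_eq_surjInv x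
    rw [← hc, hcomm, hq.map_smul]
  refine ⟨{ smul a y := π (a • Function.surjInv hq.surjective y)
            mul_smul a b y := ?_
            one_smul y := ?_ }, key⟩
  · obtain ⟨x, rfl⟩ := hq.surjective y
    change π _ = π (a • Function.surjInv hq.surjective (π (b • _)))
    obtain ⟨c, hc⟩ := hq.exists_smul_eq_surjInv x
    rw [key, key, ← hc, hcomm, hcomm, hq.map_smul, mul_smul]
  · obtain ⟨x, rfl⟩ := hq.surjective y
    exact (key 1 x).trans (by rw [one_smul])

theorem IsCircleQuotient.contMDiffSMul [MulAction G N] [ContMDiffSMul I (𝓡 m) ∞ G M]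
    (hq : IsCircleQuotient m d π) (h : ∀ (a : G) (x : M), a • π x = π (a • x)) :
    ContMDiffSMul I (𝓡 d) ∞ G N := by
  refine ⟨hq.sections.contMDiff_of_prod_comp hq.surjective ?_⟩
  simp only [h]
  exact hq.sections.contMDiff.comp contMDiff_smul

/-- The induced action on the quotient, to first order. -/
theorem IsCircleQuotient.tangentMap_smul [MulAction G N] (I : ModelWithCorners ℝ E H)
    [ContMDiffSMul I (𝓡 m) ∞ G M] [ContMDiffSMul I (𝓡 d) ∞ G N] (hq : IsCircleQuotient m d π)
    (h : ∀ (a : G) (x : M), a • π x = π (a • x)) (a : G) (w : TangentBundle (𝓡 m) M) :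
    tangentMap (𝓡 m) (𝓡 d) π (tangentMap (𝓡 m) (𝓡 m) (fun x : M => a • x) w) =
      tangentMap (𝓡 d) (𝓡 d) (fun y : N => a • y) (tangentMap (𝓡 m) (𝓡 d) π w) := by
  have hne : (∞ : WithTop ℕ∞) ≠ 0 := by simp
  have h1 := tangentMap_comp_at (g := π) (f := fun x : M => a • x) w (hq.mdifferentiableAt _)
    ((contMDiff_smul_left I a _).mdifferentiableAt hne)
  have h2 := tangentMap_comp_at (g := fun y : N => a • y) (f := π) w
    ((contMDiff_smul_left I a _).mdifferentiableAt hne) (hq.mdifferentiableAt _)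
  have h3 : (fun y : N => a • y) ∘ π = π ∘ fun x : M => a • x := funext fun x => h a x
  rw [← h1, ← h2, h3]

theorem IsCircleQuotient.mfderiv_smul [MulAction G N] (I : ModelWithCorners ℝ E H)
    [ContMDiffSMul I (𝓡 m) ∞ G M] [ContMDiffSMul I (𝓡 d) ∞ G N] (hq : IsCircleQuotient m d π)
    (h : ∀ (a : G) (x : M), a • π x = π (a • x)) (a : G) (x : M) (v : Euc m) :
    (mfderiv (𝓡 m) (𝓡 d) π (a • x) (mfderiv (𝓡 m) (𝓡 m) (fun x : M => a • x) x v) : Euc d) =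
      mfderiv (𝓡 d) (𝓡 d) (fun y : N => a • y) (π x) (mfderiv (𝓡 m) (𝓡 d) π x v) :=
  eq_of_heq (Bundle.TotalSpace.mk.inj (hq.tangentMap_smul I h a ⟨x, v⟩)).2

end InducedAction

section QuotientGeometry

variable {k : ℕ} {Z : Type*} [TopologicalSpace Z] [ChartedSpace (Euc (k + 1)) Z]
  [IsManifold (𝓡 (k + 1)) ∞ Z] [MulAction Circle Z] {g : RiemMetric (k + 1) Z}
  {o : ManifoldOrientation (k + 1) Z}
  {N : Type*} [TopologicalSpace N] [ChartedSpace (Euc k) N] {π : Z → N}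
  {P' : Type*} [TopologicalSpace P'] [ChartedSpace (Euc (spinCDim (k + 1) k)) P']
  [IsManifold (𝓡 (spinCDim (k + 1) k)) ∞ P']

/-- A spinᶜ structure on the normal bundle gives local families of oriented normal frames,
parametrized by the quotient. -/
theorem IsCircleQuotient.exists_normalFrames (hq : IsCircleQuotient (k + 1) k π)
    (S' : SpinCStructure k (SOFV g o) P') (y₀ : N) :
    ∃ W : Set N, IsOpen W ∧ y₀ ∈ W ∧ ∃ (j : N → Z)
      (F : ∀ y, Euc k →ₗ[ℝ] TangentSpace (𝓡 (k + 1)) (j y)), (∀ y ∈ W, π (j y) = y) ∧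
      (∀ y, F y ∈ SOFV g o (j y)) ∧ ∀ v, ContMDiffAt (𝓡 k) (𝓡 (k + 1)).tangent ∞
        (fun y => (⟨j y, F y v⟩ : TangentBundle (𝓡 (k + 1)) Z)) y₀ := by
  obtain ⟨x₀, rfl⟩ := hq.surjective y₀
  obtain ⟨U', hU', hxU', σ, -, hσ, hσs, -⟩ := S'.locally_trivial x₀
  obtain ⟨U, hU, hxU, i, hi, hix, hπi⟩ := hq.sections.exists_section x₀
  have hW : IsOpen (U ∩ i ⁻¹' U') := hi.continuousOn.isOpen_inter_preimage hU hU'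
  have hmem : π x₀ ∈ U ∩ i ⁻¹' U' := ⟨hxU, by rw [Set.mem_preimage, hix]; exact hxU'⟩
  refine ⟨U ∩ i ⁻¹' U', hW, hmem, fun y => S'.proj (σ (i y)), fun y => S'.frame (σ (i y)),
    fun y hy => (congrArg π (hσ _ hy.2)).trans (hπi y hy.1), fun y => S'.frame_mem _, fun v => ?_⟩
  exact (S'.frame_smooth v).contMDiffAt.comp (π x₀)
    ((hσs.comp (hi.mono Set.inter_subset_left) fun y hy => hy.2).contMDiffAt (hW.mem_nhds hmem))

variable [T2Space Z] [IsManifold (𝓡 k) ∞ N]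
  {gB : RiemMetric k N} {oB : ManifoldOrientation k N}
  {E H : Type*} [NormedAddCommGroup E] [NormedSpace ℝ E] [TopologicalSpace H]
  {G : Type*} [TopologicalSpace G] [ChartedSpace H G] [Group G]
  [MulAction G Z] [MulAction G N]

/-- The induced action on the quotient is by oriented isometries. -/
theorem ActsByOrientedIsometries.quotient (I : ModelWithCorners ℝ E H)
    [ContMDiffSMul I (𝓡 (k + 1)) ∞ G Z] [ContMDiffSMul I (𝓡 k) ∞ G N]
    [ContMDiffSMul (𝓡 1) (𝓡 (k + 1)) ∞ Circle Z] (hiso : ActsByOrientedIsometries G g o)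
    (hq : IsCircleQuotient (k + 1) k π) (h : ∀ (a : G) (x : Z), a • π x = π (a • x))
    (hgenG : ∀ (a : G) (x : Z), mfderiv (𝓡 (k + 1)) (𝓡 (k + 1)) (fun y : Z => a • y) x
      (generator (k + 1) x) = generator (k + 1) (a • x))
    (hgB : ∀ (x : Z), ∀ u ∈ normalSpace g x, ∀ v ∈ normalSpace g x,
      gB.inner (π x) (mfderiv (𝓡 (k + 1)) (𝓡 k) π x u) (mfderiv (𝓡 (k + 1)) (𝓡 k) π x v) =
        g.inner x u v)
    (hSOF : ∀ (x : Z), ∀ f ∈ SOFV g o x,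
      (mfderiv (𝓡 (k + 1)) (𝓡 k) π x).toLinearMap ∘ₗ f ∈ SOF gB oB (π x))
    (hne : ∀ x : Z, (SOFV g o x).Nonempty) : ActsByOrientedIsometries G gB oB := by
  have hiso' : ∀ (a : G) (y : N) (u v : TangentSpace (𝓡 k) y),
      gB.inner (a • y) (mfderiv (𝓡 k) (𝓡 k) (fun y : N => a • y) y u)
        (mfderiv (𝓡 k) (𝓡 k) (fun y : N => a • y) y v) = gB.inner y u v := by
    intro a y u v
    obtain ⟨x, rfl⟩ := hq.surjective y
    obtain ⟨L, hL1, hL2⟩ := hq.exists_horizontalLift g x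
    have h1 : ∀ (y : N) (_ : π (a • x) = y) (u' v' : Euc k),
        mfderiv (𝓡 (k + 1)) (𝓡 k) π (a • x) (mfderiv (𝓡 (k + 1)) (𝓡 (k + 1))
          (fun x : Z => a • x) x (L u)) = u' →
        mfderiv (𝓡 (k + 1)) (𝓡 k) π (a • x) (mfderiv (𝓡 (k + 1)) (𝓡 (k + 1))
          (fun x : Z => a • x) x (L v)) = v' → gB.inner y u' v' = g.inner x (L u) (L v) := by
      rintro _ rfl _ _ rfl rfl
      exact (hgB _ _ (hiso.mem_normalSpace hgenG a (hL2 u)) _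
        (hiso.mem_normalSpace hgenG a (hL2 v))).trans (hiso.isometry a x _ _)
    have h2 : gB.inner (π x) u v = g.inner x (L u) (L v) := by
      refine Eq.trans ?_ (hgB x _ (hL2 u) _ (hL2 v))
      exact (congrArg₂ (fun a b : Euc k => gB.inner (π x) a b) (hL1 u) (hL1 v)).symm
    rw [h2]
    refine h1 _ (h a x).symm _ _ ((hq.mfderiv_smul I h a x _).trans ?_)
      ((hq.mfderiv_smul I h a x _).trans ?_)
    · exact congrArg (mfderiv (𝓡 k) (𝓡 k) (fun y : N => a • y) (π x)) (hL1 u)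
    · exact congrArg (mfderiv (𝓡 k) (𝓡 k) (fun y : N => a • y) (π x)) (hL1 v)
  refine ⟨hiso', ?_⟩
  rintro a y b ⟨B, hB, hBo⟩
  obtain ⟨x, rfl⟩ := hq.surjective y
  obtain ⟨f, hf⟩ := hne x
  obtain ⟨-, B₁, hB₁, hB₁o⟩ := hSOF x f hf
  obtain ⟨-, hpos⟩ := hSOF _ _ (hiso.comp_mem_SOFV hq.generator_ne_zero hgenG a hf)
  have hpos' : ∀ (y : N) (_ : π (a • x) = y) (b' : Fin k → Euc k),
      (∀ i, mfderiv (𝓡 (k + 1)) (𝓡 k) π (a • x) (mfderiv (𝓡 (k + 1)) (𝓡 (k + 1))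
          (fun x : Z => a • x) x (f (EuclideanSpace.single i 1))) = b' i) →
      oB.IsPositive y b' := by
    rintro _ rfl b' hb'
    have : b' = _ := funext fun i => (hb' i).symm
    rw [this]
    exact hpos
  obtain ⟨B₂, hB₂, hB₂o⟩ := hpos' _ (h a x).symm _ fun i => hq.mfderiv_smul I h a x _
  let D : Euc k →ₗ[ℝ] Euc k := (mfderiv (𝓡 k) (𝓡 k) (fun y : N => a • y) (π x)).toLinearMap
  have hD : Function.Injective D := by
    rw [← LinearMap.ker_eq_bot, LinearMap.ker_eq_bot']
    intro v hv
    by_contra hv0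
    have h1 := hiso' a (π x) v v
    have h2 : mfderiv (𝓡 k) (𝓡 k) (fun y : N => a • y) (π x) v = 0 := hv
    rw [h2, map_zero] at h1
    exact (gB.pos (π x) v hv0).ne h1
  let e : Euc k ≃ₗ[ℝ] Euc k := LinearEquiv.ofInjectiveEndo D hD
  let B' : Module.Basis (Fin k) ℝ (Euc k) := B
  let B₁' : Module.Basis (Fin k) ℝ (Euc k) := B₁
  refine ⟨B'.map e, fun i => congrArg D (hB i), ?_⟩
  change (B'.map e).orientation = oB.orientation (a • π x)
  have h2 : B₁'.map e = B₂ := Module.Basis.eq_of_apply_eq fun i =>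
    (congrArg D (hB₁ i)).trans (hB₂ i).symm
  refine Eq.trans ?_ ((congrArg Module.Basis.orientation h2).trans hB₂o)
  refine (Module.Basis.orientation_map B' e).trans (Eq.trans ?_
    (Module.Basis.orientation_map B₁' e).symm)
  exact congrArg (Orientation.map (Fin k) e) (hBo.trans hB₁o.symm)

variable [MulAction Circle P'] [MulAction G P']
  {PB : Type*} [TopologicalSpace PB] [ChartedSpace (Euc (spinCDim k k)) PB] {q : P' → PB}
  [IsManifold (𝓡 (spinCDim k k)) ∞ PB] [MulAction G PB] {S' : SpinCStructure k (SOFV g o) P'}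

theorem quotSpinC_isEquivariant {I : ModelWithCorners ℝ E H} (hq : IsCircleQuotient (k + 1) k π)
    (hqP : IsCircleQuotient (spinCDim (k + 1) k) (spinCDim k k) q)
    (hS' : S'.IsEquivariant (𝓡 1) Circle)
    (hSOF : ∀ (x : Z), ∀ f ∈ SOFV g o x,
      (mfderiv (𝓡 (k + 1)) (𝓡 k) π x).toLinearMap ∘ₗ f ∈ SOF gB oB (π x))
    (hSG : S'.IsEquivariant I G) (h : ∀ (a : G) (x : Z), a • π x = π (a • x))
    (hP : ∀ (a : G) (p : P'), a • q p = q (a • p)) :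
    (quotSpinC hq hqP hS' hSOF).IsEquivariant I G := by
  have := hSG.smooth_base
  have := hSG.smooth_total
  have hsm : ContMDiffSMul I (𝓡 k) ∞ G N := hq.contMDiffSMul h
  refine ⟨hsm, hqP.contMDiffSMul hP, fun a y s => ?_, fun a y => ?_,
    fun a y v => ?_⟩
  · obtain ⟨p, rfl⟩ := hqP.surjective y
    change quotAct S' hqP _ s = a • quotAct S' hqP _ s
    rw [hP, quotAct_apply hqP hS', quotAct_apply hqP hS', hP, hSG.smul_act]
  · obtain ⟨p, rfl⟩ := hqP.surjective y
    change quotProj S' hqP π _ = a • quotProj S' hqP π _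
    rw [hP, quotProj_apply hq hqP hS', quotProj_apply hq hqP hS', h, hSG.proj_smul]
  · obtain ⟨p, rfl⟩ := hqP.surjective y
    change (⟨quotProj S' hqP π _, quotFrame S' hqP π _ v⟩ : TangentBundle (𝓡 k) N) =
      tangentMap (𝓡 k) (𝓡 k) (fun y : N => a • y)
        ⟨quotProj S' hqP π (q p), quotFrame S' hqP π (q p) v⟩
    rw [hP, quotFrame_apply hq hqP hS', quotFrame_apply hq hqP hS', hSG.frame_smul,
      hq.tangentMap_smul I h]

end QuotientGeometry

end SpinCPreq
end

/-! ### Restriction and descent of connections -/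

noncomputable section

namespace SpinCPreq

open Topology

section Curves

variable {d r : ℕ} {M : Type*} [TopologicalSpace M] [ChartedSpace (Euc d) M] [IsManifold (𝓡 d) ∞ M]
  {Q : ∀ x : M, Set (Euc r →ₗ[ℝ] TangentSpace (𝓡 d) x)} {P : Type*} [TopologicalSpace P]
  [ChartedSpace (Euc (spinCDim d r)) P] [IsManifold (𝓡 (spinCDim d r)) ∞ P]
  (S : SpinCStructure r Q P)

namespace SpinCStructure

theorem contMDiff_act_curve (p : P) {s : ℝ → SpinC r}
    (hs : ∀ l, ContDiff ℝ ∞ fun t => SpinC.coeff l (s t)) :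
    ContMDiff 𝓘(ℝ, ℝ) (𝓡 (spinCDim d r)) ∞ (fun t => S.act p (s t)) := by
  have h1 := S.act_smooth 1 (fun w => s (w 0)) fun l => (hs l).comp (by fun_prop)
  have h2 : ContMDiff 𝓘(ℝ, ℝ) 𝓘(ℝ, Euc 1) ∞ (fun t : ℝ => (WithLp.toLp 2 fun _ => t : Euc 1)) :=
    ((EuclideanSpace.equiv (Fin 1) ℝ).symm.contDiff.comp
      (contDiff_pi.2 fun _ => contDiff_id)).contMDiff
  exact h1.comp (contMDiff_const.prodMk h2)

theorem mdifferentiableAt_act_circle (p : P) (a : ℝ) :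
    MDifferentiableAt 𝓘(ℝ, ℝ) (𝓡 (spinCDim d r))
      (fun t : ℝ => S.act p (SpinC.mk 1 (Circle.exp (t * a)))) 0 := by
  refine (S.contMDiff_act_curve p (fun l => ?_) 0).mdifferentiableAt (by simp)
  simp only [SpinC.coeff_mk, Circle.coe_exp]
  have : ContDiff ℝ ∞ fun t : ℝ => ((t * a : ℝ) : ℂ) :=
    Complex.ofRealCLM.contDiff.comp (contDiff_id.mul contDiff_const)
  exact ((this.mul contDiff_const).cexp).mul contDiff_const

theorem mdifferentiableAt_act_spin (p : P) (γ : Multiplicative ℝ →* Spin r)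
    (hγ : ∀ l : Module.Dual ℝ (Cl r), ContDiff ℝ ∞ fun t : ℝ =>
      l (γ (Multiplicative.ofAdd t) : Cl r)) :
    MDifferentiableAt 𝓘(ℝ, ℝ) (𝓡 (spinCDim d r))
      (fun t : ℝ => S.act p (SpinC.mk (γ (Multiplicative.ofAdd t)) 1)) 0 := by
  refine (S.contMDiff_act_curve p (fun l => ?_) 0).mdifferentiableAt (by simp)
  simp only [SpinC.coeff_mk]
  exact contDiff_const.mul (Complex.ofRealCLM.contDiff.comp (hγ l))

/-- The projection has smooth local sections through all points. -/
theorem hasSmoothSections : HasSmoothSections (m := spinCDim d r) (d := d) S.proj := by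
  refine ⟨S.proj_smooth, fun p => ?_⟩
  obtain ⟨U, hU, hxU, σ, τ, hσ, hσs, hτ, -⟩ := S.locally_trivial (S.proj p)
  exact ⟨U, hU, hxU, fun x => S.act (σ x) (τ p),
    (S.contMDiff_act_right (τ p)).comp_contMDiffOn hσs, hτ p hxU, fun x hx => by
      rw [S.proj_act, hσ x hx]⟩

end SpinCStructure

end Curves

theorem DForm.pullback_pullback_comm {a b r : ℕ} {M N : Type*} [TopologicalSpace M]
    [ChartedSpace (Euc a) M] [TopologicalSpace N] [ChartedSpace (Euc b) N] {F : Type*}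
    [NormedAddCommGroup F] [NormedSpace ℝ F] {j : M → N} {f : M → M} {h : N → N}
    (hj : ContMDiff (𝓡 a) (𝓡 b) ∞ j) (hf : ContMDiff (𝓡 a) (𝓡 a) ∞ f)
    (hh : ContMDiff (𝓡 b) (𝓡 b) ∞ h) (hcomm : ∀ x, h (j x) = j (f x)) (α : DForm b N r F) :
    DForm.pullback f (DForm.pullback (d := a) j α) =
      DForm.pullback (d := a) j (DForm.pullback (d := b) h α) := by
  have hne : (∞ : WithTop ℕ∞) ≠ 0 := by simp
  have h1 : h ∘ j = j ∘ f := funext hcomm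
  funext x
  rw [← DForm.pullback_comp_at α ((hj _).mdifferentiableAt hne) ((hf _).mdifferentiableAt hne),
    ← DForm.pullback_comp_at α ((hh _).mdifferentiableAt hne) ((hj _).mdifferentiableAt hne), h1]

section Pullback

variable {k : ℕ} {Z : Type*} [TopologicalSpace Z] [ChartedSpace (Euc (k + 1)) Z]
  [IsManifold (𝓡 (k + 1)) ∞ Z]
  {Q : ∀ x : Z, Set (Euc (k + 1) →ₗ[ℝ] TangentSpace (𝓡 (k + 1)) x)}
  {Q' : ∀ x : Z, Set (Euc k →ₗ[ℝ] TangentSpace (𝓡 (k + 1)) x)}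
  {P : Type*} [TopologicalSpace P] [ChartedSpace (Euc (spinCDim (k + 1) (k + 1))) P]
  [IsManifold (𝓡 (spinCDim (k + 1) (k + 1))) ∞ P]
  {P' : Type*} [TopologicalSpace P'] [ChartedSpace (Euc (spinCDim (k + 1) k)) P']
  [IsManifold (𝓡 (spinCDim (k + 1) k)) ∞ P']
  {S : SpinCStructure (k + 1) Q P} {S' : SpinCStructure k Q' P'}
  {θ : DForm (spinCDim (k + 1) (k + 1)) P 1 ℂ} {j : P' → P}

/-- Connection forms restrict to reductions of the structure group. -/
theorem SpinCStructure.IsConnection.pullback (hθ : S.IsConnection θ)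
    (hj : ContMDiff (𝓡 (spinCDim (k + 1) k)) (𝓡 (spinCDim (k + 1) (k + 1))) ∞ j)
    (hact : ∀ p s, j (S'.act p s) = S.act (j p) (spinCIncl k s)) :
    S'.IsConnection (DForm.pullback (d := spinCDim (k + 1) k) j θ) where
  smooth := hθ.smooth.pullback hj
  imaginary p v := hθ.imaginary _ _
  vertical p a := by
    refine (DForm.onVelocity_pullback θ ((hj _).mdifferentiableAt (by simp))
      (S'.mdifferentiableAt_act_circle p a)).trans ?_
    simp only [hact, spinCIncl_mk, map_one]
    exact hθ.vertical (j p) a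
  invariant z := by
    rw [DForm.pullback_pullback_comm hj (S'.contMDiff_act_right (SpinC.mk 1 z))
      (S.contMDiff_act_right (SpinC.mk 1 z)) (fun p => ?_), hθ.invariant]
    rw [hact, spinCIncl_mk, map_one]

theorem SpinCStructure.VanishesOnSpin.pullback (hθ : S.VanishesOnSpin θ)
    (hj : ContMDiff (𝓡 (spinCDim (k + 1) k)) (𝓡 (spinCDim (k + 1) (k + 1))) ∞ j)
    (hact : ∀ p s, j (S'.act p s) = S.act (j p) (spinCIncl k s)) :
    S'.VanishesOnSpin (DForm.pullback (d := spinCDim (k + 1) k) j θ) := by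
  intro γ hγ p
  refine (DForm.onVelocity_pullback θ ((hj _).mdifferentiableAt (by simp))
    (S'.mdifferentiableAt_act_spin p γ hγ)).trans ?_
  simp only [hact, spinCIncl_mk]
  exact hθ ((spinIncl k).comp γ) (fun l => hγ (l ∘ₗ (clIncl k).toLinearMap)) (j p)

theorem SpinCStructure.HasCurvature.pullback {form : DForm (k + 1) Z 2 ℝ}
    (hθ : S.HasCurvature θ form) (hsm : θ.IsSmooth)
    (hj : ContMDiff (𝓡 (spinCDim (k + 1) k)) (𝓡 (spinCDim (k + 1) (k + 1))) ∞ j)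
    (hproj : ∀ p, S.proj (j p) = S'.proj p) :
    S'.HasCurvature (DForm.pullback (d := spinCDim (k + 1) k) j θ) form := by
  have hne : (∞ : WithTop ℕ∞) ≠ 0 := by simp
  intro p v
  rw [DForm.extD_pullback hsm hj, DForm.pullback_apply, hθ]
  have h1 : S'.proj = S.proj ∘ j := funext fun p => (hproj p).symm
  rw [h1, DForm.pullback_comp_at form ((S.proj_smooth _).mdifferentiableAt hne)
    ((hj _).mdifferentiableAt hne)]
  rfl

end Pullback

section Descent

variable {k : ℕ} {Z : Type*} [TopologicalSpace Z] [ChartedSpace (Euc (k + 1)) Z]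
  [IsManifold (𝓡 (k + 1)) ∞ Z]
  {Q' : ∀ x : Z, Set (Euc k →ₗ[ℝ] TangentSpace (𝓡 (k + 1)) x)}
  {P' : Type*} [TopologicalSpace P'] [ChartedSpace (Euc (spinCDim (k + 1) k)) P']
  [IsManifold (𝓡 (spinCDim (k + 1) k)) ∞ P'] {S' : SpinCStructure k Q' P'}
  {N : Type*} [TopologicalSpace N] [ChartedSpace (Euc k) N] [IsManifold (𝓡 k) ∞ N]
  {Q : ∀ y : N, Set (Euc k →ₗ[ℝ] TangentSpace (𝓡 k) y)}
  {PB : Type*} [TopologicalSpace PB] [ChartedSpace (Euc (spinCDim k k)) PB]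
  [IsManifold (𝓡 (spinCDim k k)) ∞ PB] {SB : SpinCStructure k Q PB}
  {q : P' → PB} {θB : DForm (spinCDim k k) PB 1 ℂ}

/-- A smooth form whose pullback by the quotient map is a connection form is a connection form. -/
theorem SpinCStructure.IsConnection.descend (hsmB : θB.IsSmooth)
    (hq : HasSmoothSections (m := spinCDim (k + 1) k) (d := spinCDim k k) q)
    (hsurj : Function.Surjective q)
    (hact : ∀ p s, SB.act (q p) s = q (S'.act p s))
    (hθ : S'.IsConnection (DForm.pullback (d := spinCDim (k + 1) k) q θB)) :
    SB.IsConnection θB where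
  smooth := hsmB
  imaginary y v := by
    obtain ⟨p, rfl⟩ := hsurj y
    choose w hw using fun i => hq.surjective_mfderiv p (v i)
    have h := hθ.imaginary p w
    rw [DForm.pullback_apply] at h
    simpa only [hw] using h
  vertical y a := by
    obtain ⟨p, rfl⟩ := hsurj y
    have h := hθ.vertical p a
    rw [DForm.onVelocity_pullback θB ((hq.contMDiff _).mdifferentiableAt (by simp))
      (S'.mdifferentiableAt_act_circle p a)] at h
    simpa only [hact] using h
  invariant z := by
    refine DForm.pullback_injective hsurj hq.surjective_mfderiv ?_
    rw [← DForm.pullback_pullback_comm hq.contMDiff (S'.contMDiff_act_right (SpinC.mk 1 z))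
      (SB.contMDiff_act_right (SpinC.mk 1 z)) (fun p => hact p _), hθ.invariant]

theorem SpinCStructure.VanishesOnSpin.descend
    (hq : HasSmoothSections (m := spinCDim (k + 1) k) (d := spinCDim k k) q)
    (hsurj : Function.Surjective q)
    (hact : ∀ p s, SB.act (q p) s = q (S'.act p s))
    (hθ : S'.VanishesOnSpin (DForm.pullback (d := spinCDim (k + 1) k) q θB)) :
    SB.VanishesOnSpin θB := by
  intro γ hγ y
  obtain ⟨p, rfl⟩ := hsurj y
  have h := hθ γ hγ p
  rw [DForm.onVelocity_pullback θB ((hq.contMDiff _).mdifferentiableAt (by simp))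
    (S'.mdifferentiableAt_act_spin p γ hγ)] at h
  simpa only [hact] using h

theorem SpinCStructure.HasCurvature.descend {π : Z → N} {formB : DForm k N 2 ℝ}
    (hsmB : θB.IsSmooth)
    (hq : HasSmoothSections (m := spinCDim (k + 1) k) (d := spinCDim k k) q)
    (hsurj : Function.Surjective q) (hπ : ContMDiff (𝓡 (k + 1)) (𝓡 k) ∞ π)
    (hproj : ∀ p, SB.proj (q p) = π (S'.proj p))
    (hθ : S'.HasCurvature (DForm.pullback (d := spinCDim (k + 1) k) q θB)
      (DForm.pullback (d := k + 1) π formB)) : SB.HasCurvature θB formB := by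
  have hne : (∞ : WithTop ℕ∞) ≠ 0 := by simp
  intro y v
  obtain ⟨p, rfl⟩ := hsurj y
  choose w hw using fun i => hq.surjective_mfderiv p (v i)
  have h := hθ p w
  rw [DForm.extD_pullback hsmB hq.contMDiff, DForm.pullback_apply] at h
  have h1 : π ∘ S'.proj = SB.proj ∘ q := funext fun p => (hproj p).symm
  rw [← DForm.pullback_comp_at formB ((hπ _).mdifferentiableAt hne)
    ((S'.proj_smooth _).mdifferentiableAt hne), h1,
    DForm.pullback_comp_at formB ((SB.proj_smooth _).mdifferentiableAt hne)
    ((hq.contMDiff _).mdifferentiableAt hne), DForm.pullback_apply q] at h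
  simpa only [hw] using h

variable [MulAction Circle P'] [ContMDiffSMul (𝓡 1) (𝓡 (spinCDim (k + 1) k)) ∞ Circle P']
  [MulAction Circle Z]

/-- If a connection descends to the quotient, then its curvature is horizontal. -/
theorem SpinCStructure.HasCurvature.eq_zero_of_eq_generator {form : DForm (k + 1) Z 2 ℝ}
    (hqP : IsCircleQuotient (spinCDim (k + 1) k) (spinCDim k k) q) (hsmB : θB.IsSmooth)
    (hprojS : ∀ (c : Circle) p, S'.proj (c • p) = c • S'.proj p)
    (hθ : S'.HasCurvature (DForm.pullback (d := spinCDim (k + 1) k) q θB) form) (x : Z)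
    (v : Fin 2 → Euc (k + 1)) (i : Fin 2) (hv : v i = generator (k + 1) x) : form x v = 0 := by
  obtain ⟨p, rfl⟩ := S'.proj_surjective x
  choose w hw using fun i => S'.hasSmoothSections.surjective_mfderiv p (v i)
  have hgen := mfderiv_generator ((S'.proj_smooth p).mdifferentiableAt (by simp)) hprojS
  let w' : Fin 2 → TangentSpace (𝓡 (spinCDim (k + 1) k)) p :=
    Function.update w i (generator (spinCDim (k + 1) k) p)
  have hw' : ∀ l, mfderiv (𝓡 (spinCDim (k + 1) k)) (𝓡 (k + 1)) S'.proj p (w' l) = v l := by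
    intro l
    by_cases hl : l = i
    · subst hl
      rw [show w' l = generator (spinCDim (k + 1) k) p from Function.update_self _ _ _]
      exact hgen.trans hv.symm
    · rw [show w' l = w l from Function.update_of_ne hl _ _, hw]
  have h := hθ p w'
  rw [DForm.extD_pullback hsmB hqP.sections.contMDiff, DForm.pullback_apply] at h
  rw [ContinuousAlternatingMap.map_coord_zero _ i (by
    rw [show w' i = generator (spinCDim (k + 1) k) p from Function.update_self _ _ _]
    exact hqP.mfderiv_apply_generator p)] at h
  have h2 : DForm.pullback (d := spinCDim (k + 1) k) S'.proj form p w' = form (S'.proj p) v := by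
    rw [DForm.pullback_apply]
    exact congrArg (form (S'.proj p)) (funext hw')
  rw [h2] at h
  have h3 := h.symm
  rw [mul_eq_zero, neg_eq_zero, or_iff_right Complex.I_ne_zero] at h3
  exact_mod_cast h3

end Descent

end SpinCPreq
end

/-! ### Reduction of a prequantization -/

theorem SpinCPreq.orbitMk_eq_iff {Z : Type*} [MulAction Circle Z] (x y : Z) :
    orbitMk Z x = orbitMk Z y ↔ ∃ c : Circle, c • x = y := by
  rw [eq_comm]
  exact Quotient.eq

theorem SpinCPreq.etaQuot_eq_iff {k : ℕ} {Z : Type*} [TopologicalSpace Z]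
    [ChartedSpace (Euc (k + 1)) Z] [IsManifold (𝓡 (k + 1)) ∞ Z] [MulAction Circle Z]
    {g : RiemMetric (k + 1) Z} {o : ManifoldOrientation (k + 1) Z}
    {P : Type*} [TopologicalSpace P] [ChartedSpace (Euc (spinCDim (k + 1) (k + 1))) P]
    [IsManifold (𝓡 (spinCDim (k + 1) (k + 1))) ∞ P] [MulAction Circle P]
    {S : SpinCStructure (k + 1) (SOF g o) P} [MulAction Circle (EtaPullback S)]
    (hcoe : ∀ (c : Circle) (p : EtaPullback S), ((c • p : EtaPullback S) : P) = c • (p : P))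
    (p p' : EtaPullback S) : etaQuot S p = etaQuot S p' ↔ ∃ c : Circle, c • p = p' := by
  rw [eq_comm]
  refine Quotient.eq.trans ⟨?_, ?_⟩
  · rintro ⟨c, hc⟩
    exact ⟨c, Subtype.ext ((hcoe c p).trans hc)⟩
  · rintro ⟨c, rfl⟩
    exact ⟨c, (hcoe c p).symm⟩

theorem proposition3p1 {k : ℕ} (hk : 1 ≤ k)
    -- a Lie group `G`
    {E : Type*} [NormedAddCommGroup E] [NormedSpace ℝ E] [FiniteDimensional ℝ E]
    {G : Type*} [TopologicalSpace G] [ChartedSpace E G] [Group G] [LieGroup 𝓘(ℝ, E) ∞ G]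
    -- an oriented Riemannian manifold `Z` of dimension `n = k + 1`, with a 2-form
    {Z : Type*} [TopologicalSpace Z] [T2Space Z] [SecondCountableTopology Z]
    [ChartedSpace (Euc (k + 1)) Z] [IsManifold (𝓡 (k + 1)) ∞ Z]
    (g : RiemMetric (k + 1) Z) (o : ManifoldOrientation (k + 1) Z) (form : DForm (k + 1) Z 2 ℝ)
    -- a `G`- and `S¹`-equivariant spinᶜ prequantization `(P, θ)` of `(Z, form)`
    {P : Type*} [TopologicalSpace P] [T2Space P] [SecondCountableTopology P]
    [ChartedSpace (Euc (spinCDim (k + 1) (k + 1))) P]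
    [IsManifold (𝓡 (spinCDim (k + 1) (k + 1))) ∞ P]
    [MulAction G Z] [MulAction Circle Z] [MulAction G P] [MulAction Circle P]
    (S : SpinCStructure (k + 1) (SOF g o) P) (θ : DForm (spinCDim (k + 1) (k + 1)) P 1 ℂ)
    (hG : IsEquivariantPrequantization 𝓘(ℝ, E) G g o form S θ)
    (hS : IsEquivariantPrequantization (𝓡 1) Circle g o form S θ)
    -- the two actions commute, and `S¹` acts freely on `Z`
    (hcommZ : ∀ (a : G) (c : Circle) (x : Z), a • c • x = c • a • x)
    (hcommP : ∀ (a : G) (c : Circle) (p : P), a • c • p = c • a • p)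
    (hfree : ∀ (c : Circle) (x : Z), c • x = x → c = 1) :
    -- the manifold structures of `η^*(P)`, `Z / S¹` and `P̄ = η^*(P) / S¹`
    ∃ (_ : ChartedSpace (Euc (spinCDim (k + 1) k)) (EtaPullback S))
      (_ : IsManifold (𝓡 (spinCDim (k + 1) k)) ∞ (EtaPullback S))
      (_ : ChartedSpace (Euc k) (OrbitSpace Z)) (_ : IsManifold (𝓡 k) ∞ (OrbitSpace Z))
      (_ : ChartedSpace (Euc (spinCDim k k)) (EtaQuotient S))
      (_ : IsManifold (𝓡 (spinCDim k k)) ∞ (EtaQuotient S)),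
      Manifold.IsSmoothEmbedding (𝓡 (spinCDim (k + 1) k)) (𝓡 (spinCDim (k + 1) (k + 1))) ∞
        (Subtype.val : EtaPullback S → P) ∧
      Manifold.IsSubmersion (𝓡 (k + 1)) (𝓡 k) ∞ (orbitMk Z) ∧
      Manifold.IsSubmersion (𝓡 (spinCDim (k + 1) k)) (𝓡 (spinCDim k k)) ∞ (etaQuot S) ∧
      T2Space (OrbitSpace Z) ∧ SecondCountableTopology (OrbitSpace Z) ∧
      T2Space (EtaQuotient S) ∧ SecondCountableTopology (EtaQuotient S) ∧
    -- the induced group actions on them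
    ∃ (_ : MulAction Circle (EtaPullback S)) (_ : MulAction G (EtaPullback S))
      (_ : MulAction G (OrbitSpace Z)) (_ : MulAction G (EtaQuotient S)),
      (∀ (c : Circle) (p : EtaPullback S), ((c • p : EtaPullback S) : P) = c • (p : P)) ∧
      (∀ (a : G) (p : EtaPullback S), ((a • p : EtaPullback S) : P) = a • (p : P)) ∧
      (∀ (a : G) (x : Z), a • orbitMk Z x = orbitMk Z (a • x)) ∧
      (∀ (a : G) (p : EtaPullback S), a • etaQuot S p = etaQuot S (a • p)) ∧
    -- the quotient metric and orientation of `Z / S¹`, for which `SOF(V) / S¹ ≅ SOF(Z / S¹)`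
    ∃ (gB : RiemMetric k (OrbitSpace Z)) (oB : ManifoldOrientation k (OrbitSpace Z)),
      (∀ (x : Z), ∀ u ∈ normalSpace g x, ∀ v ∈ normalSpace g x,
        gB.inner (orbitMk Z x) (mfderiv (𝓡 (k + 1)) (𝓡 k) (orbitMk Z) x u)
          (mfderiv (𝓡 (k + 1)) (𝓡 k) (orbitMk Z) x v) = g.inner x u v) ∧
      (∀ (x : Z) (f : Euc k →ₗ[ℝ] TangentSpace (𝓡 (k + 1)) x), (∀ u, f u ∈ normalSpace g x) →
        (f ∈ SOFV g o x ↔ (mfderiv (𝓡 (k + 1)) (𝓡 k) (orbitMk Z) x).toLinearMap ∘ₗ f ∈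
          SOF gB oB (orbitMk Z x))) ∧
    -- the spinᶜ structures `η^*(P) → SOF(V) → Z` and `P̄ → SOF(Z / S¹) → Z / S¹`
    ∃ (S' : SpinCStructure k (SOFV g o) (EtaPullback S))
      (SB : SpinCStructure k (SOF gB oB) (EtaQuotient S)),
      ((∀ (p : EtaPullback S) (s : SpinC k), ((S'.act p s : EtaPullback S) : P) =
          S.act p (spinCIncl k s)) ∧
        (∀ (p : EtaPullback S) (v : Euc k),
          (⟨S'.proj p, S'.frame p v⟩ : TangentBundle (𝓡 (k + 1)) Z) =
            ⟨S.proj p, S.frame p (incl k v)⟩) ∧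
        S'.IsEquivariant (𝓡 1) Circle ∧ S'.IsEquivariant 𝓘(ℝ, E) G) ∧
      ((∀ (p : EtaPullback S) (s : SpinC k), SB.act (etaQuot S p) s = etaQuot S (S'.act p s)) ∧
        (∀ (p : EtaPullback S) (v : Euc k),
          (⟨SB.proj (etaQuot S p), SB.frame (etaQuot S p) v⟩ :
              TangentBundle (𝓡 k) (OrbitSpace Z)) =
            tangentMap (𝓡 (k + 1)) (𝓡 k) (orbitMk Z) ⟨S'.proj p, S'.frame p v⟩) ∧
        SB.IsEquivariant 𝓘(ℝ, E) G) ∧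
    -- the pulled-back 1-form `θ'`
    ∃ θ' : DForm (spinCDim (k + 1) k) (EtaPullback S) 1 ℂ,
      θ' = DForm.pullback (Subtype.val : EtaPullback S → P) θ ∧
      -- part 1
      (S'.IsConnection θ' ∧ S'.HasCurvature θ' form ∧ S'.VanishesOnSpin θ') ∧
      -- part 2: the connection descends if and only if it vanishes on the generator
      ((∃ θB : DForm (spinCDim k k) (EtaQuotient S) 1 ℂ,
          SB.IsConnection θB ∧ θ' = DForm.pullback (etaQuot S) θB) ↔
        ∀ p : EtaPullback S, θ' p (fun _ => generator (spinCDim (k + 1) k) p) = 0) ∧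
      -- and then it is a prequantization of the quotient
      ((∀ p : EtaPullback S, θ' p (fun _ => generator (spinCDim (k + 1) k) p) = 0) →
        ∃ formB : DForm k (OrbitSpace Z) 2 ℝ, form = DForm.pullback (orbitMk Z) formB ∧
          ∀ θB : DForm (spinCDim k k) (EtaQuotient S) 1 ℂ,
            SB.IsConnection θB → θ' = DForm.pullback (etaQuot S) θB →
              IsEquivariantPrequantization 𝓘(ℝ, E) G gB oB formB SB θB) := by
  have smZ : ContMDiffSMul (𝓡 1) (𝓡 (k + 1)) ∞ Circle Z := hS.equivariant.smooth_base
  have smGZ : ContMDiffSMul 𝓘(ℝ, E) (𝓡 (k + 1)) ∞ G Z := hG.equivariant.smooth_base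
  have smGP : ContMDiffSMul 𝓘(ℝ, E) (𝓡 (spinCDim (k + 1) (k + 1))) ∞ G P :=
    hG.equivariant.smooth_total
  have smP : ContMDiffSMul (𝓡 1) (𝓡 (spinCDim (k + 1) (k + 1))) ∞ Circle P :=
    hS.equivariant.smooth_total
  have hgen : ∀ x : Z, generator (k + 1) x ≠ 0 := generator_ne_zero hfree
  have hgenG : ∀ (a : G) (x : Z), mfderiv (𝓡 (k + 1)) (𝓡 (k + 1)) (fun y : Z => a • y) x
      (generator (k + 1) x) = generator (k + 1) (a • x) := fun a x =>
    mfderiv_generator ((contMDiff_smul_left 𝓘(ℝ, E) a x).mdifferentiableAt (by simp))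
      fun c y => hcommZ a c y
  obtain ⟨csE, ismE, hemb, he⟩ := exists_isManifold_etaPullback (S := S) hgen
  let actC : MulAction Circle (EtaPullback S) :=
    etaMulAction hgen (frameCoord_smul hS.isometries hS.equivariant mfderiv_smul_generator)
  let actG : MulAction G (EtaPullback S) :=
    etaMulAction hgen (frameCoord_smul hG.isometries hG.equivariant hgenG)
  have hcoeC : ∀ (c : Circle) (p : EtaPullback S), ((c • p : EtaPullback S) : P) = c • (p : P) :=
    fun _ _ => rfl
  have hcoeG : ∀ (a : G) (p : EtaPullback S), ((a • p : EtaPullback S) : P) = a • (p : P) :=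
    fun _ _ => rfl
  let S' := etaSpinC he hk hgen
  have hS'C : S'.IsEquivariant (𝓡 1) Circle :=
    etaSpinC_isEquivariant he hk hgen hS.equivariant hcoeC
  have hS'G : S'.IsEquivariant 𝓘(ℝ, E) G := etaSpinC_isEquivariant he hk hgen hG.equivariant hcoeG
  have smE : ContMDiffSMul (𝓡 1) (𝓡 (spinCDim (k + 1) k)) ∞ Circle (EtaPullback S) :=
    hS'C.smooth_total
  have smGE : ContMDiffSMul 𝓘(ℝ, E) (𝓡 (spinCDim (k + 1) k)) ∞ G (EtaPullback S) :=
    hS'G.smooth_total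
  have hfreeE : ∀ (c : Circle) (p : EtaPullback S), c • p = p → c = 1 := fun c p hc =>
    hfree c (S'.proj p) (by rw [← hS'C.proj_smul, hc])
  have contZ : ContinuousSMul Circle Z :=
    ⟨(contMDiff_smul (I := 𝓡 1) (I' := 𝓡 (k + 1)) (n := ∞) (G := Circle) (M := Z)).continuous⟩
  have contE : ContinuousSMul Circle (EtaPullback S) :=
    ⟨(contMDiff_smul (I := 𝓡 1) (I' := 𝓡 (spinCDim (k + 1) k)) (n := ∞) (G := Circle)
      (M := EtaPullback S)).continuous⟩
  have hπ : IsOpenQuotientMap (orbitMk Z) :=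
    isOpenQuotientMap_of_orbits isQuotientMap_quot_mk orbitMk_eq_iff
  have hπE : IsOpenQuotientMap (etaQuot S) :=
    isOpenQuotientMap_of_orbits isQuotientMap_quot_mk (etaQuot_eq_iff hcoeC)
  obtain ⟨csN, ismN, hsubN, hq⟩ :=
    exists_isCircleQuotient (m := k + 1) (d := k) rfl hπ orbitMk_eq_iff hfree
  obtain ⟨csB, ismB, hsubB, hqP⟩ := exists_isCircleQuotient (m := spinCDim (k + 1) k)
    (d := spinCDim k k) (by simp only [spinCDim]; omega) hπE (etaQuot_eq_iff hcoeC) hfreeE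
  obtain ⟨actGN, hGN⟩ := hq.exists_mulAction hcommZ
  obtain ⟨actGB, hGB⟩ := hqP.exists_mulAction (G := G)
    fun a c p => Subtype.ext (hcommP a c p)
  obtain ⟨gB, hgB⟩ := hq.exists_riemMetric hS.isometries
  obtain ⟨oB, hoB⟩ := hq.exists_orientation hS.isometries (hq.exists_normalFrames S') gB hgB
  have hSOF : ∀ (x : Z), ∀ f ∈ SOFV g o x,
      (mfderiv (𝓡 (k + 1)) (𝓡 k) (orbitMk Z) x).toLinearMap ∘ₗ f ∈ SOF gB oB (orbitMk Z x) :=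
    fun x f hf => (hoB x f hf.1).1 hf
  have hSne : ∀ x : Z, (SOFV g o x).Nonempty := fun x => by
    obtain ⟨p, rfl⟩ := S'.proj_surjective x
    exact ⟨_, S'.frame_mem p⟩
  let SB := quotSpinC hq hqP hS'C hSOF
  have hSBG : SB.IsEquivariant 𝓘(ℝ, E) G := quotSpinC_isEquivariant hq hqP hS'C hSOF hS'G hGN hGB
  have smGN : ContMDiffSMul 𝓘(ℝ, E) (𝓡 k) ∞ G (OrbitSpace Z) := hSBG.smooth_base
  have smGB : ContMDiffSMul 𝓘(ℝ, E) (𝓡 (spinCDim k k)) ∞ G (EtaQuotient S) := hSBG.smooth_total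
  have hact : ∀ (p : EtaPullback S) (s : SpinC k),
      SB.act (etaQuot S p) s = etaQuot S (S'.act p s) :=
    quotAct_apply hqP hS'C
  have hproj : ∀ p : EtaPullback S, SB.proj (etaQuot S p) = orbitMk Z (S'.proj p) :=
    quotProj_apply hq hqP hS'C
  have scE : SecondCountableTopology (EtaPullback S) :=
    Topology.IsEmbedding.subtypeVal.secondCountableTopology
  let θ' : DForm (spinCDim (k + 1) k) (EtaPullback S) 1 ℂ :=
    DForm.pullback (Subtype.val : EtaPullback S → P) θ
  have hθ'C : S'.IsConnection θ' := hS.connection.pullback he.contMDiff_coe fun _ _ => rfl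
  have hθ'V : S'.VanishesOnSpin θ' := hS.vanishesOnSpin.pullback he.contMDiff_coe fun _ _ => rfl
  have hθ'K : S'.HasCurvature θ' form :=
    hS.curvature.pullback hS.connection.smooth he.contMDiff_coe fun _ => rfl
  have hθ'circle : ∀ c : Circle, DForm.pullback (fun p : EtaPullback S => c • p) θ' = θ' := by
    intro c
    have h := DForm.pullback_pullback_comm (f := fun p : EtaPullback S => c • p)
      (h := fun p : P => c • p) he.contMDiff_coe (contMDiff_circle_smul c)
      (contMDiff_circle_smul c) (fun _ => rfl) θ
    rwa [hS.invariant c] at h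
  have hθ'G : ∀ a : G, DForm.pullback (fun p : EtaPullback S => a • p) θ' = θ' := by
    intro a
    have h := DForm.pullback_pullback_comm (f := fun p : EtaPullback S => a • p)
      (h := fun p : P => a • p) he.contMDiff_coe (contMDiff_smul_left 𝓘(ℝ, E) a)
      (contMDiff_smul_left 𝓘(ℝ, E) a) (fun _ => rfl) θ
    rwa [hG.invariant a] at h
  have hθ's : ∀ s : SpinC k, DForm.pullback (fun p : EtaPullback S => S'.act p s) θ' = θ' := by
    intro s
    have h := DForm.pullback_pullback_comm (f := fun p : EtaPullback S => S'.act p s)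
      (h := fun p : P => S.act p (spinCIncl k s)) he.contMDiff_coe (S'.contMDiff_act_right s)
      (S.contMDiff_act_right _) (fun _ => rfl) θ
    rwa [hS.spinC_invariant] at h
  have hdescend : (∀ p : EtaPullback S, θ' p (fun _ => generator (spinCDim (k + 1) k) p) = 0) →
      ∃ θB : DForm (spinCDim k k) (EtaQuotient S) 1 ℂ,
        SB.IsConnection θB ∧ θ' = DForm.pullback (etaQuot S) θB := by
    intro h0
    obtain ⟨θB, hsmB, hθB⟩ := hqP.exists_pullback_eq hθ'C.smooth hθ'circle fun p v i hv => by
      have h1 : v = fun _ => generator (spinCDim (k + 1) k) p := funext fun l => by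
        rw [Subsingleton.elim l i, hv]
      rw [h1]
      exact h0 p
    refine ⟨θB, ?_, hθB⟩
    rw [hθB] at hθ'C
    exact hθ'C.descend hsmB hqP.sections hqP.surjective hact
  refine ⟨csE, ismE, csN, ismN, csB, ismB, hemb, hsubN, hsubB, t2Space_of_orbits hπ orbitMk_eq_iff,
    hπ.isQuotientMap.secondCountableTopology hπ.isOpenMap,
    t2Space_of_orbits hπE (etaQuot_eq_iff hcoeC),
    hπE.isQuotientMap.secondCountableTopology hπE.isOpenMap, actC, actG, actGN, actGB, hcoeC, hcoeG,
    hGN, hGB, gB, oB, hgB, hoB, S', SB, ⟨fun _ _ => rfl, fun _ _ => rfl, hS'C, hS'G⟩,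
    ⟨hact, quotFrame_apply hq hqP hS'C, hSBG⟩, θ', rfl, ⟨hθ'C, hθ'K, hθ'V⟩, ⟨?_, hdescend⟩, ?_⟩
  · rintro ⟨θB, -, hθB⟩ p
    rw [hθB, DForm.pullback_apply]
    exact ContinuousAlternatingMap.map_coord_zero _ 0 (hqP.mfderiv_apply_generator p)
  · intro h0
    obtain ⟨θ₀, hθ₀C, hθ₀⟩ := hdescend h0
    -- the form is horizontal, since `dθ'` is the pullback of `dθ₀`
    obtain ⟨formB, hsmB, hformB⟩ := hq.exists_pullback_eq hS.form_smooth hS.form_invariant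
      (SpinCStructure.HasCurvature.eq_zero_of_eq_generator (S' := S') hqP hθ₀C.smooth
        hS'C.proj_smul (by rw [← hθ₀]; exact hθ'K))
    refine ⟨formB, hformB, fun θB hθBC hθB => ?_⟩
    -- pullbacks along `orbitMk Z` and `etaQuot S` are injective, so that the identities between
    -- forms on the quotients follow from those on `Z` and on `η^*(P)`
    have hsurjE := hqP.sections.surjective_mfderiv
    have hsurjN := hq.sections.surjective_mfderiv
    refine ⟨hG.isometries.quotient 𝓘(ℝ, E) hq hGN hgenG hgB hSOF hSne, hsmB, ?_, fun a => ?_, hSBG,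
      hθBC, fun a => ?_, fun s => ?_, ?_, ?_⟩
    · refine congrFun (DForm.pullback_injective (β := fun _ => 0) hq.surjective hsurjN ?_)
      rw [← DForm.extD_pullback hsmB hq.sections.contMDiff, ← hformB]
      funext x
      rw [hS.form_closed x]
      rfl
    · refine DForm.pullback_injective hq.surjective hsurjN ?_
      rw [← DForm.pullback_pullback_comm hq.sections.contMDiff (contMDiff_smul_left 𝓘(ℝ, E) a)
        (contMDiff_smul_left 𝓘(ℝ, E) a) (hGN a), ← hformB, hG.form_invariant]
    · refine DForm.pullback_injective hqP.surjective hsurjE ?_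
      rw [← DForm.pullback_pullback_comm hqP.sections.contMDiff (contMDiff_smul_left 𝓘(ℝ, E) a)
        (contMDiff_smul_left 𝓘(ℝ, E) a) (hGB a), ← hθB, hθ'G]
    · refine DForm.pullback_injective hqP.surjective hsurjE ?_
      rw [← DForm.pullback_pullback_comm hqP.sections.contMDiff (S'.contMDiff_act_right s)
        (SB.contMDiff_act_right s) (fun p => hact p s), ← hθB, hθ's]
    · rw [hθB] at hθ'V
      exact hθ'V.descend hqP.sections hqP.surjective hact
    · rw [hθB, hformB] at hθ'K
      exact hθ'K.descend hθBC.smooth hqP.sections hqP.surjective hq.sections.contMDiff hproj
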